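/- Let $\Omega\subset\mathbb R^2$ be a domain (bounded or exterior) with compact $C^\infty$ boundary, whose finitely many components are parametrized by arc length $s$, and let $\nu$ be the outward unit normal. Let $\kappa$ be the signed curvature of $\partial\Omega$, with the sign for which discs have positive curvature (a parametrization $s\mapsto M(s)$ has $M''=-\kappa\nu$). Assume that $\kappa$ attains its maximum $\kappa_{\max}$ at a unique point $M(s_0)$ and that $k_2:=-\kappa''(s_0)>0$. For $h>0$ let $\mathcal L_h=-h^2\Delta$ be the Robin Laplacian in $L^2(\Omega)$ with boundary condition $h^{1/2}\,\nu\cdot\nabla u=u$ on $\partial\Omega$, i.e. the self-adjoint operator associated (Friedrichs) with the closed semibounded form $u\mapsto\int_\Omega|h\nabla u|^2dx-h^{3/2}\int_{\partial\Omega}|u|^2ds$ on $H^1(\Omega)$. Then for every integer $n\ge1$ there is a real sequence $(\zeta_{j,n})_{j\ge0}$, given by a quasimode expansion as described below, such that for every integer $M\ge0$ there is, for all sufficiently small $h>0$, an eigenvalue $\widetilde\mu_n(h)$ of $\mathcal L_h$ (which may depend on $M$) with, as $h\to0_+$, $$\widetilde\mu_n(h)=-h-\kappa_{\max}h^{3/2}+(2n-1)\sqrt{\tfrac{k_2}{2}}\,h^{7/4}+h^{15/8}\sum_{j=0}^{M}\zeta_{j,n}h^{j/8}+\mathcal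 O\big(h^{(M+16)/8}\big).$$ Quasimode expansion. In the rescaled boundary coordinates $s=s_0+h^{1/8}\sigma$, $\operatorname{dist}(x,\partial\Omega)=h^{1/2}\tau$, and with $\tilde a=1-h^{1/2}\tau\,\kappa(s_0+h^{1/8}\sigma)$, one has $h^{-1}\mathcal L_h=-h^{3/4}\tilde a^{-1}\partial_\sigma(\tilde a^{-1}\partial_\sigma)-\tilde a^{-1}\partial_\tau(\tilde a\,\partial_\tau)$. Expanding the coefficients in powers of $h^{1/8}$ gives the formal series $P_0+h^{1/2}P_2+h^{3/4}P_3+h^{7/8}\sum_{j\ge0}h^{j/8}Q_j$, where $P_0=-\partial_\tau^2$, $P_2=\kappa_{\max}\partial_\tau$, $P_3=-\partial_\sigma^2-\frac{k_2}{2}\sigma^2\partial_\tau$. There are a normalized eigenfunction $f_n$ of $-\partial_\sigma^2+\frac{k_2}{2}\sigma^2$ in $L^2(\mathbb R)$ for the eigenvalue $(2n-1)\sqrt{k_2/2}$, real Schwartz functions $v_{n,j}$ ($j\ge1$) on $\mathbb R$, and real Schwartz functions $g_{n,j}$ ($j\ge0$) on $\mathbb R\times[0,\infty)$ with $\partial_\tau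 g_{n,j}=-g_{n,j}$ at $\tau=0$, such that for every $M\ge0$, with $u_0(\tau)=\sqrt2\,e^{-\tau}$ and $$\Psi_{n,M}=u_0f_n+\sum_{j=1}^{M+1}h^{j/8}u_0v_{n,j}+h^{7/8}\sum_{j=0}^Mh^{j/8}g_{n,j},$$ $$\mu_{n,M}=-1-h^{1/2}\kappa_{\max}+h^{3/4}\sqrt{\tfrac{k_2}{2}}(2n-1)+h^{7/8}\sum_{j=0}^M\zeta_{j,n}h^{j/8},$$ one has, as $h\to0_+$, $$\Big\|\Big(P_0+h^{1/2}P_2+h^{3/4}P_3+h^{7/8}\sum_{j=0}^Mh^{j/8}Q_j-\mu_{n,M}\Big)\Psi_{n,M}\Big\|_{L^2(\mathbb R\times\mathbb R_+)}=\mathcal O\big(h^{\frac78+\frac{M+1}8}\big).$$ -/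

import Mathlib

open Set Filter Topology MeasureTheory Asymptotics
open scoped ContDiff SchwartzMap ComplexConjugate Nat

noncomputable section

namespace Robin

/-- The Euclidean plane. -/
abbrev Plane : Type := EuclideanSpace ℝ (Fin 2)

/-! ### Plane domains with smooth compact boundary -/

/-- The clockwise rotation by a right angle. -/
def rotCW (w : Plane) : Plane := !₂[w 1, - w 0]

/-- An arc-length parametrization of the boundary of `Ω`: the boundary is the disjoint union of
finitely many smooth simple closed curves `M i` of length `len i`, run through at unit speed, and
`Ω` lies locally on exactly one side of each of them, namely on the left (so an outer boundary
curve is run through counterclockwise). Every open set whose boundary is compact and `C^∞`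
smooth has such a parametrization. -/
structure BoundaryParam (Ω : Set Plane) (ι : Type) where
  /-- the lengths of the boundary curves -/
  len : ι → ℝ
  /-- the boundary curves -/
  M : ι → ℝ → Plane
  len_pos : ∀ i, 0 < len i
  smooth : ∀ i, ContDiff ℝ ∞ (M i)
  periodic : ∀ i, Function.Periodic (M i) (len i)
  unit_speed : ∀ i s, ‖deriv (M i) s‖ = 1
  simple : ∀ i s j s', M i s = M j s' → i = j ∧ ∃ k : ℤ, s' = s + k * len i
  frontier_eq : frontier Ω = ⋃ i, range (M i)
  one_sided : ∀ i s, ∃ δ > 0, ∀ t ∈ Ioo (0 : ℝ) δ,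
    M i s - t • rotCW (deriv (M i) s) ∈ Ω ∧ M i s + t • rotCW (deriv (M i) s) ∉ Ω

namespace BoundaryParam

variable {Ω : Set Plane} {ι : Type}

/-- The outward unit normal at `M i s`. -/
def normal (Γ : BoundaryParam Ω ι) (i : ι) (s : ℝ) : Plane := rotCW (deriv (Γ.M i) s)

/-- The signed curvature `κ`, given by `M'' = - κ ν` with `ν` the outward unit normal; it is
positive where `Ω` is strictly convex (the disc of radius `R` has curvature `1 / R`). -/
def curvature (Γ : BoundaryParam Ω ι) (i : ι) (s : ℝ) : ℝ :=
  - inner ℝ (deriv (deriv (Γ.M i)) s) (Γ.normal i s)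

/-- The arc-length measure `ds` on the boundary. -/
def arcMeasure [Fintype ι] (Γ : BoundaryParam Ω ι) : Measure Plane :=
  ∑ i, (volume.restrict (Ioc 0 (Γ.len i))).map (Γ.M i)

end BoundaryParam

/-! ### The Sobolev space `H¹(Ω)` and traces -/

/-- The partial derivative in the `i`-th coordinate direction. -/
def pderiv (i : Fin 2) (η : Plane → ℂ) (x : Plane) : ℂ :=
  fderiv ℝ η x (EuclideanSpace.single i 1)

/-- `u ∈ H¹(Ω)`, with weak gradient `G` on `Ω`. -/
structure IsWeakGrad (Ω : Set Plane) (u : Plane → ℂ) (G : Fin 2 → Plane → ℂ) : Prop where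
  memLp : MemLp u 2 (volume.restrict Ω)
  memLp_grad : ∀ i, MemLp (G i) 2 (volume.restrict Ω)
  weak : ∀ (i : Fin 2) (η : Plane → ℂ), ContDiff ℝ ∞ η → HasCompactSupport η → tsupport η ⊆ Ω →
    ∫ x in Ω, u x * pderiv i η x = - ∫ x in Ω, G i x * η x

/-- `g ∈ L²(∂Ω)` is the boundary trace of `u ∈ H¹(Ω)`, whose weak gradient is `G`: some sequence of
functions in `C_c^∞(ℝ²)` converges to `u` in `H¹(Ω)`, and its restrictions to the boundary converge
to `g` in `L²(∂Ω)`. -/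
def IsTrace {Ω : Set Plane} {ι : Type} [Fintype ι] (Γ : BoundaryParam Ω ι)
    (u : Plane → ℂ) (G : Fin 2 → Plane → ℂ) (g : Plane → ℂ) : Prop :=
  MemLp g 2 Γ.arcMeasure ∧
  ∃ η : ℕ → Plane → ℂ, (∀ k, ContDiff ℝ ∞ (η k)) ∧ (∀ k, HasCompactSupport (η k)) ∧
    Tendsto (fun k => eLpNorm (η k - u) 2 (volume.restrict Ω)) atTop (𝓝 0) ∧
    (∀ i, Tendsto (fun k => eLpNorm (pderiv i (η k) - G i) 2 (volume.restrict Ω)) atTop (𝓝 0)) ∧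
    Tendsto (fun k => eLpNorm (η k - g) 2 Γ.arcMeasure) atTop (𝓝 0)

/-! ### The semiclassical Robin Laplacian -/

/-- The graph of the semiclassical Robin Laplacian `𝓛_h = - h² Δ`, with boundary condition
`h^{1/2} ν · ∇u = u` on the boundary: the self-adjoint operator in `L²(Ω)` that the Friedrichs
theorem associates with the closed semibounded quadratic form
`u ↦ ∫_Ω |h ∇u|² - h^{3/2} ∫_{∂Ω} |u|² ds` on `H¹(Ω)`.
So `RobinLaplacian Γ h u f` says that `u` is in the domain and that `𝓛_h u = f`. -/
def RobinLaplacian {Ω : Set Plane} {ι : Type} [Fintype ι] (Γ : BoundaryParam Ω ι) (h : ℝ)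
    (u f : Plane → ℂ) : Prop :=
  MemLp f 2 (volume.restrict Ω) ∧
  ∃ (G : Fin 2 → Plane → ℂ) (g : Plane → ℂ), IsWeakGrad Ω u G ∧ IsTrace Γ u G g ∧
    ∀ (v : Plane → ℂ) (H : Fin 2 → Plane → ℂ) (k : Plane → ℂ),
      IsWeakGrad Ω v H → IsTrace Γ v H k →
      ((h ^ 2 : ℝ) : ℂ) * (∫ x in Ω, ∑ i, G i x * conj (H i x))
        - ((h ^ (3 / 2 : ℝ) : ℝ) : ℂ) * (∫ x, g x * conj (k x) ∂Γ.arcMeasure)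
        = ∫ x in Ω, f x * conj (v x)

/-- `μ` is an eigenvalue of `𝓛_h`. -/
def IsEigenvalue {Ω : Set Plane} {ι : Type} [Fintype ι] (Γ : BoundaryParam Ω ι) (h μ : ℝ) : Prop :=
  ∃ u : Plane → ℂ, ¬ (u =ᵐ[volume.restrict Ω] 0) ∧ RobinLaplacian Γ h u (fun x => (μ : ℂ) * u x)

/-! ### The operator in rescaled boundary coordinates

Let `(s, t)` be the arc-length and the distance to the boundary, and put `s = s₀ + ε σ` and
`t = ε⁴ τ` with `ε = h^{1/8}`. With `a = 1 - ε⁴ τ κ(s₀ + ε σ)` the operator `h⁻¹ 𝓛_h` reads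
`- ε⁶ a⁻¹ ∂_σ (a⁻¹ ∂_σ) - a⁻¹ ∂_τ (a ∂_τ)`
`= - ∂_τ² + (- a⁻¹ ∂_τ a) ∂_τ + (- ε⁶ a⁻²) ∂_σ² + (- ε⁶ a⁻¹ ∂_σ (a⁻¹)) ∂_σ`. -/

/-- The Jacobian `a`. -/
def jac (κ : ℝ → ℝ) (s₀ ε σ τ : ℝ) : ℝ := 1 - ε ^ 4 * τ * κ (s₀ + ε * σ)

/-- The coefficient of `∂_τ`. -/
def coefT (κ : ℝ → ℝ) (s₀ ε σ τ : ℝ) : ℝ :=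
  - (jac κ s₀ ε σ τ)⁻¹ * deriv (fun t => jac κ s₀ ε σ t) τ

/-- The coefficient of `∂_σ²`. -/
def coefSS (κ : ℝ → ℝ) (s₀ ε σ τ : ℝ) : ℝ := - ε ^ 6 * ((jac κ s₀ ε σ τ)⁻¹) ^ 2

/-- The coefficient of `∂_σ`. -/
def coefS (κ : ℝ → ℝ) (s₀ ε σ τ : ℝ) : ℝ :=
  - ε ^ 6 * (jac κ s₀ ε σ τ)⁻¹ * deriv (fun s => (jac κ s₀ ε s τ)⁻¹) σ

/-- The `k`-th Taylor coefficient at `0`. -/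
def taylorCoef (k : ℕ) (F : ℝ → ℝ) : ℝ := iteratedDeriv k F 0 / (k ! : ℝ)

/-- `∂_σ ψ`. -/
def dS (ψ : ℝ → ℝ → ℝ) (σ τ : ℝ) : ℝ := deriv (fun s => ψ s τ) σ

/-- `∂_τ ψ`. -/
def dT (ψ : ℝ → ℝ → ℝ) (σ τ : ℝ) : ℝ := deriv (fun t => ψ σ t) τ

/-- The operator `Q_j`, the coefficient of `ε^{7+j}` in the expansion of `h⁻¹ 𝓛_h`. -/
def opQ (κ : ℝ → ℝ) (s₀ : ℝ) (j : ℕ) (ψ : ℝ → ℝ → ℝ) (σ τ : ℝ) : ℝ :=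
  taylorCoef (7 + j) (fun ε => coefT κ s₀ ε σ τ) * dT ψ σ τ
    + taylorCoef (7 + j) (fun ε => coefSS κ s₀ ε σ τ) * dS (dS ψ) σ τ
    + taylorCoef (7 + j) (fun ε => coefS κ s₀ ε σ τ) * dS ψ σ τ

/-- The truncated operator `P₀ + h^{1/2} P₂ + h^{3/4} P₃ + h^{7/8} ∑_{j ≤ M} h^{j/8} Q_j`, with
`P₀ = - ∂_τ²`, `P₂ = κ(s₀) ∂_τ` and `P₃ = - ∂_σ² + (κ''(s₀) / 2) σ² ∂_τ`. -/
def opTrunc (κ : ℝ → ℝ) (s₀ : ℝ) (M : ℕ) (h : ℝ) (ψ : ℝ → ℝ → ℝ) (σ τ : ℝ) : ℝ :=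
  - dT (dT ψ) σ τ
    + h ^ (1 / 2 : ℝ) * (κ s₀ * dT ψ σ τ)
    + h ^ (3 / 4 : ℝ) * (- dS (dS ψ) σ τ + iteratedDeriv 2 κ s₀ / 2 * σ ^ 2 * dT ψ σ τ)
    + h ^ (7 / 8 : ℝ) * ∑ j ∈ Finset.range (M + 1), h ^ ((j : ℝ) / 8) * opQ κ s₀ j ψ σ τ

/-- The quasi-eigenvalue
`- 1 - h^{1/2} κ(s₀) + h^{3/4} (2n-1) √(k₂/2) + h^{7/8} ∑_{j ≤ M} ζ_j h^{j/8}`,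
`k₂ = - κ''(s₀)`, of `h⁻¹ 𝓛_h`. -/
def quasiEigenvalue (κ : ℝ → ℝ) (s₀ : ℝ) (n : ℕ) (ζ : ℕ → ℝ) (M : ℕ) (h : ℝ) : ℝ :=
  - 1 - h ^ (1 / 2 : ℝ) * κ s₀
    + h ^ (3 / 4 : ℝ) * ((2 * (n : ℝ) - 1) * √(- iteratedDeriv 2 κ s₀ / 2))
    + h ^ (7 / 8 : ℝ) * ∑ j ∈ Finset.range (M + 1), ζ j * h ^ ((j : ℝ) / 8)

/-- The transversal ground state `u₀(τ) = √2 e^{-τ}`. -/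
def u0 (τ : ℝ) : ℝ := √2 * Real.exp (- τ)

/-- The ansatz `Ψ = u₀ f + ∑_{j=1}^{M+1} h^{j/8} u₀ v_j + h^{7/8} ∑_{j=0}^{M} h^{j/8} g_j`. -/
def ansatz (f : ℝ → ℝ) (v : ℕ → ℝ → ℝ) (g : ℕ → ℝ → ℝ → ℝ) (M : ℕ) (h : ℝ) (σ τ : ℝ) : ℝ :=
  u0 τ * f σ
    + ∑ j ∈ Finset.Icc 1 (M + 1), h ^ ((j : ℝ) / 8) * (u0 τ * v j σ)
    + h ^ (7 / 8 : ℝ) * ∑ j ∈ Finset.range (M + 1), h ^ ((j : ℝ) / 8) * g j σ τ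

/-- `g` is a Schwartz function on the closed half-plane `τ ≥ 0` (a smooth function on the plane all
of whose derivatives decay rapidly on the half-plane). -/
def IsSchwartzHalf (g : ℝ → ℝ → ℝ) : Prop :=
  ContDiff ℝ ∞ (fun p : ℝ × ℝ => g p.1 p.2) ∧
  ∀ k m : ℕ, ∃ C : ℝ, ∀ p : ℝ × ℝ, 0 ≤ p.2 →
    ‖p‖ ^ k * ‖iteratedFDeriv ℝ m (fun q : ℝ × ℝ => g q.1 q.2) p‖ ≤ C

/-- The numbers `ζ_j` are the coefficients of the `n`-th quasimode expansion: there are a normalized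
eigenfunction `f` of the harmonic oscillator `- ∂_σ² + (k₂/2) σ²` for its `n`-th eigenvalue
`(2n-1) √(k₂/2)`, and real Schwartz functions `v_j` and `g_j`, the latter with the Robin condition
`∂_τ g_j = - g_j` at `τ = 0`, such that for every `M` the ansatz solves the eigenvalue equation of
the truncated operator up to `O(h^{7/8 + (M+1)/8})` in `L²` of the half-plane. -/
def IsQuasimodeExpansion (κ : ℝ → ℝ) (s₀ : ℝ) (n : ℕ) (ζ : ℕ → ℝ) : Prop :=
  ∃ (f : 𝓢(ℝ, ℝ)) (v : ℕ → 𝓢(ℝ, ℝ)) (g : ℕ → ℝ → ℝ → ℝ),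
    (∫ σ, f σ ^ 2 = 1) ∧
    (∀ σ, - iteratedDeriv 2 f σ + - iteratedDeriv 2 κ s₀ / 2 * σ ^ 2 * f σ
      = (2 * (n : ℝ) - 1) * √(- iteratedDeriv 2 κ s₀ / 2) * f σ) ∧
    (∀ j, IsSchwartzHalf (g j)) ∧
    (∀ j σ, dT (g j) σ 0 = - g j σ 0) ∧
    ∀ M : ℕ, ∃ C > 0, ∃ h₀ > 0, ∀ h ∈ Ioo (0 : ℝ) h₀,
      eLpNorm (fun p : ℝ × ℝ =>
          opTrunc κ s₀ M h (ansatz f (fun j => v j) g M h) p.1 p.2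
            - quasiEigenvalue κ s₀ n ζ M h * ansatz f (fun j => v j) g M h p.1 p.2)
        2 (volume.restrict {p : ℝ × ℝ | 0 < p.2})
        ≤ ENNReal.ofReal (C * h ^ (7 / 8 + ((M : ℝ) + 1) / 8))

end Robin

end

/-!
The eigenvalue comes from an approximate eigenfunction (quasimode), by the spectral theorem, and the
quasimode is concentrated near the point of maximal curvature. Throughout `ε = h^{1/8}`.

*From quasimodes to eigenvalues.* The form domain is the closure of the triples `(η, ∇η, η|_∂Ω)` of
test functions in `L²(Ω) × L²(Ω)² × L²(∂Ω)`. The trace is a compact operator on it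
(`isCompactOperator_trace`): up to finitely many averages, boundary values are bounded by a small
multiple of the gradient (`traceEstimate`), which follows from an elementary inequality on small
squares in boundary coordinates (`trace_square_le`). So on the negative half-line the form minus the
spectral parameter is a coercive form minus a compact one, the Fredholm alternative holds there, and
a gap of size `d` about `μ₀` without eigenvalues bounds the resolvent at `μ₀` by `1 / d`
(`mul_norm_le_of_no_eigenvalue`). Hence a test function that satisfies the weak eigenvalue equation
with a relative error less than `d` produces an eigenvalue at distance less than `d`
(`exists_isEigenvalue_near`). This covers exterior domains, whose essential spectrum is not
negative.

*The formal quasimode.* In the rescaled boundary coordinates the ansatz is a polynomial in `σ`, `τ`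
times the weight `e^{-τ - ασ²/2}`, where `α² = k₂/2`. After conjugation with the weight everything is
algebra in polynomials. The transversal equation with Robin condition is solvable up to a multiple
`c(σ)` of the ground state (`exists_transversal_solution`), and the oscillator equation for `c` is
solvable up to a multiple of the eigenfunction (`exists_oscillator_eq`), which fixes `ζ_j`. Doing
this order by order gives `exists_formal_solution`.

*Remainders.* The coefficients of the rescaled operator are functions of `(εσ, ε⁴τ)`, smooth near
the origin, so their expansions in powers of `ε` have polynomial coefficients and polynomially
bounded remainders (`exists_coef_expansion`); the weight absorbs these. This gives the quasimode
expansion on the half-plane (`QuasimodeData.isQuasimodeExpansion`), and the same bound for the full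
operator near the boundary point (`QuasimodeData.exists_full_residual_le`).

*Transport to the plane.* The ansatz is cut off at a fixed distance from the boundary point, where
the weight is smaller than all powers of `ε` (`IsPatch.exists_commutator_le`), and is composed with
the inverse of the boundary coordinates. It satisfies the Robin condition exactly, so Green's formula
(`IsPatch.weak_form`) leaves only the residual, of relative size `O(ε^{16+M})`
(`exists_quasimode`). The eigenvalue is therefore within `O(h^{(M+16)/8})` of `h` times the
quasi-eigenvalue (`exists_isEigenvalue_quasi`).
-/

noncomputable section

namespace Robin

/-! ### Self-adjoint operators defined by forms -/

section Abstract

open scoped InnerProductSpace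

variable {V L L' B : Type*}
  [NormedAddCommGroup V] [InnerProductSpace ℂ V]
  [NormedAddCommGroup L] [InnerProductSpace ℂ L] [CompleteSpace L]
  [NormedAddCommGroup L'] [InnerProductSpace ℂ L'] [CompleteSpace L']
  [NormedAddCommGroup B] [InnerProductSpace ℂ B] [CompleteSpace B]

/-- An operator that is small, in norm, up to finitely many linear functionals is compact. -/
theorem isCompactOperator_of_forall_le_add_finite (T : V →L[ℂ] B)
    (h : ∀ r > 0, ∃ (m : ℕ) (F : V →L[ℂ] (Fin m → ℂ)) (C : ℝ),
      ∀ v, ‖T v‖ ^ 2 ≤ r * ‖v‖ ^ 2 + C * ‖F v‖ ^ 2) : IsCompactOperator T := by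
  rw [show (⇑T : V → B) = ⇑(T : V →ₗ[ℂ] B) from rfl,
    isCompactOperator_iff_isCompact_closure_image_ball _ one_pos]
  refine TotallyBounded.isCompact_of_isClosed (TotallyBounded.closure ?_) isClosed_closure
  rw [Metric.totallyBounded_iff]
  intro ε hε
  -- On the unit ball `‖v - w‖ ≤ 2`, so the first term of the bound contributes at most `ε² / 4`; a
  -- finite net for the image under `F`, which is bounded in a finite-dimensional space, controls
  -- the second term.
  obtain ⟨m, F, C, hF⟩ := h (ε ^ 2 / 16) (by positivity)
  have hbd : TotallyBounded (F '' Metric.ball 0 1) := by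
    have : Bornology.IsBounded (F '' Metric.ball 0 1) :=
      Metric.isBounded_ball.image F
    exact this.isCompact_closure.totallyBounded.subset subset_closure
  obtain ⟨δ, hδ, hδC⟩ : ∃ δ > 0, |C| * δ ^ 2 < ε ^ 2 / 4 := by
    have : Tendsto (fun δ : ℝ => |C| * δ ^ 2) (𝓝[>] 0) (𝓝 (|C| * 0 ^ 2)) :=
      Tendsto.mono_left ((continuous_const.mul (continuous_pow 2)).tendsto _) nhdsWithin_le_nhds
    have h2 := (this.eventually_lt_const (u := ε ^ 2 / 4) (by
      rw [zero_pow two_ne_zero, mul_zero]; positivity)).and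
      self_mem_nhdsWithin
    obtain ⟨δ, h3, h4⟩ := h2.exists
    exact ⟨δ, h4, h3⟩
  obtain ⟨t, ht, htf, htc⟩ := (totallyBounded_iff_subset.1 hbd) _ (Metric.dist_mem_uniformity hδ)
  have ht' : ∀ y ∈ t, ∃ v, v ∈ Metric.ball 0 1 ∧ F v = y := fun y hy => ht hy
  choose! p hp hpF using ht'
  refine ⟨(fun y => T (p y)) '' t, htf.image _, ?_⟩
  rintro _ ⟨v, hv, rfl⟩
  obtain ⟨y, hy, hvy⟩ := mem_iUnion₂.1 (htc ⟨v, hv, rfl⟩)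
  refine mem_iUnion₂.2 ⟨_, ⟨y, hy, rfl⟩, ?_⟩
  have h1 := hF (v - p y)
  have h2 : ‖v - p y‖ ≤ 2 := by
    have := hp y hy
    simp only [Metric.mem_ball, dist_zero_right] at hv this
    linarith [norm_sub_le v (p y)]
  have h3 : ‖F (v - p y)‖ ≤ δ := by
    rw [map_sub, hpF y hy, ← dist_eq_norm]; exact le_of_lt hvy
  rw [map_sub] at h1
  have h4 : ε ^ 2 / 16 * ‖v - p y‖ ^ 2 ≤ ε ^ 2 / 16 * 2 ^ 2 := by gcongr
  have h5 : C * ‖F (v - p y)‖ ^ 2 ≤ |C| * δ ^ 2 := by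
    gcongr
    exact le_abs_self C
  simp only [Metric.mem_ball, dist_eq_norm, ContinuousLinearMap.coe_coe]
  refine lt_of_pow_lt_pow_left₀ 2 hε.le ?_
  nlinarith

variable [CompleteSpace V]

/-- The operator of the form `a ⟨D v, D w⟩ - b ⟨T v, T w⟩ - μ ⟨I v, I w⟩`. -/
def formOp (I : V →L[ℂ] L) (D : V →L[ℂ] L') (T : V →L[ℂ] B) (a b μ : ℝ) :
    V →L[ℂ] V :=
  (a : ℂ) • (D.adjoint ∘L D) - (b : ℂ) • (T.adjoint ∘L T) - (μ : ℂ) • (I.adjoint ∘L I)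

variable (I : V →L[ℂ] L) (D : V →L[ℂ] L') (T : V →L[ℂ] B)

theorem inner_formOp (a b μ : ℝ) (v w : V) :
    ⟪w, formOp I D T a b μ v⟫_ℂ = a * ⟪D w, D v⟫_ℂ - b * ⟪T w, T v⟫_ℂ - μ * ⟪I w, I v⟫_ℂ := by
  simp [formOp, ContinuousLinearMap.adjoint_inner_right]

theorem isSelfAdjoint_formOp (a b μ : ℝ) : IsSelfAdjoint (formOp I D T a b μ) := by
  rw [ContinuousLinearMap.isSelfAdjoint_iff_isSymmetric]
  intro v w
  simp only [ContinuousLinearMap.coe_coe]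
  rw [← inner_conj_symm, inner_formOp, inner_formOp]
  simp

/-- The Fredholm alternative for a form that is a coercive form minus a compact one. -/
theorem isUnit_formOp {C : ℝ} (hT : IsCompactOperator T)
    (hC : ∀ v, ‖v‖ ^ 2 ≤ C * (‖I v‖ ^ 2 + ‖D v‖ ^ 2)) {a b μ : ℝ} (ha : 0 < a) (hμ : μ < 0)
    (hinj : ∀ v, formOp I D T a b μ v = 0 → v = 0) : IsUnit (formOp I D T a b μ) := by
  -- The part `A` without `T` is coercive since `μ < 0`, and the whole operator is `A (1 - K)` with
  -- `K` compact.
  set A := formOp I D T a 0 μ with hA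
  have hAu : IsUnit A := by
    rcases subsingleton_or_nontrivial V with hV | hV
    · rw [ContinuousLinearMap.isUnit_iff_bijective]
      exact ⟨Function.injective_of_subsingleton _, fun x => ⟨0, Subsingleton.elim _ _⟩⟩
    have hC0 : 0 < C := by
      obtain ⟨v, hv⟩ := exists_ne (0 : V)
      have h1 := hC v
      have h2 : 0 < ‖v‖ ^ 2 := by positivity
      by_contra hcon
      push Not at hcon
      nlinarith [sq_nonneg ‖I v‖, sq_nonneg ‖D v‖]
    have hm : 0 < min a (-μ) := lt_min ha (by linarith)
    -- Lax-Milgram.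
    refine ContinuousLinearMap.isUnit_of_forall_le_norm_inner_map A
      (c := Real.toNNReal (min a (-μ) / C))
      (Real.toNNReal_pos.2 (div_pos hm hC0)) fun v => ?_
    have h1 : ⟪v, A v⟫_ℂ = ((a * ‖D v‖ ^ 2 - μ * ‖I v‖ ^ 2 : ℝ) : ℂ) := by
      rw [hA, inner_formOp]
      simp
    rw [← inner_conj_symm, RCLike.norm_conj, h1, Complex.norm_real, Real.norm_eq_abs]
    refine le_trans ?_ (le_abs_self _)
    rw [Real.coe_toNNReal _ (div_pos hm hC0).le]
    have h3 := min_le_left a (-μ)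
    have h4 := min_le_right a (-μ)
    calc ‖v‖ ^ 2 * (min a (-μ) / C) ≤ (C * (‖I v‖ ^ 2 + ‖D v‖ ^ 2)) * (min a (-μ) / C) := by
          gcongr; exact hC v
      _ = min a (-μ) * (‖I v‖ ^ 2 + ‖D v‖ ^ 2) := by field_simp
      _ ≤ a * ‖D v‖ ^ 2 - μ * ‖I v‖ ^ 2 := by
          nlinarith [sq_nonneg ‖I v‖, sq_nonneg ‖D v‖]
  obtain ⟨u, hu⟩ := hAu
  set K : V →L[ℂ] V := (↑u⁻¹ : V →L[ℂ] V) * ((b : ℂ) • (T.adjoint ∘L T)) with hK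
  have hKc : IsCompactOperator K := by
    have h1 : IsCompactOperator (T.adjoint ∘ T) := hT.clm_comp T.adjoint
    have h2 := h1.smul (b : ℂ)
    exact h2.clm_comp (↑u⁻¹ : V →L[ℂ] V)
  have hS : formOp I D T a b μ = A * (1 - K) := by
    rw [hK, mul_sub, mul_one, ← mul_assoc, ← hu, Units.mul_inv, one_mul, hu, hA]
    simp only [formOp, Complex.ofReal_zero, zero_smul, sub_zero]
    abel
  rw [hS]
  refine IsUnit.mul ⟨u, hu⟩ ?_
  -- By the Fredholm alternative either `1 - K` is invertible or `1` is an eigenvalue of `K`; the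
  -- latter contradicts injectivity.
  rcases hKc.hasEigenvalue_or_mem_resolventSet (one_ne_zero (α := ℂ)) with h | h
  · obtain ⟨v, hv⟩ := h.exists_hasEigenvector
    refine absurd (hinj v ?_) hv.2
    have := hv.apply_eq_smul
    rw [hS]
    simp only [one_smul, ContinuousLinearMap.coe_coe] at this
    simp [this]
  · rw [spectrum.mem_resolventSet_iff] at h
    simpa using h

/-- The spectral theorem in the form that locates eigenvalues: if the form has no eigenvalue at
distance less than `d` from `μ₀`, and `0` is not closer either, then `d` is a lower bound for the
operator that the form defines, shifted by `μ₀`. -/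
theorem mul_norm_le_of_no_eigenvalue {C : ℝ} (hT : IsCompactOperator T)
    (hC : ∀ v, ‖v‖ ^ 2 ≤ C * (‖I v‖ ^ 2 + ‖D v‖ ^ 2)) {a b μ₀ d : ℝ} (ha : 0 < a) (hd : 0 < d)
    (hneg : μ₀ + d ≤ 0)
    (hno : ∀ μ : ℝ, |μ - μ₀| < d → ∀ v, (∀ w, a * ⟪D w, D v⟫_ℂ - b * ⟪T w, T v⟫_ℂ
      = μ * ⟪I w, I v⟫_ℂ) → v = 0)
    (ψ : V) (f : L)
    (hψ : ∀ w, a * ⟪D w, D ψ⟫_ℂ - b * ⟪T w, T ψ⟫_ℂ - μ₀ * ⟪I w, I ψ⟫_ℂ = ⟪I w, f⟫_ℂ) :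
    d * ‖I ψ‖ ≤ ‖f‖ := by
  have hunit : ∀ μ : ℝ, |μ - μ₀| < d → IsUnit (formOp I D T a b μ) := fun μ hμ =>
    isUnit_formOp I D T hT hC ha (by linarith [(abs_lt.1 hμ).2]) fun v hv => by
      refine hno μ hμ v fun w => ?_
      have := inner_formOp I D T a b μ v w
      rw [hv, inner_zero_right] at this
      exact (sub_eq_zero.1 this.symm)
  obtain ⟨u₀, hu₀⟩ := hunit μ₀ (by simpa using hd)
  set J := I.adjoint with hJ
  -- `R` is the resolvent at `μ₀` of the operator that the form defines in `L`. It is self-adjoint,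
  -- so `‖R‖` is its spectral radius, and it maps `f` to `I ψ`.
  set R : L →L[ℂ] L := I ∘L (↑u₀⁻¹ : V →L[ℂ] V) ∘L J with hR
  have hinvsa : IsSelfAdjoint (↑u₀⁻¹ : V →L[ℂ] V) := by
    have : IsSelfAdjoint (u₀ : V →L[ℂ] V) := hu₀ ▸ isSelfAdjoint_formOp I D T a b μ₀
    have h2 : star u₀ = u₀ := Units.ext this
    rw [IsSelfAdjoint, ← Units.coe_star, star_inv, h2]
  have hRsa : IsSelfAdjoint R := hinvsa.conj_adjoint I
  have hRψ : R f = I ψ := by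
    have h1 : J f = formOp I D T a b μ₀ ψ := by
      refine ext_inner_left ℂ fun w => ?_
      rw [inner_formOp, hψ, hJ, ContinuousLinearMap.adjoint_inner_right]
    simp only [hR, ContinuousLinearMap.comp_apply, h1, ← hu₀]
    rw [← mul_apply_eq_comp, Units.inv_mul]
    simp
  have hspec : ∀ z ∈ spectrum ℂ R, ‖z‖ ≤ d⁻¹ := by
    intro z hz
    by_contra hcon
    push Not at hcon
    have hzre : z = (z.re : ℂ) := hRsa.mem_spectrum_eq_re hz
    -- A spectral value `x` of `R` with `|x| > d⁻¹` corresponds to the point `μ₀ + x⁻¹` at distance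
    -- less than `d` from `μ₀`.
    set x := z.re with hx
    have hx1 : d⁻¹ < |x| := by rw [hzre, Complex.norm_real] at hcon; exact hcon
    have hx0 : x ≠ 0 := by
      rintro h0
      rw [h0, abs_zero] at hx1
      exact absurd hx1 (not_lt.2 (by positivity))
    have hμ : |(μ₀ + x⁻¹) - μ₀| < d := by
      rw [add_sub_cancel_left, abs_inv]
      exact inv_lt_of_inv_lt₀ hd hx1
    obtain ⟨u, hu⟩ := hunit _ hμ
    have hdiff : (u₀ : V →L[ℂ] V) - u = (x : ℂ)⁻¹ • (J ∘L I) := by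
      rw [hu, hu₀]
      ext v
      simp [formOp, hJ, add_smul]
    -- With `P` the resolvent at `μ₀ + x⁻¹`, the resolvent identity `P - R = x⁻¹ R P` shows that
    -- `1 + x⁻¹ P` is inverse to `1 - x⁻¹ R`.
    have key : IsUnit (1 - (x : ℂ)⁻¹ • R) := by
      set w : ℂ := (x : ℂ)⁻¹
      set P : L →L[ℂ] L := I ∘L (↑u⁻¹ : V →L[ℂ] V) ∘L J with hP
      have e1 : w • (R * P) = P - R := by
        have : (↑u₀⁻¹ : V →L[ℂ] V) * ((u₀ : V →L[ℂ] V) - u) * (↑u⁻¹ : V →L[ℂ] V)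
            = ↑u⁻¹ - ↑u₀⁻¹ := by
          rw [mul_sub, Units.inv_mul, sub_mul, one_mul, mul_assoc, Units.mul_inv, mul_one]
        rw [hdiff] at this
        ext y
        have h2 := congrArg (fun Q : V →L[ℂ] V => I (Q (J y))) this
        simpa [hR, hP] using h2
      have e2 : w • (P * R) = P - R := by
        have : (↑u⁻¹ : V →L[ℂ] V) * ((u₀ : V →L[ℂ] V) - u) * (↑u₀⁻¹ : V →L[ℂ] V)
            = ↑u⁻¹ - ↑u₀⁻¹ := by
          rw [mul_sub, Units.inv_mul, sub_mul, one_mul, mul_assoc, Units.mul_inv, mul_one]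
        rw [hdiff] at this
        ext y
        have h2 := congrArg (fun Q : V →L[ℂ] V => I (Q (J y))) this
        simpa [hR, hP] using h2
      refine ⟨⟨1 - w • R, 1 + w • P, ?_, ?_⟩, rfl⟩
      · rw [mul_add, sub_mul, sub_mul, mul_one, one_mul, mul_one, smul_mul_assoc, mul_smul_comm, e1,
          smul_sub]
        abel
      · rw [add_mul, mul_sub, mul_sub, mul_one, one_mul, mul_one, smul_mul_assoc, mul_smul_comm, e2,
          smul_sub]
        abel
    refine hz ?_
    rw [spectrum.mem_resolventSet_iff]
    have hxc : (x : ℂ) ≠ 0 := by exact_mod_cast hx0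
    have h3 : algebraMap ℂ (L →L[ℂ] L) z - R = (x : ℂ) • (1 - (x : ℂ)⁻¹ • R) := by
      rw [smul_sub, smul_smul, mul_inv_cancel₀ hxc, one_smul, Algebra.algebraMap_eq_smul_one, hzre]
    rw [h3]
    exact (isUnit_smul_iff (Units.mk0 (x : ℂ) hxc) _).2 key
  have hnorm : ‖R‖ ≤ d⁻¹ := by
    have h1 := hRsa.spectralRadius_eq_nnnorm
    have h2 : spectralRadius ℂ R ≤ (Real.toNNReal d⁻¹ : NNReal) := by
      refine iSup₂_le fun z hz => ?_
      have h3 : ‖z‖₊ ≤ Real.toNNReal d⁻¹ := by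
        rw [← NNReal.coe_le_coe, Real.coe_toNNReal _ (by positivity)]
        exact hspec z hz
      exact_mod_cast h3
    rw [h1] at h2
    have h4 : ‖R‖₊ ≤ Real.toNNReal d⁻¹ := by exact_mod_cast h2
    rwa [← NNReal.coe_le_coe, Real.coe_toNNReal _ (by positivity)] at h4
  rw [← hRψ]
  calc d * ‖R f‖ ≤ d * (d⁻¹ * ‖f‖) := by gcongr; exact R.le_of_opNorm_le hnorm f
    _ = ‖f‖ := by field_simp

end Abstract

/-! ### The form domain, and eigenvalues from approximate eigenfunctions -/

section TestFunctions

open scoped InnerProductSpace ENNReal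

/-- A test function: a function in `C_c^∞(ℝ²)`, not required to vanish on the boundary. -/
def IsTest (η : Plane → ℂ) : Prop := ContDiff ℝ ∞ η ∧ HasCompactSupport η

theorem contDiff_pderiv {η : Plane → ℂ} (hη : ContDiff ℝ ∞ η) (i : Fin 2) :
    ContDiff ℝ ∞ (pderiv i η) := by
  have : ContDiff ℝ ∞ (fderiv ℝ η) := hη.fderiv_right (by simp)
  exact this.clm_apply contDiff_const

theorem IsTest.pderiv {η : Plane → ℂ} (hη : IsTest η) (i : Fin 2) : IsTest (pderiv i η) :=
  ⟨contDiff_pderiv hη.1 i, hη.2.fderiv_apply ℝ _⟩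

theorem IsTest.add {η η' : Plane → ℂ} (h : IsTest η) (h' : IsTest η') : IsTest (η + η') :=
  ⟨h.1.add h'.1, h.2.add h'.2⟩

theorem IsTest.smul {η : Plane → ℂ} (h : IsTest η) (c : ℂ) : IsTest (c • η) :=
  ⟨contDiff_const.smul h.1, h.2.smul_left⟩

theorem IsTest.conj {η : Plane → ℂ} (h : IsTest η) : IsTest (fun x => conj (η x)) :=
  ⟨Complex.conjCLE.contDiff.comp h.1, h.2.comp_left (map_zero _)⟩

theorem IsTest.memLp {η : Plane → ℂ} (h : IsTest η) (p : ℝ≥0∞) (μ : Measure Plane)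
    [IsFiniteMeasureOnCompacts μ] : MemLp η p μ :=
  h.1.continuous.memLp_of_hasCompactSupport h.2

theorem pderiv_add {η η' : Plane → ℂ} (h : IsTest η) (h' : IsTest η') (i : Fin 2) :
    Robin.pderiv i (η + η') = Robin.pderiv i η + Robin.pderiv i η' := by
  funext x
  simp only [Robin.pderiv, Pi.add_apply]
  rw [fderiv_add (h.1.differentiable (by simp) x) (h'.1.differentiable (by simp) x)]
  rfl

theorem pderiv_smul {η : Plane → ℂ} (h : IsTest η) (c : ℂ) (i : Fin 2) :
    Robin.pderiv i (c • η) = c • Robin.pderiv i η := by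
  funext x
  simp only [Robin.pderiv, Pi.smul_apply]
  rw [fderiv_const_smul (h.1.differentiable (by simp) x)]
  rfl

instance {Ω : Set Plane} {ι : Type} [Fintype ι] (Γ : BoundaryParam Ω ι) :
    IsFiniteMeasure Γ.arcMeasure := by
  unfold BoundaryParam.arcMeasure
  infer_instance

section Energy

variable {Ω : Set Plane} {ι : Type} [Fintype ι] (Γ : BoundaryParam Ω ι)

/-- The Hilbert space `L²(Ω) × L²(Ω)² × L²(∂Ω)` of triples (function, gradient, trace). -/
abbrev Triple : Type :=
  WithLp 2 (Lp ℂ 2 (volume.restrict Ω) ×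
    WithLp 2 (PiLp 2 (fun _ : Fin 2 => Lp ℂ 2 (volume.restrict Ω)) × Lp ℂ 2 Γ.arcMeasure))

/-- The function of a triple. -/
def funL : Triple Γ →L[ℂ] Lp ℂ 2 (volume.restrict Ω) := WithLp.fstL 2 ℂ _ _

/-- The gradient of a triple. -/
def gradL : Triple Γ →L[ℂ] PiLp 2 (fun _ : Fin 2 => Lp ℂ 2 (volume.restrict Ω)) :=
  (WithLp.fstL 2 ℂ _ _) ∘L (WithLp.sndL 2 ℂ _ _)

/-- The trace of a triple. -/
def traceL : Triple Γ →L[ℂ] Lp ℂ 2 Γ.arcMeasure :=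
  (WithLp.sndL 2 ℂ _ _) ∘L (WithLp.sndL 2 ℂ _ _)

theorem norm_sq_triple (x : Triple Γ) :
    ‖x‖ ^ 2 = ‖funL Γ x‖ ^ 2 + ‖gradL Γ x‖ ^ 2 + ‖traceL Γ x‖ ^ 2 := by
  rw [WithLp.prod_norm_sq_eq_of_L2, WithLp.prod_norm_sq_eq_of_L2, ← add_assoc]
  rfl

variable {Γ}

/-- The components of the triple `x` are represented by the functions `u`, `G`, `g`. -/
def Represents (x : Triple Γ) (u : Plane → ℂ) (G : Fin 2 → Plane → ℂ) (g : Plane → ℂ) : Prop :=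
  funL Γ x =ᵐ[volume.restrict Ω] u ∧ (∀ i, gradL Γ x i =ᵐ[volume.restrict Ω] G i) ∧
    traceL Γ x =ᵐ[Γ.arcMeasure] g

theorem represents_self (x : Triple Γ) :
    Represents x (funL Γ x) (fun i => gradL Γ x i) (traceL Γ x) :=
  ⟨ae_eq_rfl, fun _ => ae_eq_rfl, ae_eq_rfl⟩

theorem exists_represents {u : Plane → ℂ} {G : Fin 2 → Plane → ℂ} {g : Plane → ℂ}
    (hu : MemLp u 2 (volume.restrict Ω)) (hG : ∀ i, MemLp (G i) 2 (volume.restrict Ω))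
    (hg : MemLp g 2 Γ.arcMeasure) : ∃ x : Triple Γ, Represents x u G g :=
  ⟨WithLp.toLp 2 (hu.toLp u, WithLp.toLp 2 (WithLp.toLp 2 fun i => (hG i).toLp (G i), hg.toLp g)),
    hu.coeFn_toLp, fun i => (hG i).coeFn_toLp, hg.coeFn_toLp⟩

theorem IsTest.exists_represents {η : Plane → ℂ} (h : IsTest η) :
    ∃ x : Triple Γ, Represents x η (fun i => Robin.pderiv i η) η :=
  Robin.exists_represents (h.memLp 2 _) (fun i => (h.pderiv i).memLp 2 _) (h.memLp 2 _)

variable (Γ)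

/-- The triples `(η, ∇η, η|_∂Ω)` of test functions `η`. -/
def testSpace : Submodule ℂ (Triple Γ) where
  carrier := {x | ∃ η, IsTest η ∧ Represents x η (fun i => Robin.pderiv i η) η}
  add_mem' := by
    rintro x y ⟨η, h, h1, h2, h3⟩ ⟨η', h', h1', h2', h3'⟩
    refine ⟨η + η', h.add h', ?_, fun i => ?_, ?_⟩
    · rw [map_add]; exact (Lp.coeFn_add _ _).trans (h1.add h1')
    · simp only [map_add, pderiv_add h h']; exact (Lp.coeFn_add _ _).trans ((h2 i).add (h2' i))
    · rw [map_add]; exact (Lp.coeFn_add _ _).trans (h3.add h3')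
  zero_mem' := by
    refine ⟨0, ⟨contDiff_const, HasCompactSupport.zero⟩, ?_, fun i => ?_, ?_⟩
    · rw [map_zero]; exact Lp.coeFn_zero _ _ _
    · rw [map_zero]
      have : Robin.pderiv i (0 : Plane → ℂ) = 0 := by
        funext x; simp [Robin.pderiv]
      simp only [this]
      exact Lp.coeFn_zero _ _ _
    · rw [map_zero]; exact Lp.coeFn_zero _ _ _
  smul_mem' := by
    rintro c x ⟨η, h, h1, h2, h3⟩
    refine ⟨c • η, h.smul c, ?_, fun i => ?_, ?_⟩
    · rw [map_smul]; exact (Lp.coeFn_smul _ _).trans (h1.const_smul c)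
    · simp only [map_smul, pderiv_smul h]; exact (Lp.coeFn_smul _ _).trans ((h2 i).const_smul c)
    · rw [map_smul]; exact (Lp.coeFn_smul _ _).trans (h3.const_smul c)

/-- The form domain `H¹(Ω)`, as the space of triples `(u, ∇u, u|_∂Ω)`. -/
def formDomain : Submodule ℂ (Triple Γ) := (testSpace Γ).topologicalClosure

instance : CompleteSpace (formDomain Γ) :=
  (testSpace Γ).isClosed_topologicalClosure.completeSpace_coe

variable {Γ}

/-- Closed conditions on triples need only be checked on test functions. -/
theorem formDomain_induction {p : Triple Γ → Prop} (hp : IsClosed {x | p x})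
    (h : ∀ x η, IsTest η → Represents x η (fun i => Robin.pderiv i η) η → p x)
    {x : Triple Γ} (hx : x ∈ formDomain Γ) : p x := by
  have : ((testSpace Γ).topologicalClosure : Set (Triple Γ)) ⊆ {x | p x} := by
    rw [Submodule.topologicalClosure_coe]
    refine closure_minimal ?_ hp
    rintro y ⟨η, h1, h2⟩
    exact h y η h1 h2
  exact this hx

theorem inner_eq_integral {X : Type*} [MeasurableSpace X] {μ : Measure X} {x y : Lp ℂ 2 μ}
    {f g : X → ℂ} (hx : x =ᵐ[μ] f) (hy : y =ᵐ[μ] g) : ⟪y, x⟫_ℂ = ∫ a, f a * conj (g a) ∂μ := by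
  rw [L2.inner_def]
  refine integral_congr_ae ?_
  filter_upwards [hx, hy] with a h1 h2
  rw [h1, h2]
  rfl

theorem norm_sq_eq_integral {X : Type*} [MeasurableSpace X] {μ : Measure X} {x : Lp ℂ 2 μ}
    {f : X → ℂ} (hx : x =ᵐ[μ] f) : ‖x‖ ^ 2 = ∫ a, ‖f a‖ ^ 2 ∂μ := by
  have h := inner_eq_integral hx hx
  rw [inner_self_eq_norm_sq_to_K] at h
  have h2 : (∫ a, f a * conj (f a) ∂μ) = ((∫ a, ‖f a‖ ^ 2 ∂μ : ℝ) : ℂ) := by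
    rw [← integral_complex_ofReal]
    refine integral_congr_ae (Eventually.of_forall fun a => ?_)
    simp only [Complex.mul_conj', Complex.ofReal_pow]
  rw [h2] at h
  refine Complex.ofReal_injective ?_
  rw [← h, Complex.ofReal_pow]
  rfl

theorem inner_gradL_eq {x y : Triple Γ} {u v g k : Plane → ℂ} {G H : Fin 2 → Plane → ℂ}
    (hx : Represents x u G g) (hy : Represents y v H k) :
    ⟪gradL Γ y, gradL Γ x⟫_ℂ = ∫ a in Ω, ∑ i, G i a * conj (H i a) := by
  rw [PiLp.inner_apply]
  simp only [fun i => inner_eq_integral (hx.2.1 i) (hy.2.1 i)]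
  rw [integral_finsetSum]
  intro i _
  have h1 : MemLp (G i) 2 (volume.restrict Ω) := (memLp_congr_ae (hx.2.1 i)).1 (Lp.memLp _)
  have h2 : MemLp (H i) 2 (volume.restrict Ω) := (memLp_congr_ae (hy.2.1 i)).1 (Lp.memLp _)
  exact h1.integrable_mul h2.star

/-- The gradient component of an element of the form domain is the weak gradient of its function,
since integration by parts is a closed condition. -/
theorem isWeakGrad_of_mem {x : Triple Γ} (hx : x ∈ formDomain Γ) :
    IsWeakGrad Ω (funL Γ x) (fun i => gradL Γ x i) where
  memLp := Lp.memLp _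
  memLp_grad i := Lp.memLp _
  weak i η h1 h2 h3 := by
    have hη : IsTest η := ⟨h1, h2⟩
    obtain ⟨y, hy, -⟩ := IsTest.exists_represents (Γ := Γ) hη.conj
    obtain ⟨z, hz, -⟩ := IsTest.exists_represents (Γ := Γ) (hη.pderiv i).conj
    have key : ⟪funL Γ z, funL Γ x⟫_ℂ + ⟪funL Γ y, gradL Γ x i⟫_ℂ = 0 := by
      refine formDomain_induction (p := fun x => ⟪funL Γ z, funL Γ x⟫_ℂ
        + ⟪funL Γ y, gradL Γ x i⟫_ℂ = 0) ?_ ?_ hx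
      · refine isClosed_eq ?_ continuous_const
        have : Continuous fun x : Triple Γ => gradL Γ x i :=
          (PiLp.continuous_apply _ _ i).comp (gradL Γ).continuous
        fun_prop
      · intro w θ hθ hw
        rw [inner_eq_integral hw.1 hz, inner_eq_integral (hw.2.1 i) hy]
        simp only [Complex.conj_conj]
        have hsub : ∀ f : Plane → ℂ, (∀ a, a ∉ tsupport η → f a = 0) →
            ∫ a in Ω, f a = ∫ a, f a := fun f hf =>
          setIntegral_eq_integral_of_forall_compl_eq_zero fun a ha => hf a fun h => ha (h3 h)
        rw [hsub, hsub]
        · have hint : ∀ {f g : Plane → ℂ}, IsTest f → IsTest g →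
              Integrable fun a => f a * g a := fun hf hg =>
            (hf.1.continuous.mul hg.1.continuous).integrable_of_hasCompactSupport hf.2.mul_right
          have := integral_mul_fderiv_eq_neg_fderiv_mul_of_integrable (μ := volume)
            (v := EuclideanSpace.single i (1 : ℝ)) (hint (hθ.pderiv i) hη)
            (hint hθ (hη.pderiv i)) (hint hθ hη) (fun a _ => hθ.1.differentiable (by simp) a)
            (fun a _ => hη.1.differentiable (by simp) a)
          simp only [Robin.pderiv] at this ⊢
          rw [this]; simp
        · intro a ha
          rw [image_eq_zero_of_notMem_tsupport ha, mul_zero]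
        · intro a ha
          have : Robin.pderiv i η a = 0 := by
            rw [Robin.pderiv, fderiv_of_notMem_tsupport _ ha]; rfl
          rw [this, mul_zero]
    rw [inner_eq_integral ae_eq_rfl hz, inner_eq_integral ae_eq_rfl hy] at key
    simp only [Complex.conj_conj] at key
    exact eq_neg_of_add_eq_zero_left key

/-- The elements of the form domain are limits of test functions, which is how traces are defined.
-/
theorem isTrace_of_mem {x : Triple Γ} (hx : x ∈ formDomain Γ) :
    IsTrace Γ (funL Γ x) (fun i => gradL Γ x i) (traceL Γ x) := by
  refine ⟨Lp.memLp _, ?_⟩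
  have hx' : x ∈ closure (testSpace Γ : Set (Triple Γ)) := by
    rw [← Submodule.topologicalClosure_coe]; exact hx
  obtain ⟨w, hw, hwx⟩ := mem_closure_iff_seq_limit.1 hx'
  choose η hη hr using hw
  refine ⟨η, fun k => (hη k).1, fun k => (hη k).2, ?_, fun i => ?_, ?_⟩
  · have h1 : Tendsto (fun k => funL Γ (w k)) atTop (𝓝 (funL Γ x)) :=
      ((funL Γ).continuous.tendsto x).comp hwx
    refine (Lp.tendsto_Lp_iff_tendsto_eLpNorm' _ _).1 h1 |>.congr fun k => ?_
    exact eLpNorm_congr_ae ((hr k).1.sub ae_eq_rfl)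
  · have h1 : Tendsto (fun k => gradL Γ (w k) i) atTop (𝓝 (gradL Γ x i)) :=
      (((PiLp.continuous_apply _ _ i).comp (gradL Γ).continuous).tendsto x).comp hwx
    refine (Lp.tendsto_Lp_iff_tendsto_eLpNorm' _ _).1 h1 |>.congr fun k => ?_
    exact eLpNorm_congr_ae (((hr k).2.1 i).sub ae_eq_rfl)
  · have h1 : Tendsto (fun k => traceL Γ (w k)) atTop (𝓝 (traceL Γ x)) :=
      ((traceL Γ).continuous.tendsto x).comp hwx
    refine (Lp.tendsto_Lp_iff_tendsto_eLpNorm' _ _).1 h1 |>.congr fun k => ?_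
    exact eLpNorm_congr_ae ((hr k).2.2.sub ae_eq_rfl)

/-- Conversely, a function in `H¹(Ω)` with a trace defines an element of the form domain. -/
theorem exists_mem_formDomain {u g : Plane → ℂ} {G : Fin 2 → Plane → ℂ}
    (hu : IsWeakGrad Ω u G) (hg : IsTrace Γ u G g) :
    ∃ x ∈ formDomain Γ, Represents x u G g := by
  obtain ⟨hg2, η, h1, h2, h3, h4, h5⟩ := hg
  obtain ⟨x, hx⟩ := exists_represents hu.memLp hu.memLp_grad hg2
  refine ⟨x, ?_, hx⟩
  choose w hw using fun k => IsTest.exists_represents (Γ := Γ) (η := η k) ⟨h1 k, h2 k⟩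
  rw [formDomain, ← SetLike.mem_coe, Submodule.topologicalClosure_coe]
  refine mem_closure_of_tendsto (b := atTop) (f := w) ?_
    (Eventually.of_forall fun k => ⟨η k, ⟨h1 k, h2 k⟩, hw k⟩)
  have e1 : Tendsto (fun k => funL Γ (w k)) atTop (𝓝 (funL Γ x)) := by
    refine (Lp.tendsto_Lp_iff_tendsto_eLpNorm' _ _).2 (h3.congr fun k => ?_)
    exact eLpNorm_congr_ae ((hw k).1.sub hx.1).symm
  have e2 : Tendsto (fun k => gradL Γ (w k)) atTop (𝓝 (gradL Γ x)) := by
    have : ∀ i, Tendsto (fun k => gradL Γ (w k) i) atTop (𝓝 (gradL Γ x i)) := fun i => by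
      refine (Lp.tendsto_Lp_iff_tendsto_eLpNorm' _ _).2 ((h4 i).congr fun k => ?_)
      exact eLpNorm_congr_ae (((hw k).2.1 i).sub (hx.2.1 i)).symm
    have h6 := tendsto_pi_nhds.2 this
    exact ((PiLp.continuous_toLp 2 _).tendsto _).comp h6
  have e3 : Tendsto (fun k => traceL Γ (w k)) atTop (𝓝 (traceL Γ x)) := by
    refine (Lp.tendsto_Lp_iff_tendsto_eLpNorm' _ _).2 (h5.congr fun k => ?_)
    exact eLpNorm_congr_ae ((hw k).2.2.sub hx.2.2).symm
  have e4 := ((WithLp.prod_continuous_toLp 2 _ _).tendsto _).comp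
    (e1.prodMk_nhds (((WithLp.prod_continuous_toLp 2 _ _).tendsto _).comp (e2.prodMk_nhds e3)))
  exact e4

variable (Γ) in
/-- Up to finitely many averages over sets of finite measure, the boundary values of a test function
are small compared with its gradient. -/
def TraceEstimate : Prop :=
  ∀ r > 0, ∃ (m : ℕ) (Q : Fin m → Set Plane) (C : ℝ), 0 ≤ C ∧
    (∀ k, MeasurableSet (Q k) ∧ volume (Q k) ≠ ⊤ ∧ Q k ⊆ Ω) ∧
    ∀ η, IsTest η → ∫ x, ‖η x‖ ^ 2 ∂Γ.arcMeasure
      ≤ r * (∫ x in Ω, ∑ i, ‖pderiv i η x‖ ^ 2) + C * ∑ k, ‖∫ x in Q k, η x‖ ^ 2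

theorem norm_sq_gradL_eq {x : Triple Γ} {u g : Plane → ℂ} {G : Fin 2 → Plane → ℂ}
    (hx : Represents x u G g) : ‖gradL Γ x‖ ^ 2 = ∫ a in Ω, ∑ i, ‖G i a‖ ^ 2 := by
  rw [PiLp.norm_sq_eq_of_L2, integral_finsetSum]
  · exact Finset.sum_congr rfl fun i _ => norm_sq_eq_integral (hx.2.1 i)
  · intro i _
    have h1 : MemLp (G i) 2 (volume.restrict Ω) := (memLp_congr_ae (hx.2.1 i)).1 (Lp.memLp _)
    exact (memLp_two_iff_integrable_sq_norm h1.1).1 h1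

/-- Averages over sets of finite measure are continuous functionals on `L²`. -/
theorem exists_integral_functionals {X : Type*} [MeasurableSpace X] (μ : Measure X) {m : ℕ}
    (Q : Fin m → Set X) (hQ : ∀ k, MeasurableSet (Q k)) (hfin : ∀ k, μ (Q k) ≠ ⊤) :
    ∃ F : Lp ℂ 2 μ →L[ℂ] (Fin m → ℂ), ∀ (u : Lp ℂ 2 μ) (η : X → ℂ), u =ᵐ[μ] η → ∀ k,
      F u k = ∫ a in Q k, η a ∂μ := by
  refine ⟨ContinuousLinearMap.pi fun k => innerSL ℂ (indicatorConstLp 2 (hQ k) (hfin k) (1 : ℂ)),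
    fun u η hu k => ?_⟩
  simp only [ContinuousLinearMap.coe_pi', innerSL_apply_apply]
  rw [L2.inner_indicatorConstLp_one]
  exact integral_congr_ae (ae_restrict_of_ae hu)

/-- The trace estimate, extended to the form domain by closedness. -/
theorem TraceEstimate.formDomain_le (hΓ : TraceEstimate Γ) {r : ℝ} (hr : 0 < r) :
    ∃ (m : ℕ) (F : Lp ℂ 2 (volume.restrict Ω) →L[ℂ] (Fin m → ℂ)) (C : ℝ), 0 ≤ C ∧
      ∀ x ∈ formDomain Γ,
        ‖traceL Γ x‖ ^ 2 ≤ r * ‖gradL Γ x‖ ^ 2 + C * ‖F (funL Γ x)‖ ^ 2 := by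
  obtain ⟨m, Q, C, hC, hQ, h⟩ := hΓ r hr
  obtain ⟨F, hF⟩ := exists_integral_functionals (volume.restrict Ω) Q (fun k => (hQ k).1)
    fun k => ((Measure.restrict_apply_le _ _).trans_lt (hQ k).2.1.lt_top).ne
  refine ⟨m, F, C * m, by positivity, fun x hx => ?_⟩
  refine formDomain_induction (p := fun x => ‖traceL Γ x‖ ^ 2
    ≤ r * ‖gradL Γ x‖ ^ 2 + C * m * ‖F (funL Γ x)‖ ^ 2) ?_ ?_ hx
  · have h1 := (funL Γ).continuous
    have h2 := (gradL Γ).continuous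
    have h3 := (traceL Γ).continuous
    have h4 := F.continuous
    exact isClosed_le (h3.norm.pow 2) ((continuous_const.mul (h2.norm.pow 2)).add
      (continuous_const.mul ((h4.comp h1).norm.pow 2)))
  · intro x η hη hx
    rw [norm_sq_eq_integral hx.2.2, norm_sq_gradL_eq hx, mul_assoc C]
    refine (h η hη).trans ?_
    have h5 : ∑ k, ‖∫ a in Q k, η a‖ ^ 2 ≤ m * ‖F (funL Γ x)‖ ^ 2 := by
      calc ∑ k, ‖∫ a in Q k, η a‖ ^ 2 ≤ ∑ _k : Fin m, ‖F (funL Γ x)‖ ^ 2 := by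
            refine Finset.sum_le_sum fun k _ => ?_
            have h6 := hF _ η hx.1 k
            rw [Measure.restrict_restrict (hQ k).1, inter_eq_left.2 (hQ k).2.2] at h6
            rw [← h6]
            exact pow_le_pow_left₀ (norm_nonneg _) (norm_le_pi_norm _ k) 2
        _ = m * ‖F (funL Γ x)‖ ^ 2 := by simp
    exact add_le_add le_rfl (mul_le_mul_of_nonneg_left h5 hC)

/-- The norm of the form domain is equivalent to the norm of `H¹(Ω)`. -/
theorem TraceEstimate.norm_sq_le (hΓ : TraceEstimate Γ) :
    ∃ C : ℝ, ∀ x ∈ formDomain Γ, ‖x‖ ^ 2 ≤ C * (‖funL Γ x‖ ^ 2 + ‖gradL Γ x‖ ^ 2) := by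
  obtain ⟨m, F, C, hC, h⟩ := hΓ.formDomain_le one_pos
  refine ⟨2 + C * ‖F‖ ^ 2, fun x hx => ?_⟩
  have h3 := norm_sq_triple Γ x
  have h4 := h x hx
  have h5 : ‖F (funL Γ x)‖ ^ 2 ≤ ‖F‖ ^ 2 * ‖funL Γ x‖ ^ 2 := by
    rw [← mul_pow]
    exact pow_le_pow_left₀ (norm_nonneg _) (F.le_opNorm _) 2
  have h6 := mul_le_mul_of_nonneg_left h5 hC
  have h7 : 0 ≤ ‖funL Γ x‖ ^ 2 := by positivity
  have h8 : 0 ≤ ‖gradL Γ x‖ ^ 2 := by positivity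
  have h9 : 0 ≤ C * ‖F‖ ^ 2 * ‖gradL Γ x‖ ^ 2 := by positivity
  linarith

/-- An element of the form domain is determined by its function: the gradient is determined weakly,
and the trace by the trace estimate. -/
theorem funL_injective (hΩ : IsOpen Ω) (hΓ : TraceEstimate Γ) {x : Triple Γ}
    (hx : x ∈ formDomain Γ) (h0 : funL Γ x =ᵐ[volume.restrict Ω] 0) : x = 0 := by
  have hu : funL Γ x = 0 := (Lp.eq_zero_iff_ae_eq_zero).2 h0
  have hG : gradL Γ x = 0 := by
    ext1 i
    refine (Lp.eq_zero_iff_ae_eq_zero).2 ?_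
    have hw := (isWeakGrad_of_mem hx).weak i
    have h1 := hΩ.ae_eq_zero_of_integral_contDiff_smul_eq_zero (μ := volume)
      (f := fun a => gradL Γ x i a) ?_ ?_
    · filter_upwards [ae_restrict_of_ae h1, ae_restrict_mem hΩ.measurableSet] with a h2 h3
      exact h2 h3
    · exact locallyIntegrableOn_of_locallyIntegrable_restrict
        ((Lp.memLp (gradL Γ x i)).locallyIntegrable (by norm_num))
    · intro g hg1 hg2 hg3
      have h2 := hw (fun a => (g a : ℂ)) (Complex.ofRealCLM.contDiff.comp hg1)
        (hg2.comp_left Complex.ofReal_zero)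
        ((tsupport_comp_subset Complex.ofReal_zero g).trans hg3)
      have h3 : ∫ a in Ω, (funL Γ x) a * Robin.pderiv i (fun a => (g a : ℂ)) a = 0 := by
        rw [integral_congr_ae (g := fun _ => (0 : ℂ)), integral_zero]
        filter_upwards [h0] with a ha
        rw [ha]; simp
      rw [h3, zero_eq_neg] at h2
      rw [← h2, ← setIntegral_eq_integral_of_forall_compl_eq_zero (s := Ω)]
      · refine integral_congr_ae (Eventually.of_forall fun a => ?_)
        simp [mul_comm]
      · intro a ha
        rw [image_eq_zero_of_notMem_tsupport fun h => ha (hg3 h), zero_smul]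
  obtain ⟨C, hC⟩ := hΓ.norm_sq_le
  have h1 := hC x hx
  rw [hu, hG, norm_zero, norm_zero] at h1
  have h6 : ‖x‖ ^ 2 = 0 := le_antisymm (by simpa using h1) (by positivity)
  simpa using h6

variable (Γ) in
/-- The form domain as a Hilbert space in its own right. -/
def FormDomain : Type := formDomain Γ

instance : NormedAddCommGroup (FormDomain Γ) := inferInstanceAs (NormedAddCommGroup (formDomain Γ))

instance : InnerProductSpace ℂ (FormDomain Γ) :=
  inferInstanceAs (InnerProductSpace ℂ (formDomain Γ))

instance : CompleteSpace (FormDomain Γ) := inferInstanceAs (CompleteSpace (formDomain Γ))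

variable (Γ) in
/-- The inclusion of the form domain into the space of triples. -/
def inclL : FormDomain Γ →L[ℂ] Triple Γ where
  toFun v := v.1
  map_add' _ _ := rfl
  map_smul' _ _ := rfl
  cont := continuous_subtype_val

theorem norm_inclL (v : FormDomain Γ) : ‖inclL Γ v‖ = ‖v‖ := rfl

theorem inclL_mem (v : FormDomain Γ) : inclL Γ v ∈ formDomain Γ := v.2

theorem exists_inclL_eq {x : Triple Γ} (hx : x ∈ formDomain Γ) : ∃ v, inclL Γ v = x := ⟨⟨x, hx⟩, rfl⟩

theorem inclL_injective : Function.Injective (inclL Γ) := Subtype.val_injective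

/-- The trace is compact on the form domain. No compactness of `H¹(Ω)` in `L²(Ω)` is involved, so
this also holds for exterior domains. -/
theorem isCompactOperator_trace (hΓ : TraceEstimate Γ) :
    IsCompactOperator (traceL Γ ∘L inclL Γ) := by
  refine isCompactOperator_of_forall_le_add_finite (traceL Γ ∘L inclL Γ) fun r hr => ?_
  obtain ⟨m, F, C, hC, h⟩ := hΓ.formDomain_le hr
  refine ⟨m, F ∘L (funL Γ ∘L inclL Γ), C, fun v => (h _ (inclL_mem v)).trans ?_⟩
  have h3 := norm_sq_triple Γ (inclL Γ v)
  rw [norm_inclL] at h3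
  have h6 : 0 ≤ ‖funL Γ (inclL Γ v)‖ ^ 2 := by positivity
  have h7 : 0 ≤ ‖traceL Γ (inclL Γ v)‖ ^ 2 := by positivity
  have h4 : ‖gradL Γ (inclL Γ v)‖ ^ 2 ≤ ‖v‖ ^ 2 := by linarith
  exact add_le_add (mul_le_mul_of_nonneg_left h4 hr.le) le_rfl

/-- The weak equation is a closed condition on the function that it is tested with. -/
theorem isClosed_weak_equation {E L L' B : Type*} [TopologicalSpace E] [AddCommGroup E] [Module ℂ E]
    [NormedAddCommGroup L] [InnerProductSpace ℂ L] [NormedAddCommGroup L'] [InnerProductSpace ℂ L']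
    [NormedAddCommGroup B] [InnerProductSpace ℂ B] (I : E →L[ℂ] L) (D : E →L[ℂ] L')
    (T : E →L[ℂ] B) (a b c : ℂ) (l f : L) (l' : L') (t : B) :
    IsClosed {y | a * ⟪D y, l'⟫_ℂ - b * ⟪T y, t⟫_ℂ - c * ⟪I y, l⟫_ℂ = ⟪I y, f⟫_ℂ} := by
  have h1 := I.continuous
  have h2 := D.continuous
  have h3 := T.continuous
  exact isClosed_eq (((continuous_const.mul (h2.inner continuous_const)).sub
    (continuous_const.mul (h3.inner continuous_const))).sub
    (continuous_const.mul (h1.inner continuous_const))) (h1.inner continuous_const)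

/-- A quasimode produces an eigenvalue: if a test function satisfies the weak eigenvalue equation
up to an error of `L²` norm less than `d` times its own, then there is an eigenvalue at distance
less than `d`, provided that the interval in question lies on the negative half-line. -/
theorem exists_isEigenvalue_near (hΩ : IsOpen Ω) (hΓ : TraceEstimate Γ) {h μ₀ d : ℝ} (hh : 0 < h)
    (hd : 0 < d) (hneg : μ₀ + d ≤ 0) {ψ f : Plane → ℂ} (hψ : IsTest ψ)
    (hf : MemLp f 2 (volume.restrict Ω))
    (hweak : ∀ η, IsTest η →
      ((h ^ 2 : ℝ) : ℂ) * (∫ x in Ω, ∑ i, pderiv i ψ x * conj (pderiv i η x))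
        - ((h ^ (3 / 2 : ℝ) : ℝ) : ℂ) * (∫ x, ψ x * conj (η x) ∂Γ.arcMeasure)
        - (μ₀ : ℂ) * (∫ x in Ω, ψ x * conj (η x)) = ∫ x in Ω, f x * conj (η x))
    (hlt : ∫ x in Ω, ‖f x‖ ^ 2 < d ^ 2 * ∫ x in Ω, ‖ψ x‖ ^ 2) :
    ∃ μ : ℝ, |μ - μ₀| < d ∧ IsEigenvalue Γ h μ := by
  by_contra hcon
  push Not at hcon
  obtain ⟨C, hC⟩ := hΓ.norm_sq_le
  obtain ⟨x, hx⟩ := IsTest.exists_represents (Γ := Γ) hψ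
  have hxV : x ∈ formDomain Γ := (testSpace Γ).le_topologicalClosure ⟨ψ, hψ, hx⟩
  obtain ⟨v₀, rfl⟩ := exists_inclL_eq hxV
  have hfl : hf.toLp f =ᵐ[volume.restrict Ω] f := hf.coeFn_toLp
  have key := mul_norm_le_of_no_eigenvalue (funL Γ ∘L inclL Γ) (gradL Γ ∘L inclL Γ)
    (traceL Γ ∘L inclL Γ) (isCompactOperator_trace hΓ) (fun v => hC _ (inclL_mem v)) (a := h ^ 2)
    (b := h ^ (3 / 2 : ℝ)) (μ₀ := μ₀) (d := d) (by positivity) hd hneg ?_ v₀ (hf.toLp f) ?_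
  · rw [ContinuousLinearMap.comp_apply] at key
    have h1 : (d * ‖funL Γ (inclL Γ v₀)‖) ^ 2 ≤ ‖hf.toLp f‖ ^ 2 :=
      pow_le_pow_left₀ (by positivity) key 2
    rw [mul_pow, norm_sq_eq_integral hx.1, norm_sq_eq_integral hfl] at h1
    linarith
  -- A non-zero solution of the homogeneous equation in the form domain is an eigenfunction, and its
  -- function does not vanish because an element of the form domain is determined by it.
  · intro μ hμ v hv
    by_contra hv0
    refine hcon μ hμ ⟨funL Γ (inclL Γ v), fun h0 => hv0 (inclL_injective
      ((funL_injective hΩ hΓ (inclL_mem v) h0).trans (map_zero _).symm)), ?_, ?_⟩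
    · exact (Lp.memLp _).const_mul _
    · refine ⟨_, _, isWeakGrad_of_mem (inclL_mem v), isTrace_of_mem (inclL_mem v),
        fun w H k hw1 hw2 => ?_⟩
      obtain ⟨y, hy, hyr⟩ := exists_mem_formDomain hw1 hw2
      obtain ⟨y, rfl⟩ := exists_inclL_eq hy
      have h1 := hv y
      have h2 := inner_gradL_eq (represents_self (inclL Γ v)) hyr
      have h3 := inner_eq_integral (x := traceL Γ (inclL Γ v)) ae_eq_rfl hyr.2.2
      have h4 := inner_eq_integral (x := funL Γ (inclL Γ v)) ae_eq_rfl hyr.1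
      simp only [ContinuousLinearMap.comp_apply] at h1
      rw [h2, h3, h4] at h1
      rw [h1, ← integral_const_mul]
      simp only [mul_assoc]
  · intro y
    -- The weak equation for test functions extends to the whole form domain.
    have hcl := isClosed_weak_equation (funL Γ) (gradL Γ) (traceL Γ) ((h ^ 2 : ℝ) : ℂ)
      ((h ^ (3 / 2 : ℝ) : ℝ) : ℂ) (μ₀ : ℂ) (funL Γ (inclL Γ v₀)) (hf.toLp f)
      (gradL Γ (inclL Γ v₀)) (traceL Γ (inclL Γ v₀))
    refine formDomain_induction hcl (fun y η hη hyr => ?_) (inclL_mem y)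
    have e1 := inner_gradL_eq hx hyr
    have e2 := inner_eq_integral hx.2.2 hyr.2.2
    have e3 := inner_eq_integral hx.1 hyr.1
    have e4 := inner_eq_integral hfl hyr.1
    exact ((congrArg₂ (· - ·) (congrArg₂ (· - ·) (congrArg (((h ^ 2 : ℝ) : ℂ) * ·) e1)
      (congrArg (((h ^ (3 / 2 : ℝ) : ℝ) : ℂ) * ·) e2)) (congrArg ((μ₀ : ℂ) * ·) e3)).trans
      (hweak η hη)).trans e4.symm

end Energy

end TestFunctions

/-! ### Boundary coordinates -/

namespace BoundaryParam

variable {Ω : Set Plane} {ι : Type} (Γ : BoundaryParam Ω ι) (i : ι)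

/-- The unit tangent vector. -/
def tangent (s : ℝ) : Plane := deriv (Γ.M i) s

/-- The boundary (normal) coordinates: the point at distance `t` from the boundary, on the inward
normal at `M i s`. -/
def tube (p : ℝ × ℝ) : Plane := Γ.M i p.1 - p.2 • Γ.normal i p.1

theorem normal_zero (s : ℝ) : Γ.normal i s 0 = Γ.tangent i s 1 := by
  simp [normal, rotCW, tangent]

theorem normal_one (s : ℝ) : Γ.normal i s 1 = - Γ.tangent i s 0 := by
  simp [normal, rotCW, tangent]

theorem tangent_sq (s : ℝ) : Γ.tangent i s 0 ^ 2 + Γ.tangent i s 1 ^ 2 = 1 := by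
  have h := Γ.unit_speed i s
  have h2 := EuclideanSpace.real_norm_sq_eq (Γ.tangent i s)
  rw [tangent, h, Fin.sum_univ_two] at h2
  simpa [tangent] using h2.symm

theorem contDiff_tangent : ContDiff ℝ ∞ (Γ.tangent i) := by
  have := (contDiff_infty_iff_deriv (𝕜 := ℝ)).1 (Γ.smooth i)
  exact this.2

theorem contDiff_normal : ContDiff ℝ ∞ (Γ.normal i) := by
  rw [contDiff_piLp]
  intro k
  have h := fun k => (contDiff_piLp 2).1 (Γ.contDiff_tangent i) k
  fin_cases k
  · simpa only [Fin.zero_eta, normal_zero] using h 1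
  · simpa only [Fin.mk_one, normal_one] using (h 0).neg

theorem contDiff_curvature : ContDiff ℝ ∞ (Γ.curvature i) := by
  have h1 : ContDiff ℝ ∞ (deriv (Γ.tangent i)) :=
    ((contDiff_infty_iff_deriv (𝕜 := ℝ)).1 (Γ.contDiff_tangent i)).2
  exact (h1.inner ℝ (Γ.contDiff_normal i)).neg

theorem contDiff_tube : ContDiff ℝ ∞ (Γ.tube i) := by
  refine ((Γ.smooth i).comp contDiff_fst).sub (contDiff_snd.smul ?_)
  exact (Γ.contDiff_normal i).comp contDiff_fst

theorem hasDerivAt_M (s : ℝ) : HasDerivAt (Γ.M i) (Γ.tangent i s) s :=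
  ((Γ.smooth i).differentiable (by simp) s).hasDerivAt

theorem hasDerivAt_apply {c : ℝ → Plane} {c' : Plane} {s : ℝ} (h : HasDerivAt c c' s) (k : Fin 2) :
    HasDerivAt (fun s => c s k) (c' k) s :=
  (EuclideanSpace.proj (𝕜 := ℝ) k).hasFDerivAt.comp_hasDerivAt s h

theorem hasDerivAt_of_apply {c : ℝ → Plane} {c' : Plane} {s : ℝ}
    (h : ∀ k, HasDerivAt (fun s => c s k) (c' k) s) : HasDerivAt c c' s := by
  have h1 : HasDerivAt (fun s k => c s k) (fun k => c' k) s := hasDerivAt_pi.2 h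
  exact (PiLp.continuousLinearEquiv 2 ℝ (fun _ : Fin 2 => ℝ)).symm.hasFDerivAt.comp_hasDerivAt s h1

/-- The Frenet formula `M'' = - κ ν`. -/
theorem hasDerivAt_tangent (s : ℝ) :
    HasDerivAt (Γ.tangent i) (-Γ.curvature i s • Γ.normal i s) s := by
  have h0 : HasDerivAt (Γ.tangent i) (deriv (Γ.tangent i) s) s :=
    ((Γ.contDiff_tangent i).differentiable (by simp) s).hasDerivAt
  have hT := Γ.tangent_sq i s
  set d := deriv (Γ.tangent i) s with hd
  have h1 : Γ.tangent i s 0 * d 0 + Γ.tangent i s 1 * d 1 = 0 := by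
    have h2 := ((hasDerivAt_apply h0 0).pow 2).add ((hasDerivAt_apply h0 1).pow 2)
    have h3 : (fun s => Γ.tangent i s 0) ^ 2 + (fun s => Γ.tangent i s 1) ^ 2
        = fun _ : ℝ => (1 : ℝ) := by
      funext x; exact Γ.tangent_sq i x
    rw [h3] at h2
    have h4 := h2.unique (hasDerivAt_const s (1 : ℝ))
    norm_num at h4
    linarith
  have hκ : Γ.curvature i s = - (d 0 * Γ.tangent i s 1 - d 1 * Γ.tangent i s 0) := by
    have : deriv (deriv (Γ.M i)) s = d := rfl
    rw [curvature, this, PiLp.inner_apply, Fin.sum_univ_two, normal_zero, normal_one]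
    simp
    ring
  convert h0 using 1
  ext k
  fin_cases k
  · simp only [Fin.zero_eta, PiLp.smul_apply, normal_zero, hκ, smul_eq_mul]
    linear_combination Γ.tangent i s 0 * h1 * (-1) + d 0 * hT
  · simp only [Fin.mk_one, PiLp.smul_apply, normal_one, hκ, smul_eq_mul]
    linear_combination Γ.tangent i s 1 * h1 * (-1) + d 1 * hT

theorem hasDerivAt_normal (s : ℝ) :
    HasDerivAt (Γ.normal i) (Γ.curvature i s • Γ.tangent i s) s := by
  refine hasDerivAt_of_apply fun k => ?_
  have h := Γ.hasDerivAt_tangent i s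
  fin_cases k
  · have := hasDerivAt_apply h 1
    simpa [normal_zero, normal_one] using this
  · have := (hasDerivAt_apply h 0).neg
    simp only [Fin.mk_one, PiLp.smul_apply, normal_one]
    refine this.congr_deriv ?_
    simp [normal_zero]

/-- The Jacobian of the boundary coordinates. -/
def tubeJac (p : ℝ × ℝ) : ℝ := 1 - p.2 * Γ.curvature i p.1

theorem contDiff_tubeJac : ContDiff ℝ ∞ (Γ.tubeJac i) :=
  contDiff_const.sub (contDiff_snd.mul ((Γ.contDiff_curvature i).comp contDiff_fst))

/-- The derivative of the boundary coordinates. -/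
def tubeDeriv (p : ℝ × ℝ) : ℝ × ℝ →L[ℝ] Plane :=
  (ContinuousLinearMap.fst ℝ ℝ ℝ).smulRight (Γ.tubeJac i p • Γ.tangent i p.1)
    - (ContinuousLinearMap.snd ℝ ℝ ℝ).smulRight (Γ.normal i p.1)

theorem tubeDeriv_apply (p q : ℝ × ℝ) : Γ.tubeDeriv i p q
    = q.1 • Γ.tubeJac i p • Γ.tangent i p.1 - q.2 • Γ.normal i p.1 := by
  simp [tubeDeriv]

theorem hasFDerivAt_tube (p : ℝ × ℝ) : HasFDerivAt (Γ.tube i) (Γ.tubeDeriv i p) p := by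
  have h1 : HasFDerivAt (fun q : ℝ × ℝ => Γ.M i q.1) _ p :=
    (Γ.hasDerivAt_M i p.1).hasFDerivAt.comp p hasFDerivAt_fst
  have h2 : HasFDerivAt (fun q : ℝ × ℝ => Γ.normal i q.1) _ p :=
    (Γ.hasDerivAt_normal i p.1).hasFDerivAt.comp p hasFDerivAt_fst
  have h3 := h1.sub (hasFDerivAt_snd.smul h2)
  refine h3.congr_fderiv ?_
  ext <;> (simp [tubeDeriv, tubeJac]; try ring)

/-- The derivative of the boundary coordinates is invertible where the Jacobian is not zero. -/
def tubeDerivEquiv (p : ℝ × ℝ) (hp : Γ.tubeJac i p ≠ 0) : (ℝ × ℝ) ≃L[ℝ] Plane :=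
  ContinuousLinearEquiv.equivOfInverse (Γ.tubeDeriv i p)
    (((Γ.tubeJac i p)⁻¹ • innerSL ℝ (Γ.tangent i p.1)).prod (-innerSL ℝ (Γ.normal i p.1)))
    (by
      have hT := Γ.tangent_sq i p.1
      rintro ⟨x, y⟩
      simp only [tubeDeriv_apply, ContinuousLinearMap.prod_apply, _root_.smul_apply,
        _root_.neg_apply, innerSL_apply_apply, PiLp.inner_apply, Fin.sum_univ_two,
        PiLp.sub_apply, PiLp.smul_apply, normal_zero, normal_one, smul_eq_mul, RCLike.inner_apply,
        conj_trivial, Prod.mk.injEq]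
      constructor
      · field_simp
        linear_combination (x * Γ.tubeJac i p) * hT
      · linear_combination y * hT)
    (by
      have hT := Γ.tangent_sq i p.1
      intro v
      ext k
      simp only [tubeDeriv_apply, ContinuousLinearMap.prod_apply, _root_.smul_apply,
        _root_.neg_apply, innerSL_apply_apply, PiLp.inner_apply, Fin.sum_univ_two,
        smul_eq_mul, RCLike.inner_apply, conj_trivial]
      fin_cases k
      · simp only [Fin.zero_eta, PiLp.sub_apply, PiLp.smul_apply, normal_zero, normal_one,
          smul_eq_mul]
        field_simp
        linear_combination v 0 * hT
      · simp only [Fin.mk_one, PiLp.sub_apply, PiLp.smul_apply, normal_zero, normal_one,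
          smul_eq_mul]
        field_simp
        linear_combination v 1 * hT)

/-- The identification of the plane with `ℝ × ℝ`. -/
def planeEquiv : Plane ≃L[ℝ] ℝ × ℝ :=
  (PiLp.continuousLinearEquiv 2 ℝ (fun _ : Fin 2 => ℝ)).trans
    (ContinuousLinearEquiv.piFinTwo ℝ fun _ : Fin 2 => ℝ)

theorem planeEquiv_apply (x : Plane) : planeEquiv x = (x 0, x 1) := rfl

theorem measurePreserving_planeEquiv : MeasurePreserving planeEquiv := by
  have h1 := PiLp.volume_preserving_ofLp (Fin 2)
  have h2 := volume_preserving_finTwoArrow ℝ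
  exact h2.comp h1

/-- The Jacobian determinant is `1 - t κ(s)`, with positive sign: the tangent and the inward normal
are positively oriented. -/
theorem det_planeEquiv_tubeDeriv (p : ℝ × ℝ) :
    ((planeEquiv : Plane →L[ℝ] ℝ × ℝ) ∘L Γ.tubeDeriv i p).det = Γ.tubeJac i p := by
  have hT := Γ.tangent_sq i p.1
  rw [ContinuousLinearMap.det, ← LinearMap.det_toMatrix (Module.Basis.finTwoProd ℝ),
    Matrix.det_fin_two]
  simp only [LinearMap.toMatrix_apply, Module.Basis.finTwoProd_zero, Module.Basis.finTwoProd_one,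
    Module.Basis.coe_finTwoProd_repr, ContinuousLinearMap.coe_coe, ContinuousLinearMap.comp_apply,
    ContinuousLinearEquiv.coe_coe, planeEquiv_apply, tubeDeriv_apply]
  simp [normal_zero, normal_one]
  linear_combination Γ.tubeJac i p * hT

end BoundaryParam

/-! ### Neighbourhoods of boundary points -/

namespace BoundaryParam

variable {Ω : Set Plane} {ι : Type} (Γ : BoundaryParam Ω ι) (i : ι)

/-- The parameter square of side `2δ` about the boundary point with parameter `s₀`. -/
def box (s₀ δ : ℝ) : Set (ℝ × ℝ) := Ioo (s₀ - δ) (s₀ + δ) ×ˢ Ioo (-δ) δ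

/-- The boundary coordinates are a diffeomorphism on the square `box s₀ δ`, and identify its upper
half with its image's intersection with `Ω`. -/
structure IsPatch (s₀ δ : ℝ) : Prop where
  pos : 0 < δ
  le_half_len : δ ≤ Γ.len i / 2
  injOn : InjOn (Γ.tube i) (box s₀ δ)
  jac_mem : ∀ p ∈ box s₀ δ, Γ.tubeJac i p ∈ Icc (1 / 2 : ℝ) 2
  mem : ∀ p ∈ box s₀ δ, 0 < p.2 → Γ.tube i p ∈ Ω
  notMem : ∀ p ∈ box s₀ δ, p.2 ≤ 0 → Γ.tube i p ∉ Ω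
  eq_zero : ∀ p ∈ box s₀ δ, Γ.tube i p ∈ frontier Ω → p.2 = 0

theorem box_mono {s₀ δ δ' : ℝ} (h : δ' ≤ δ) : box s₀ δ' ⊆ box s₀ δ :=
  prod_mono (Ioo_subset_Ioo (by linarith) (by linarith)) (Ioo_subset_Ioo (by linarith) h)

theorem isOpen_box (s₀ δ : ℝ) : IsOpen (box s₀ δ) := isOpen_Ioo.prod isOpen_Ioo

theorem box_eq_ball (s₀ δ : ℝ) : box s₀ δ = Metric.ball ((s₀, 0) : ℝ × ℝ) δ := by
  rw [← ball_prod_same, Real.ball_eq_Ioo, Real.ball_eq_Ioo, zero_sub, zero_add]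
  rfl

variable {Γ i} in
theorem IsPatch.mono {s₀ δ δ' : ℝ} (h : Γ.IsPatch i s₀ δ) (h0 : 0 < δ') (hle : δ' ≤ δ) :
    Γ.IsPatch i s₀ δ' where
  pos := h0
  le_half_len := hle.trans h.le_half_len
  injOn := h.injOn.mono (box_mono hle)
  jac_mem p hp := h.jac_mem p (box_mono hle hp)
  mem p hp := h.mem p (box_mono hle hp)
  notMem p hp := h.notMem p (box_mono hle hp)
  eq_zero p hp := h.eq_zero p (box_mono hle hp)

theorem tube_zero (s : ℝ) : Γ.tube i (s, 0) = Γ.M i s := by simp [tube]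

/-- Boundary coordinates exist near every boundary point. They are injective by the inverse function
theorem, and stay away from the part of the boundary that is far in the arc-length parameter; hence
they meet the boundary only at `t = 0`, and each of the two half-squares lies on one side of it
because it is connected. -/
theorem exists_isPatch [Finite ι] (hΩ : IsOpen Ω) (s₀ : ℝ) : ∃ δ, Γ.IsPatch i s₀ δ := by
  have hcont : Continuous (Γ.tube i) := (Γ.contDiff_tube i).continuous
  have hjac0 : Γ.tubeJac i (s₀, 0) = 1 := by simp [tubeJac]
  obtain ⟨r₁, hr₁, hinj⟩ : ∃ r > 0, InjOn (Γ.tube i) (box s₀ r) := by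
    have h1 : HasStrictFDerivAt (Γ.tube i)
        (Γ.tubeDerivEquiv i (s₀, 0) (by rw [hjac0]; exact one_ne_zero) : ℝ × ℝ →L[ℝ] Plane)
        (s₀, 0) := by
      refine (Γ.contDiff_tube i).contDiffAt.hasStrictFDerivAt' ?_ (by simp)
      exact Γ.hasFDerivAt_tube i _
    have h2 := (h1.toOpenPartialHomeomorph (Γ.tube i)).open_source.mem_nhds
      h1.mem_toOpenPartialHomeomorph_source
    obtain ⟨r, hr, hsub⟩ := Metric.mem_nhds_iff.1 h2
    refine ⟨r, hr, ?_⟩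
    rw [box_eq_ball]
    exact (h1.toOpenPartialHomeomorph (Γ.tube i)).injOn.mono hsub
  obtain ⟨r₂, hr₂, hjac⟩ : ∃ r > 0, ∀ p ∈ box s₀ r, Γ.tubeJac i p ∈ Icc (1 / 2 : ℝ) 2 := by
    have h2 := (Γ.contDiff_tubeJac i).continuous.continuousAt (x := ((s₀, 0) : ℝ × ℝ))
    have h3 := h2.eventually (Icc_mem_nhds (a := (1 / 2 : ℝ)) (b := 2) (by rw [hjac0]; norm_num)
      (by rw [hjac0]; norm_num))
    obtain ⟨r, hr, hsub⟩ := Metric.mem_nhds_iff.1 h3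
    refine ⟨r, hr, fun p hp => ?_⟩
    rw [box_eq_ball] at hp
    exact hsub hp
  -- the part of the boundary that is away from the given point in the arc-length parameter
  set C : Set Plane := ⋃ j, Γ.M j '' (Icc (s₀ - Γ.len j / 2) (s₀ + Γ.len j / 2) ∩
    {s | j = i → r₁ ≤ |s - s₀|}) with hC
  have hCclosed : IsClosed C := by
    refine isClosed_iUnion_of_finite fun j => ?_
    refine (((isCompact_Icc).inter_right ?_).image (Γ.smooth j).continuous).isClosed
    by_cases hj : j = i
    · simp only [hj, true_imp_iff]
      exact isClosed_le continuous_const (by fun_prop)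
    · simp [hj]
  have hnotC : Γ.tube i (s₀, 0) ∉ C := by
    rw [tube_zero, hC, mem_iUnion]
    rintro ⟨j, s, ⟨hs1, hs2⟩, hs3⟩
    -- Two parameters of the same boundary point differ by a multiple of the length, and these two
    -- by at most half of it.
    obtain ⟨rfl, k, hk⟩ := Γ.simple _ _ _ _ hs3
    have hl := Γ.len_pos j
    have h4 : r₁ ≤ |s - s₀| := hs2 rfl
    have hk0 : (k : ℝ) * Γ.len j = s₀ - s := by linarith
    have h5 : |(k : ℝ)| < 1 := by
      rw [← mul_lt_mul_iff_left₀ hl, ← abs_of_pos hl, ← abs_mul, abs_of_pos hl, hk0, one_mul]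
      rw [abs_lt]
      constructor <;> linarith [hs1.1, hs1.2]
    have h6 : k = 0 := by
      have : |k| < 1 := by exact_mod_cast h5
      exact Int.abs_lt_one_iff.1 this
    rw [h6] at hk0
    simp only [Int.cast_zero, zero_mul] at hk0
    rw [abs_sub_comm, ← hk0, abs_zero] at h4
    linarith
  obtain ⟨r₃, hr₃, havoid⟩ : ∃ r > 0, ∀ p ∈ box s₀ r, Γ.tube i p ∉ C := by
    have h3 := hcont.continuousAt.eventually (hCclosed.isOpen_compl.mem_nhds hnotC)
    obtain ⟨r, hr, hsub⟩ := Metric.mem_nhds_iff.1 h3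
    refine ⟨r, hr, fun p hp => ?_⟩
    rw [box_eq_ball] at hp
    exact hsub hp
  set δ := min (min r₁ r₂) (min r₃ (Γ.len i / 2)) with hδ
  have hδ1 : δ ≤ r₁ := (min_le_left _ _).trans (min_le_left _ _)
  have hδ2 : δ ≤ r₂ := (min_le_left _ _).trans (min_le_right _ _)
  have hδ3 : δ ≤ r₃ := (min_le_right _ _).trans (min_le_left _ _)
  have hδ4 : δ ≤ Γ.len i / 2 := (min_le_right _ _).trans (min_le_right _ _)
  have hδ0 : 0 < δ := lt_min (lt_min hr₁ hr₂) (lt_min hr₃ (half_pos (Γ.len_pos i)))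
  -- A boundary point in the image is either in `C`, which is excluded, or has a parameter near
  -- `s₀`, so that injectivity applies.
  have hfr : ∀ p ∈ box s₀ δ, Γ.tube i p ∈ frontier Ω → p.2 = 0 := by
    intro p hp hpf
    rw [Γ.frontier_eq, mem_iUnion] at hpf
    obtain ⟨j, s, hs⟩ := hpf
    obtain ⟨s', hs', hss'⟩ := (Γ.periodic j).exists_mem_Ico (Γ.len_pos j) s (s₀ - Γ.len j / 2)
    have h1 := havoid p (box_mono hδ3 hp)
    by_cases h2 : j = i → r₁ ≤ |s' - s₀|
    · refine absurd ?_ h1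
      refine mem_iUnion.2 ⟨j, s', ⟨⟨hs'.1, by linarith [hs'.2]⟩, h2⟩, ?_⟩
      rw [← hs, hss']
    · push Not at h2
      obtain ⟨rfl, h3⟩ := h2
      have h4 : (s', (0 : ℝ)) ∈ box s₀ r₁ := by
        rw [abs_lt] at h3
        exact ⟨⟨by linarith, by linarith⟩, by simpa using hr₁⟩
      have h5 : Γ.tube j (s', 0) = Γ.tube j p := by rw [tube_zero, ← hs, hss']
      have := hinj h4 (box_mono hδ1 hp) h5
      rw [← this]
  -- a pair of points on the normal at `s₀` that decides on which side `Ω` lies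
  obtain ⟨δ', hδ', hside⟩ := Γ.one_sided i s₀
  set t := min δ δ' / 2 with ht
  have ht0 : 0 < t := half_pos (lt_min hδ0 hδ')
  have ht1 : t < δ := (half_lt_self (lt_min hδ0 hδ')).trans_le (min_le_left _ _)
  have ht2 : t < δ' := (half_lt_self (lt_min hδ0 hδ')).trans_le (min_le_right _ _)
  obtain ⟨hin, hout⟩ := hside t ⟨ht0, ht2⟩
  -- A connected set of points off the boundary that meets `Ω` lies in `Ω`.
  have hsub : ∀ S ⊆ Ioo (-δ) δ, Convex ℝ S → (0 : ℝ) ∉ S →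
      (∃ p ∈ Ioo (s₀ - δ) (s₀ + δ) ×ˢ S, Γ.tube i p ∈ Ω) →
      ∀ p ∈ Ioo (s₀ - δ) (s₀ + δ) ×ˢ S, Γ.tube i p ∈ Ω := by
    rintro S hS hS1 hS0 ⟨q, hq, hqΩ⟩ p hp
    have hpre : IsPreconnected (Γ.tube i '' (Ioo (s₀ - δ) (s₀ + δ) ×ˢ S)) :=
      ((convex_Ioo _ _).prod hS1).isPreconnected.image _ hcont.continuousOn
    refine hpre.subset_of_closure_inter_subset hΩ ⟨_, ⟨q, hq, rfl⟩, hqΩ⟩ ?_ ⟨p, hp, rfl⟩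
    rintro _ ⟨hx1, ⟨p', hp', rfl⟩⟩
    by_contra hx2
    have h1 : Γ.tube i p' ∈ frontier Ω := by
      rw [hΩ.frontier_eq]; exact ⟨hx1, hx2⟩
    have h2 := hfr p' ⟨hp'.1, hS hp'.2⟩ h1
    exact hS0 (h2 ▸ hp'.2)
  refine ⟨δ, hδ0, hδ4, hinj.mono (box_mono hδ1), fun p hp => hjac p (box_mono hδ2 hp), ?_, ?_, hfr⟩
  · intro p hp hp0
    refine hsub (Ioo 0 δ) (Ioo_subset_Ioo (by linarith) le_rfl) (convex_Ioo _ _) (by simp)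
      ⟨(s₀, t), ⟨⟨by linarith, by linarith⟩, ht0, ht1⟩, hin⟩ p ⟨hp.1, hp0, hp.2.2⟩
  · intro p hp hp0 hpΩ
    rcases hp0.lt_or_eq with h | h
    · refine hout ?_
      have := hsub (Ioo (-δ) 0) (Ioo_subset_Ioo le_rfl hδ0.le) (convex_Ioo _ _) (by simp)
        ⟨p, ⟨hp.1, hp.2.1, h⟩, hpΩ⟩ (s₀, -t) ⟨⟨by linarith, by linarith⟩, by linarith, by linarith⟩
      simpa [tube, normal] using this
    · have h1 : Γ.tube i p = Γ.M i p.1 := by simp [tube, h]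
      have h2 : Γ.M i p.1 ∈ frontier Ω := by
        rw [Γ.frontier_eq]; exact mem_iUnion.2 ⟨i, mem_range_self _⟩
      rw [hΩ.frontier_eq] at h2
      exact h2.2 (h1 ▸ hpΩ)

/-- The change of variables to boundary coordinates. -/
theorem setIntegral_tube {E : Type*} [NormedAddCommGroup E] [NormedSpace ℝ E] {S : Set (ℝ × ℝ)}
    (hS : MeasurableSet S) (hinj : InjOn (Γ.tube i) S) (F : Plane → E) :
    ∫ x in Γ.tube i '' S, F x = ∫ p in S, |Γ.tubeJac i p| • F (Γ.tube i p) := by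
  have h1 := integral_image_eq_integral_abs_det_fderiv_smul volume hS
    (f := fun p => planeEquiv (Γ.tube i p))
    (fun p _ => ((planeEquiv : Plane →L[ℝ] ℝ × ℝ).hasFDerivAt.comp p
      (Γ.hasFDerivAt_tube i p)).hasFDerivWithinAt)
    (planeEquiv.injective.comp_injOn hinj) (fun q => F (planeEquiv.symm q))
  simp only [det_planeEquiv_tubeDeriv, ContinuousLinearEquiv.symm_apply_apply] at h1
  have h2 : (fun p => planeEquiv (Γ.tube i p)) '' S = planeEquiv '' (Γ.tube i '' S) :=
    image_comp planeEquiv (Γ.tube i) S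
  rw [← h1, h2, measurePreserving_planeEquiv.setIntegral_image_emb
      planeEquiv.toHomeomorph.measurableEmbedding]
  simp

end BoundaryParam

/-! ### A Poincaré inequality for boundary values on a square -/

/-- The Cauchy-Schwarz inequality with the constant function. -/
theorem sq_integral_le {f : ℝ → ℝ} (hf : Continuous f) (a : ℝ) {ℓ : ℝ} (hℓ : 0 < ℓ) :
    (∫ x in a..a + ℓ, f x) ^ 2 ≤ ℓ * ∫ x in a..a + ℓ, f x ^ 2 := by
  set m := (∫ x in a..a + ℓ, f x) / ℓ with hm
  have h1 : 0 ≤ ∫ x in a..a + ℓ, (f x - m) ^ 2 :=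
    intervalIntegral.integral_nonneg (by linarith) fun x _ => sq_nonneg _
  have h2 : ∫ x in a..a + ℓ, (f x - m) ^ 2
      = (∫ x in a..a + ℓ, f x ^ 2) - 2 * m * (∫ x in a..a + ℓ, f x) + ℓ * m ^ 2 := by
    have h3 : ∀ x, (f x - m) ^ 2 = f x ^ 2 - 2 * m * f x + m ^ 2 := fun x => by ring
    simp only [h3]
    rw [intervalIntegral.integral_add, intervalIntegral.integral_sub,
      intervalIntegral.integral_const_mul, intervalIntegral.integral_const]
    · simp
    all_goals exact Continuous.intervalIntegrable (by fun_prop) _ _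
  rw [h2] at h1
  have h4 : ∫ x in a..a + ℓ, f x = ℓ * m := by rw [hm]; field_simp
  rw [h4] at h1 ⊢
  nlinarith

/-- The oscillation of a function on an interval is at most the total variation. -/
theorem norm_sub_le_integral {f f' : ℝ → ℂ} (hf : ∀ x, HasDerivAt f (f' x) x)
    (hf' : Continuous f') {a b x y : ℝ} (hx : x ∈ Icc a b) (hy : y ∈ Icc a b) :
    ‖f x - f y‖ ≤ ∫ z in a..b, ‖f' z‖ := by
  wlog hxy : y ≤ x generalizing x y
  · rw [norm_sub_rev]; exact this hy hx (by linarith)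
  have h1 : ∫ z in y..x, f' z = f x - f y :=
    intervalIntegral.integral_eq_sub_of_hasDerivAt (fun z _ => hf z) (hf'.intervalIntegrable _ _)
  rw [← h1]
  refine (intervalIntegral.norm_integral_le_integral_norm hxy).trans ?_
  exact intervalIntegral.integral_mono_interval hy.1 hxy hx.2
    (Eventually.of_forall fun z => norm_nonneg _) (hf'.norm.intervalIntegrable _ _)

set_option maxHeartbeats 1000000 in
/-- Poincaré inequality for the values on one side of a square, relative to a weighted mean over the
square. -/
theorem trace_square_le {w ws wt : ℝ → ℝ → ℂ} {ρ : ℝ → ℝ → ℝ}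
    (hws : ∀ s t, HasDerivAt (fun s => w s t) (ws s t) s)
    (hwt : ∀ s t, HasDerivAt (fun t => w s t) (wt s t) t)
    (cw : Continuous (Function.uncurry w)) (cs : Continuous (Function.uncurry ws))
    (ct : Continuous (Function.uncurry wt)) (cρ : Continuous (Function.uncurry ρ))
    {a ℓ : ℝ} (hℓ : 0 < ℓ)
    (hρ : ∀ s ∈ Icc a (a + ℓ), ∀ t ∈ Icc 0 ℓ, ρ s t ∈ Icc (1 / 2 : ℝ) 2) :
    ∫ s in a..a + ℓ, ‖w s 0‖ ^ 2
      ≤ 48 * ℓ * (∫ s in a..a + ℓ, ∫ t in 0..ℓ, (‖ws s t‖ ^ 2 + ‖wt s t‖ ^ 2))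
        + 12 / ℓ ^ 3 * ‖∫ s in a..a + ℓ, ∫ t in 0..ℓ, (ρ s t : ℂ) * w s t‖ ^ 2 := by
  have cw' : Continuous fun p : ℝ × ℝ => w p.1 p.2 := cw
  have cs' : Continuous fun p : ℝ × ℝ => ws p.1 p.2 := cs
  have ct' : Continuous fun p : ℝ × ℝ => wt p.1 p.2 := ct
  have cρ' : Continuous fun p : ℝ × ℝ => ρ p.1 p.2 := cρ
  -- continuity of an iterated integral in its parameter
  have cpar : ∀ {E : Type} [NormedAddCommGroup E] [NormedSpace ℝ E] {g : ℝ → ℝ → E} (c d : ℝ),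
      Continuous (fun p : ℝ × ℝ => g p.1 p.2) → Continuous fun s => ∫ t in c..d, g s t :=
    fun c d hg => intervalIntegral.continuous_parametric_intervalIntegral_of_continuous' hg c d
  have csec : ∀ {E : Type} [TopologicalSpace E] {g : ℝ → ℝ → E},
      Continuous (fun p : ℝ × ℝ => g p.1 p.2) → ∀ s, Continuous fun t => g s t :=
    fun hg s => hg.comp (by fun_prop : Continuous fun t : ℝ => (s, t))
  have csec' : ∀ {E : Type} [TopologicalSpace E] {g : ℝ → ℝ → E},
      Continuous (fun p : ℝ × ℝ => g p.1 p.2) → ∀ t, Continuous fun s => g s t :=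
    fun hg t => hg.comp (by fun_prop : Continuous fun s : ℝ => (s, t))
  -- the variation of `w` along the vertical line through `s` and the horizontal line through `t`
  set α : ℝ → ℝ := fun s => ∫ t in 0..ℓ, ‖wt s t‖ with hα
  set β : ℝ → ℝ := fun t => ∫ s in a..a + ℓ, ‖ws s t‖ with hβ
  have cα : Continuous α := cpar 0 ℓ (g := fun s t => ‖wt s t‖) ct'.norm
  have cβ : Continuous β := cpar a (a + ℓ) (g := fun t s => ‖ws s t‖)
    (cs'.norm.comp continuous_swap)
  set Iw := ∫ s in a..a + ℓ, ∫ t in 0..ℓ, (ρ s t : ℂ) * w s t with hIw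
  set A := ∫ s in a..a + ℓ, ∫ t in 0..ℓ, ρ s t with hA
  set b := ∫ t in 0..ℓ, β t with hb
  have hα0 : ∀ s, 0 ≤ α s := fun s =>
    intervalIntegral.integral_nonneg hℓ.le fun t _ => norm_nonneg _
  have hβ0 : ∀ t, 0 ≤ β t := fun t =>
    intervalIntegral.integral_nonneg (by linarith) fun t _ => norm_nonneg _
  have hb0 : 0 ≤ b := intervalIntegral.integral_nonneg hℓ.le fun t _ => hβ0 t
  have hA1 : ℓ ^ 2 / 2 ≤ A := by
    have h1 : ∫ s in a..a + ℓ, ∫ t in 0..ℓ, (1 / 2 : ℝ) ≤ A := by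
      refine intervalIntegral.integral_mono_on (by linarith)
        (continuous_const.intervalIntegrable _ _) ((cpar 0 ℓ cρ').intervalIntegrable _ _)
        fun s hs => ?_
      exact intervalIntegral.integral_mono_on hℓ.le (continuous_const.intervalIntegrable _ _)
        ((csec cρ' s).intervalIntegrable _ _) fun t ht => (hρ s hs t ht).1
    simp at h1
    linarith
  -- The value at `(s, 0)` differs from that at `(s', t')` by at most `α s + β t'`, along the path
  -- through `(s, t')`. This is averaged over `(s', t')` with the weight `ρ`, whose mass is at least
  -- `ℓ² / 2`.
  have hpt : ∀ s ∈ Icc a (a + ℓ), ‖w s 0‖ ≤ 2 * ‖Iw‖ / ℓ ^ 2 + 4 * α s + 4 / ℓ * b := by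
    intro s hs
    have h1 : ∀ s' ∈ Icc a (a + ℓ), ∀ t' ∈ Icc 0 ℓ, ‖w s 0 - w s' t'‖ ≤ α s + β t' := by
      intro s' hs' t' ht'
      have e1 := norm_sub_le_integral (hwt s) (csec ct' s) (a := 0) (b := ℓ)
        ⟨le_rfl, hℓ.le⟩ ht'
      have e2 := norm_sub_le_integral (fun s => hws s t') (csec' cs' t') (a := a) (b := a + ℓ)
        hs hs'
      calc ‖w s 0 - w s' t'‖ = ‖(w s 0 - w s t') + (w s t' - w s' t')‖ := by congr 1; ring
        _ ≤ _ := (norm_add_le _ _).trans (add_le_add e1 e2)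
    have h2 : (A : ℂ) * w s 0
        = Iw + ∫ s' in a..a + ℓ, ∫ t' in 0..ℓ, (ρ s' t' : ℂ) * (w s 0 - w s' t') := by
      rw [hIw, ← intervalIntegral.integral_add]
      · rw [hA, ← intervalIntegral.integral_ofReal, ← intervalIntegral.integral_mul_const]
        refine intervalIntegral.integral_congr fun s' _ => ?_
        rw [← intervalIntegral.integral_ofReal, ← intervalIntegral.integral_mul_const,
          ← intervalIntegral.integral_add]
        · refine intervalIntegral.integral_congr fun t' _ => ?_
          ring
        · have e1 := csec cρ' s'
          have e2 := csec cw' s'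
          exact Continuous.intervalIntegrable (by fun_prop) _ _
        · have e1 := csec cρ' s'
          have e2 := csec cw' s'
          exact Continuous.intervalIntegrable (by fun_prop) _ _
      · refine (cpar 0 ℓ (g := fun s t => (ρ s t : ℂ) * w s t) ?_).intervalIntegrable _ _
        fun_prop
      · refine (cpar 0 ℓ (g := fun s' t' => (ρ s' t' : ℂ) * (w s 0 - w s' t')) ?_).intervalIntegrable
          _ _
        fun_prop
    have h3 : ‖∫ s' in a..a + ℓ, ∫ t' in 0..ℓ, (ρ s' t' : ℂ) * (w s 0 - w s' t')‖
        ≤ 2 * ℓ ^ 2 * α s + 2 * ℓ * b := by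
      have e0 : Continuous fun p : ℝ × ℝ => (ρ p.1 p.2 : ℂ) * (w s 0 - w p.1 p.2) := by fun_prop
      calc _ ≤ ∫ s' in a..a + ℓ, ‖∫ t' in 0..ℓ, (ρ s' t' : ℂ) * (w s 0 - w s' t')‖ :=
            intervalIntegral.norm_integral_le_integral_norm (by linarith)
        _ ≤ ∫ s' in a..a + ℓ, ∫ t' in 0..ℓ, 2 * (α s + β t') := by
            refine intervalIntegral.integral_mono_on (by linarith)
              ((cpar 0 ℓ (g := fun s' t' => (ρ s' t' : ℂ) * (w s 0 - w s' t')) e0).norm.intervalIntegrable _ _)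
              (continuous_const.intervalIntegrable _ _) fun s' hs' => ?_
            refine (intervalIntegral.norm_integral_le_integral_norm hℓ.le).trans ?_
            refine intervalIntegral.integral_mono_on hℓ.le
              ((csec (g := fun s' t' => (ρ s' t' : ℂ) * (w s 0 - w s' t')) e0 s').norm.intervalIntegrable _ _)
              (Continuous.intervalIntegrable (by fun_prop) _ _) fun t' ht' => ?_
            have e3 := hρ s' hs' t' ht'
            rw [norm_mul, Complex.norm_real, Real.norm_eq_abs, abs_of_nonneg (by linarith [e3.1])]
            exact mul_le_mul e3.2 (h1 s' hs' t' ht') (norm_nonneg _) (by norm_num)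
        _ = 2 * ℓ ^ 2 * α s + 2 * ℓ * b := by
            rw [intervalIntegral.integral_const, intervalIntegral.integral_const_mul,
              intervalIntegral.integral_add (continuous_const.intervalIntegrable _ _)
                (cβ.intervalIntegrable _ _), intervalIntegral.integral_const]
            simp only [smul_eq_mul, ← hb]
            ring
    have h4 : A * ‖w s 0‖ ≤ ‖Iw‖ + (2 * ℓ ^ 2 * α s + 2 * ℓ * b) := by
      have e1 : ‖(A : ℂ) * w s 0‖ = A * ‖w s 0‖ := by
        rw [norm_mul, Complex.norm_real, Real.norm_eq_abs, abs_of_nonneg]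
        exact le_trans (by positivity) hA1
      rw [← e1, h2]
      exact (norm_add_le _ _).trans (add_le_add le_rfl h3)
    have h5 : ℓ ^ 2 / 2 * ‖w s 0‖ ≤ ‖Iw‖ + (2 * ℓ ^ 2 * α s + 2 * ℓ * b) :=
      (mul_le_mul_of_nonneg_right hA1 (norm_nonneg _)).trans h4
    have h6 : 2 * ‖Iw‖ / ℓ ^ 2 + 4 * α s + 4 / ℓ * b
        = (‖Iw‖ + (2 * ℓ ^ 2 * α s + 2 * ℓ * b)) / (ℓ ^ 2 / 2) := by field_simp; ring
    rw [h6, le_div_iff₀ (by positivity)]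
    linarith
  have hsq : ∀ s ∈ Icc a (a + ℓ), ‖w s 0‖ ^ 2
      ≤ 12 / ℓ ^ 4 * ‖Iw‖ ^ 2 + 48 * α s ^ 2 + 48 / ℓ ^ 2 * b ^ 2 := by
    intro s hs
    have h1 := hpt s hs
    have h2 : ‖w s 0‖ ^ 2 ≤ (2 * ‖Iw‖ / ℓ ^ 2 + 4 * α s + 4 / ℓ * b) ^ 2 :=
      pow_le_pow_left₀ (norm_nonneg _) h1 2
    refine h2.trans ?_
    have h3 : ∀ x y z : ℝ, (x + y + z) ^ 2 ≤ 3 * x ^ 2 + 3 * y ^ 2 + 3 * z ^ 2 := fun x y z => by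
      nlinarith [sq_nonneg (x - y), sq_nonneg (y - z), sq_nonneg (x - z)]
    refine (h3 _ _ _).trans (le_of_eq ?_)
    field_simp
    ring
  have hα2 : ∫ s in a..a + ℓ, α s ^ 2 ≤ ℓ * ∫ s in a..a + ℓ, ∫ t in 0..ℓ, ‖wt s t‖ ^ 2 := by
    rw [← intervalIntegral.integral_const_mul]
    refine intervalIntegral.integral_mono_on (by linarith) ((cα.pow 2).intervalIntegrable _ _)
      ((continuous_const.mul (cpar 0 ℓ (g := fun s t => ‖wt s t‖ ^ 2)
        (ct'.norm.pow 2))).intervalIntegrable _ _) fun s _ => ?_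
    have := sq_integral_le (csec ct' s).norm 0 hℓ
    simpa using this
  have hb2 : b ^ 2 ≤ ℓ ^ 2 * ∫ s in a..a + ℓ, ∫ t in 0..ℓ, ‖ws s t‖ ^ 2 := by
    have e1 : Continuous fun p : ℝ × ℝ => ‖ws p.1 p.2‖ ^ 2 := cs'.norm.pow 2
    have h1 : b ^ 2 ≤ ℓ * ∫ t in 0..ℓ, β t ^ 2 := by simpa using sq_integral_le cβ 0 hℓ
    have h2 : ∫ t in 0..ℓ, β t ^ 2 ≤ ∫ t in 0..ℓ, ℓ * ∫ s in a..a + ℓ, ‖ws s t‖ ^ 2 := by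
      refine intervalIntegral.integral_mono_on hℓ.le ((cβ.pow 2).intervalIntegrable _ _)
        ((continuous_const.mul (cpar a (a + ℓ) (g := fun t s => ‖ws s t‖ ^ 2)
          (e1.comp continuous_swap))).intervalIntegrable _ _) fun t _ => ?_
      exact sq_integral_le (csec' cs' t).norm a hℓ
    rw [intervalIntegral.integral_const_mul, intervalIntegral_intervalIntegral_swap] at h2
    · calc b ^ 2 ≤ ℓ * ∫ t in 0..ℓ, β t ^ 2 := h1
        _ ≤ ℓ * (ℓ * _) := mul_le_mul_of_nonneg_left h2 hℓ.le
        _ = _ := by ring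
    · have e2 : Continuous fun p : ℝ × ℝ => ‖ws p.2 p.1‖ ^ 2 := e1.comp continuous_swap
      exact (e2.continuousOn.integrableOn_compact (isCompact_uIcc.prod isCompact_uIcc)).mono_set
        (prod_mono uIoc_subset_uIcc uIoc_subset_uIcc)
  calc ∫ s in a..a + ℓ, ‖w s 0‖ ^ 2
      ≤ ∫ s in a..a + ℓ, (12 / ℓ ^ 4 * ‖Iw‖ ^ 2 + 48 * α s ^ 2 + 48 / ℓ ^ 2 * b ^ 2) :=
        intervalIntegral.integral_mono_on (by linarith)
          (((csec' cw' 0).norm.pow 2).intervalIntegrable _ _)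
          (Continuous.intervalIntegrable (by fun_prop) _ _) hsq
    _ = 12 / ℓ ^ 3 * ‖Iw‖ ^ 2 + 48 * (∫ s in a..a + ℓ, α s ^ 2) + 48 / ℓ * b ^ 2 := by
        rw [intervalIntegral.integral_add, intervalIntegral.integral_add,
          intervalIntegral.integral_const, intervalIntegral.integral_const,
          intervalIntegral.integral_const_mul]
        · simp only [smul_eq_mul, add_sub_cancel_left]
          field_simp
        all_goals exact Continuous.intervalIntegrable (by fun_prop) _ _
    _ ≤ 12 / ℓ ^ 3 * ‖Iw‖ ^ 2 + 48 * (ℓ * ∫ s in a..a + ℓ, ∫ t in 0..ℓ, ‖wt s t‖ ^ 2)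
        + 48 / ℓ * (ℓ ^ 2 * ∫ s in a..a + ℓ, ∫ t in 0..ℓ, ‖ws s t‖ ^ 2) := by gcongr
    _ = _ := by
        have e1 : ∫ s in a..a + ℓ, ∫ t in 0..ℓ, (‖ws s t‖ ^ 2 + ‖wt s t‖ ^ 2)
            = (∫ s in a..a + ℓ, ∫ t in 0..ℓ, ‖ws s t‖ ^ 2)
              + ∫ s in a..a + ℓ, ∫ t in 0..ℓ, ‖wt s t‖ ^ 2 := by
          rw [← intervalIntegral.integral_add]
          · refine intervalIntegral.integral_congr fun s _ => ?_
            exact intervalIntegral.integral_add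
              (((csec cs' s).norm.pow 2).intervalIntegrable _ _)
              (((csec ct' s).norm.pow 2).intervalIntegrable _ _)
          · exact (cpar 0 ℓ (g := fun s t => ‖ws s t‖ ^ 2) (cs'.norm.pow 2)).intervalIntegrable _ _
          · exact (cpar 0 ℓ (g := fun s t => ‖wt s t‖ ^ 2) (ct'.norm.pow 2)).intervalIntegrable _ _
        rw [e1]
        field_simp
        ring

/-! ### The trace estimate -/

theorem fderiv_apply_eq (η : Plane → ℂ) (x v : Plane) :
    fderiv ℝ η x v = (v 0 : ℂ) * pderiv 0 η x + (v 1 : ℂ) * pderiv 1 η x := by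
  have h : v = v 0 • EuclideanSpace.single (0 : Fin 2) (1 : ℝ)
      + v 1 • EuclideanSpace.single (1 : Fin 2) (1 : ℝ) := by
    ext k; fin_cases k <;> simp
  conv_lhs => rw [h]
  rw [map_add, map_smul, map_smul]
  simp [pderiv]

namespace BoundaryParam

variable {Ω : Set Plane} {ι : Type} (Γ : BoundaryParam Ω ι) (i : ι)

/-- The scalar product of two gradients in the orthonormal frame of tangent and normal vector. -/
theorem frame_inner (ψ η : Plane → ℂ) (x : Plane) (s : ℝ) :
    fderiv ℝ ψ x (Γ.tangent i s) * conj (fderiv ℝ η x (Γ.tangent i s))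
      + fderiv ℝ ψ x (Γ.normal i s) * conj (fderiv ℝ η x (Γ.normal i s))
      = ∑ k, pderiv k ψ x * conj (pderiv k η x) := by
  have hT : ((Γ.tangent i s 0 : ℂ)) ^ 2 + (Γ.tangent i s 1 : ℂ) ^ 2 = 1 := by
    rw [← Complex.ofReal_pow, ← Complex.ofReal_pow, ← Complex.ofReal_add, Γ.tangent_sq i s,
      Complex.ofReal_one]
  simp only [fderiv_apply_eq, normal_zero, normal_one, map_add, map_mul, Complex.conj_ofReal,
    Fin.sum_univ_two, Complex.ofReal_neg, map_neg]
  linear_combination (pderiv 0 ψ x * conj (pderiv 0 η x) + pderiv 1 ψ x * conj (pderiv 1 η x)) * hT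

theorem frame_norm_sq (η : Plane → ℂ) (x : Plane) (s : ℝ) :
    ‖fderiv ℝ η x (Γ.tangent i s)‖ ^ 2 + ‖fderiv ℝ η x (Γ.normal i s)‖ ^ 2
      = ∑ k, ‖pderiv k η x‖ ^ 2 := by
  have h := Γ.frame_inner i η η x s
  simp only [Complex.mul_conj', Fin.sum_univ_two] at h ⊢
  exact_mod_cast h

theorem hasDerivAt_comp_tube_fst {η : Plane → ℂ} (hη : Differentiable ℝ η) (s t : ℝ) :
    HasDerivAt (fun s => η (Γ.tube i (s, t)))
      ((Γ.tubeJac i (s, t) : ℂ) * fderiv ℝ η (Γ.tube i (s, t)) (Γ.tangent i s)) s := by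
  have h1 := (hη _).hasFDerivAt.comp (s, t) (Γ.hasFDerivAt_tube i (s, t))
  have h2 : HasDerivAt (fun s : ℝ => (s, t)) ((1 : ℝ), (0 : ℝ)) s :=
    (hasDerivAt_id s).prodMk (hasDerivAt_const s t)
  refine (h1.comp_hasDerivAt s h2).congr_deriv ?_
  simp [tubeDeriv_apply]

theorem hasDerivAt_comp_tube_snd {η : Plane → ℂ} (hη : Differentiable ℝ η) (s t : ℝ) :
    HasDerivAt (fun t => η (Γ.tube i (s, t)))
      (-fderiv ℝ η (Γ.tube i (s, t)) (Γ.normal i s)) t := by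
  have h1 := (hη _).hasFDerivAt.comp (s, t) (Γ.hasFDerivAt_tube i (s, t))
  have h2 : HasDerivAt (fun t : ℝ => (s, t)) ((0 : ℝ), (1 : ℝ)) t :=
    (hasDerivAt_const t s).prodMk (hasDerivAt_id t)
  refine (h1.comp_hasDerivAt t h2).congr_deriv ?_
  simp [tubeDeriv_apply]

theorem continuous_fderiv_tube {η : Plane → ℂ} (hη : ContDiff ℝ ∞ η) {v : ℝ → Plane}
    (hv : Continuous v) :
    Continuous fun p : ℝ × ℝ => fderiv ℝ η (Γ.tube i p) (v p.1) := by
  have h1 : Continuous (fderiv ℝ η) := hη.continuous_fderiv (by simp)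
  exact (h1.comp (Γ.contDiff_tube i).continuous).clm_apply (hv.comp continuous_fst)

/-- Up to finitely many averages, the values of a test function on the piece `J` of the `i`-th
boundary curve are small compared with its gradient. -/
def TraceSmallOn (J : Set ℝ) : Prop :=
  ∀ r > 0, ∃ (𝒬 : Finset (Set Plane)) (C : ℝ), 0 ≤ C ∧
    (∀ Q ∈ 𝒬, MeasurableSet Q ∧ volume Q ≠ ⊤ ∧ Q ⊆ Ω) ∧
    ∀ η, IsTest η → ∫ s in J, ‖η (Γ.M i s)‖ ^ 2
      ≤ r * (∫ x in Ω, ∑ i, ‖pderiv i η x‖ ^ 2) + C * ∑ Q ∈ 𝒬, ‖∫ x in Q, η x‖ ^ 2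

theorem integrable_grad_sq {η : Plane → ℂ} (hη : IsTest η) :
    Integrable fun x => ∑ k, ‖pderiv k η x‖ ^ 2 := by
  refine integrable_finsetSum _ fun k _ => ?_
  have h := (hη.pderiv k).memLp 2 (volume : Measure Plane)
  exact (memLp_two_iff_integrable_sq_norm h.1).1 h

theorem grad_integral_nonneg (η : Plane → ℂ) (S : Set Plane) :
    0 ≤ ∫ x in S, ∑ k, ‖pderiv k η x‖ ^ 2 :=
  integral_nonneg fun _ => Finset.sum_nonneg fun _ _ => sq_nonneg _

theorem _root_.Robin.IsTest.continuous_comp_M {η : Plane → ℂ} (hη : IsTest η) :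
    Continuous fun s => ‖η (Γ.M i s)‖ ^ 2 :=
  (hη.1.continuous.comp (Γ.smooth i).continuous).norm.pow 2

variable {Γ i}

theorem TraceSmallOn.mono {J J' : Set ℝ} (h : Γ.TraceSmallOn i J) (hJ : J' ⊆ J)
    (hb : Bornology.IsBounded J) : Γ.TraceSmallOn i J' := by
  intro r hr
  obtain ⟨𝒬, C, hC, hQ, hη⟩ := h r hr
  refine ⟨𝒬, C, hC, hQ, fun η h1 => (?_ : _ ≤ _).trans (hη η h1)⟩
  refine setIntegral_mono_set ?_ (Eventually.of_forall fun s => sq_nonneg _) hJ.eventuallyLE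
  exact ((h1.continuous_comp_M Γ i).continuousOn.integrableOn_compact hb.isCompact_closure).mono_set
    subset_closure

theorem TraceSmallOn.union {J J' : Set ℝ} (h : Γ.TraceSmallOn i J) (h' : Γ.TraceSmallOn i J')
    (hb : Bornology.IsBounded J) (hb' : Bornology.IsBounded J') :
    Γ.TraceSmallOn i (J ∪ J') := by
  classical
  intro r hr
  obtain ⟨𝒬, C, hC, hQ, hη⟩ := h (r / 2) (half_pos hr)
  obtain ⟨𝒬', C', hC', hQ', hη'⟩ := h' (r / 2) (half_pos hr)
  refine ⟨𝒬 ∪ 𝒬', C + C', by positivity, fun Q hQm => ?_, fun η h1 => ?_⟩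
  · rcases Finset.mem_union.1 hQm with hm | hm
    exacts [hQ Q hm, hQ' Q hm]
  · have hint : ∀ {J : Set ℝ}, Bornology.IsBounded J →
        IntegrableOn (fun s => ‖η (Γ.M i s)‖ ^ 2) J := fun hb =>
      ((h1.continuous_comp_M Γ i).continuousOn.integrableOn_compact hb.isCompact_closure).mono_set
        subset_closure
    have e1 : ∫ s in J ∪ J', ‖η (Γ.M i s)‖ ^ 2
        ≤ (∫ s in J, ‖η (Γ.M i s)‖ ^ 2) + ∫ s in J', ‖η (Γ.M i s)‖ ^ 2 := by
      rw [← integral_add_measure (hint hb) (hint hb')]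
      refine integral_mono_measure (Measure.restrict_union_le _ _)
        (Eventually.of_forall fun s => sq_nonneg _) ?_
      exact Integrable.add_measure (hint hb) (hint hb')
    have e2 := hη η h1
    have e3 := hη' η h1
    have e4 : ∑ Q ∈ 𝒬, ‖∫ x in Q, η x‖ ^ 2 ≤ ∑ Q ∈ 𝒬 ∪ 𝒬', ‖∫ x in Q, η x‖ ^ 2 :=
      Finset.sum_le_sum_of_subset_of_nonneg Finset.subset_union_left fun _ _ _ => sq_nonneg _
    have e5 : ∑ Q ∈ 𝒬', ‖∫ x in Q, η x‖ ^ 2 ≤ ∑ Q ∈ 𝒬 ∪ 𝒬', ‖∫ x in Q, η x‖ ^ 2 :=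
      Finset.sum_le_sum_of_subset_of_nonneg Finset.subset_union_right fun _ _ _ => sq_nonneg _
    have e6 := mul_le_mul_of_nonneg_left e4 hC
    have e7 := mul_le_mul_of_nonneg_left e5 hC'
    calc _ ≤ _ := e1
      _ ≤ _ := add_le_add e2 e3
      _ ≤ _ := by linarith

/-- The piece of the boundary is divided into `N` intervals of length `ℓ = δ / N`, and each of them
is made one side of a square in the boundary coordinates. Summing up the inequality for the squares
gives the factor `384 ℓ` of the gradient term, which is small for large `N`: the factor is `48 ℓ`
for a single square, and the change of coordinates costs at most the factor `8`. -/
theorem IsPatch.traceSmallOn {s₀ δ : ℝ} (hδ : Γ.IsPatch i s₀ δ) :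
    Γ.TraceSmallOn i (Ioc (s₀ - δ / 2) (s₀ + δ / 2)) := by
  classical
  intro r hr
  have hδ0 := hδ.pos
  obtain ⟨N, hN⟩ := exists_nat_gt (max 2 (384 * δ / r))
  have hN2 : (2 : ℝ) < N := (le_max_left _ _).trans_lt hN
  have hN0 : (0 : ℝ) < N := by linarith
  have hNr : 384 * δ / r < N := (le_max_right _ _).trans_lt hN
  set ℓ := δ / N with hℓd
  have hℓ : 0 < ℓ := by positivity
  have hℓδ : ℓ < δ := by
    rw [hℓd, div_lt_iff₀ hN0]; nlinarith
  have hℓr : 384 * ℓ ≤ r := by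
    rw [div_lt_iff₀ hr] at hNr
    rw [hℓd, ← mul_div_assoc, div_le_iff₀ hN0]
    linarith
  set a : ℕ → ℝ := fun k => s₀ - δ / 2 + k * ℓ with ha
  have ha0 : a 0 = s₀ - δ / 2 := by simp [ha]
  have haN : a N = s₀ + δ / 2 := by simp only [ha, hℓd]; field_simp; ring
  have hasucc : ∀ k, a (k + 1) = a k + ℓ := fun k => by simp only [ha]; push_cast; ring
  have hamono : Monotone a := monotone_nat_of_le_succ fun k => by rw [hasucc]; linarith
  have hbox : ∀ k < N, ∀ s ∈ Icc (a k) (a k + ℓ), ∀ t ∈ Icc 0 ℓ, (s, t) ∈ box s₀ δ := by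
    intro k hk s hs t ht
    have h1 : a 0 ≤ a k := hamono (Nat.zero_le k)
    have h2 : a (k + 1) ≤ a N := hamono hk
    rw [hasucc, haN] at h2
    rw [ha0] at h1
    exact ⟨⟨by linarith [hs.1], by linarith [hs.2]⟩, by linarith [ht.1], by linarith [ht.2]⟩
  set S : ℕ → Set (ℝ × ℝ) := fun k => Ioc (a k) (a k + ℓ) ×ˢ Ioc 0 ℓ with hS
  have hSbox : ∀ k < N, S k ⊆ box s₀ δ := fun k hk p hp =>
    hbox k hk p.1 (Ioc_subset_Icc_self hp.1) p.2 (Ioc_subset_Icc_self hp.2)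
  have hSm : ∀ k, MeasurableSet (S k) := fun k => measurableSet_Ioc.prod measurableSet_Ioc
  have hcont : Continuous (Γ.tube i) := (Γ.contDiff_tube i).continuous
  refine ⟨(Finset.range N).image fun k => Γ.tube i '' S k, 12 / ℓ ^ 3, by positivity, ?_, ?_⟩
  · intro Q hQ
    obtain ⟨k, hk, rfl⟩ := Finset.mem_image.1 hQ
    have hk := Finset.mem_range.1 hk
    refine ⟨(hSm k).image_of_continuousOn_injOn hcont.continuousOn
      (hδ.injOn.mono (hSbox k hk)), ?_, ?_⟩
    · have : IsCompact (Γ.tube i '' (Icc (a k) (a k + ℓ) ×ˢ Icc 0 ℓ)) :=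
        (isCompact_Icc.prod isCompact_Icc).image hcont
      exact ((measure_mono (image_mono (Set.prod_mono Ioc_subset_Icc_self
        Ioc_subset_Icc_self))).trans_lt this.measure_lt_top).ne
    · rintro _ ⟨p, hp, rfl⟩
      exact hδ.mem p (hSbox k hk hp) hp.2.1
  · intro η hη
    have hηd : Differentiable ℝ η := hη.1.differentiable (by simp)
    have cη : Continuous η := hη.1.continuous
    have cT := Γ.continuous_fderiv_tube i hη.1 (Γ.contDiff_tangent i).continuous
    have cN := Γ.continuous_fderiv_tube i hη.1 (Γ.contDiff_normal i).continuous
    have cJ : Continuous (Γ.tubeJac i) := (Γ.contDiff_tubeJac i).continuous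
    set w : ℝ → ℝ → ℂ := fun s t => η (Γ.tube i (s, t)) with hw
    set ws : ℝ → ℝ → ℂ := fun s t =>
      (Γ.tubeJac i (s, t) : ℂ) * fderiv ℝ η (Γ.tube i (s, t)) (Γ.tangent i s) with hws
    set wt : ℝ → ℝ → ℂ := fun s t => -fderiv ℝ η (Γ.tube i (s, t)) (Γ.normal i s) with hwt
    have cw : Continuous (Function.uncurry w) := cη.comp hcont
    have cws : Continuous (Function.uncurry ws) := (Complex.continuous_ofReal.comp cJ).mul cT
    have cwt : Continuous (Function.uncurry wt) := cN.neg
    set g : ℝ → ℝ → ℝ := fun s t => ‖ws s t‖ ^ 2 + ‖wt s t‖ ^ 2 with hg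
    have cg : Continuous (Function.uncurry g) := (cws.norm.pow 2).add (cwt.norm.pow 2)
    -- Weighted by the Jacobian, the mean over a square in the boundary coordinates is an average
    -- over its image in the plane.
    have hsq : ∀ k < N, ∫ s in a k..a k + ℓ, ‖w s 0‖ ^ 2
        ≤ 48 * ℓ * (∫ s in a k..a k + ℓ, ∫ t in 0..ℓ, g s t)
          + 12 / ℓ ^ 3 * ‖∫ x in Γ.tube i '' S k, η x‖ ^ 2 := by
      intro k hk
      have h1 := trace_square_le (w := w) (ws := ws) (wt := wt)
        (ρ := fun s t => Γ.tubeJac i (s, t)) (fun s t => Γ.hasDerivAt_comp_tube_fst i hηd s t)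
        (fun s t => Γ.hasDerivAt_comp_tube_snd i hηd s t) cw cws cwt cJ (a := a k) hℓ
        (fun s hs t ht => hδ.jac_mem _ (hbox k hk s hs t ht))
      have h2 : ∫ x in Γ.tube i '' S k, η x
          = ∫ s in a k..a k + ℓ, ∫ t in 0..ℓ, (Γ.tubeJac i (s, t) : ℂ) * w s t := by
        rw [Γ.setIntegral_tube i (hSm k) (hδ.injOn.mono (hSbox k hk)),
          intervalIntegral.integral_of_le (by linarith)]
        simp only [intervalIntegral.integral_of_le hℓ.le]
        rw [hS, Measure.volume_eq_prod, setIntegral_prod]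
        · refine setIntegral_congr_fun measurableSet_Ioc fun s hs => ?_
          refine setIntegral_congr_fun measurableSet_Ioc fun t ht => ?_
          have h3 := hδ.jac_mem _ (hSbox k hk (⟨hs, ht⟩ : (s, t) ∈ S k))
          simp only [abs_of_nonneg (by linarith [h3.1] : 0 ≤ Γ.tubeJac i (s, t)), hw,
            Complex.real_smul]
        · have h3 : Continuous fun p : ℝ × ℝ => |Γ.tubeJac i p| • η (Γ.tube i p) :=
            cJ.abs.smul (cη.comp hcont)
          exact (h3.continuousOn.integrableOn_compact (isCompact_Icc.prod isCompact_Icc)).mono_set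
            (Set.prod_mono Ioc_subset_Icc_self Ioc_subset_Icc_self)
      rw [h2]
      exact h1
    have cG : Continuous fun s => ∫ t in 0..ℓ, g s t :=
      intervalIntegral.continuous_parametric_intervalIntegral_of_continuous' cg 0 ℓ
    have hint1 : ∑ k ∈ Finset.range N, ∫ s in a k..a k + ℓ, ‖w s 0‖ ^ 2
        = ∫ s in Ioc (s₀ - δ / 2) (s₀ + δ / 2), ‖η (Γ.M i s)‖ ^ 2 := by
      rw [← intervalIntegral.integral_of_le (by linarith), ← ha0, ← haN,
        ← intervalIntegral.sum_integral_adjacent_intervals fun k _ =>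
          (hη.continuous_comp_M Γ i).intervalIntegrable _ _]
      refine Finset.sum_congr rfl fun k _ => ?_
      simp only [hasucc, hw, tube_zero]
    have hint2 : ∑ k ∈ Finset.range N, ∫ s in a k..a k + ℓ, ∫ t in 0..ℓ, g s t
        ≤ 8 * ∫ x in Ω, ∑ k, ‖pderiv k η x‖ ^ 2 := by
      have h1 : ∑ k ∈ Finset.range N, ∫ s in a k..a k + ℓ, ∫ t in 0..ℓ, g s t
          = ∫ s in a 0..a N, ∫ t in 0..ℓ, g s t := by
        rw [← intervalIntegral.sum_integral_adjacent_intervals fun k _ =>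
          cG.intervalIntegrable _ _]
        simp only [hasucc]
      set R : Set (ℝ × ℝ) := Ioc (a 0) (a N) ×ˢ Ioc 0 ℓ with hR
      have hRm : MeasurableSet R := measurableSet_Ioc.prod measurableSet_Ioc
      have hRbox : R ⊆ box s₀ δ := by
        rintro p ⟨hp1, hp2⟩
        rw [ha0, haN] at hp1
        exact ⟨⟨by linarith [hp1.1], by linarith [hp1.2]⟩, by linarith [hp2.1], by linarith [hp2.2]⟩
      have hintR : ∀ {f : ℝ × ℝ → ℝ}, Continuous f → IntegrableOn f R := fun hf =>
        (hf.continuousOn.integrableOn_compact (isCompact_Icc.prod isCompact_Icc)).mono_set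
          (Set.prod_mono Ioc_subset_Icc_self Ioc_subset_Icc_self)
      have h2 : ∫ s in a 0..a N, ∫ t in 0..ℓ, g s t = ∫ p in R, g p.1 p.2 := by
        rw [intervalIntegral.integral_of_le (hamono (Nat.zero_le N))]
        simp only [intervalIntegral.integral_of_le hℓ.le]
        rw [hR, Measure.volume_eq_prod, setIntegral_prod]
        exact hintR cg
      have h3 : ∫ p in R, g p.1 p.2
          ≤ ∫ p in R, 8 * (|Γ.tubeJac i p| • ∑ k, ‖pderiv k η (Γ.tube i p)‖ ^ 2) := by
        have c1 : Continuous fun p => ∑ k, ‖pderiv k η (Γ.tube i p)‖ ^ 2 :=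
          continuous_finsetSum _ fun k _ =>
            ((hη.pderiv k).1.continuous.comp hcont).norm.pow 2
        refine setIntegral_mono_on (hintR cg) (hintR (continuous_const.mul (cJ.abs.smul c1))) hRm ?_
        rintro ⟨s, t⟩ hp
        have h4 := hδ.jac_mem _ (hRbox hp)
        have h5 := Γ.frame_norm_sq i η (Γ.tube i (s, t)) s
        have h6 : (0 : ℝ) ≤ Γ.tubeJac i (s, t) := by linarith [h4.1]
        simp only [hg, hws, hwt, norm_mul, norm_neg, Complex.norm_real, Real.norm_eq_abs,
          abs_of_nonneg h6, smul_eq_mul, mul_pow]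
        rw [← h5]
        -- The tangential derivative carries a factor `tubeJac`, whose square is at most
        -- `4 ≤ 8 * tubeJac`.
        have h7 : Γ.tubeJac i (s, t) ^ 2 ≤ 4 := by nlinarith [h4.2]
        have h8 := sq_nonneg ‖fderiv ℝ η (Γ.tube i (s, t)) (Γ.tangent i s)‖
        have h9 := sq_nonneg ‖fderiv ℝ η (Γ.tube i (s, t)) (Γ.normal i s)‖
        have h10 := mul_le_mul_of_nonneg_right h7 h8
        have h11 := mul_le_mul_of_nonneg_right h4.1 (add_nonneg h8 h9)
        linarith
      rw [h1, h2]
      refine h3.trans ?_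
      rw [integral_const_mul, ← Γ.setIntegral_tube i hRm (hδ.injOn.mono hRbox)
        (fun x => ∑ k, ‖pderiv k η x‖ ^ 2)]
      refine mul_le_mul_of_nonneg_left ?_ (by norm_num)
      refine setIntegral_mono_set (integrable_grad_sq hη).integrableOn
        (Eventually.of_forall fun x => Finset.sum_nonneg fun k _ => sq_nonneg _)
        (LE.le.eventuallyLE ?_)
      rintro _ ⟨p, hp, rfl⟩
      exact hδ.mem p (hRbox hp) hp.2.1
    have hinjS : ∑ Q ∈ (Finset.range N).image (fun k => Γ.tube i '' S k), ‖∫ x in Q, η x‖ ^ 2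
        = ∑ k ∈ Finset.range N, ‖∫ x in Γ.tube i '' S k, η x‖ ^ 2 := by
      refine Finset.sum_image fun k hk k' hk' hkk => ?_
      have hk := Finset.mem_range.1 (Finset.mem_coe.1 hk)
      have hk' := Finset.mem_range.1 (Finset.mem_coe.1 hk')
      have h1 : S k = S k' := (hδ.injOn.image_eq_image_iff (hSbox k hk) (hSbox k' hk')).1 hkk
      have h2 : (a k + ℓ, ℓ) ∈ S k' := h1 ▸ ⟨⟨by linarith, le_rfl⟩, hℓ, le_rfl⟩
      have h3 : (a k' + ℓ, ℓ) ∈ S k := h1 ▸ ⟨⟨by linarith, le_rfl⟩, hℓ, le_rfl⟩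
      have h4 : a k = a k' := by linarith [h2.1.2, h3.1.2]
      simp only [ha] at h4
      have h5 : (k : ℝ) * ℓ = k' * ℓ := by linarith
      exact_mod_cast mul_right_cancel₀ hℓ.ne' h5
    rw [← hint1, hinjS, Finset.mul_sum]
    refine (Finset.sum_le_sum fun k hk => hsq k (Finset.mem_range.1 hk)).trans ?_
    rw [Finset.sum_add_distrib, ← Finset.mul_sum]
    refine add_le_add ?_ le_rfl
    calc 48 * ℓ * ∑ k ∈ Finset.range N, ∫ s in a k..a k + ℓ, ∫ t in 0..ℓ, g s t
        ≤ 48 * ℓ * (8 * ∫ x in Ω, ∑ k, ‖pderiv k η x‖ ^ 2) := by gcongr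
      _ = 384 * ℓ * ∫ x in Ω, ∑ k, ‖pderiv k η x‖ ^ 2 := by ring
      _ ≤ _ := mul_le_mul_of_nonneg_right hℓr (grad_integral_nonneg η Ω)

end BoundaryParam

open BoundaryParam in
/-- The trace estimate, from local estimates in boundary coordinates. -/
theorem traceEstimate {Ω : Set Plane} (hΩ : IsOpen Ω) {ι : Type} [Fintype ι]
    (Γ : BoundaryParam Ω ι) : TraceEstimate Γ := by
  classical
  have hJ : ∀ i, Γ.TraceSmallOn i (Ioc 0 (Γ.len i)) := by
    intro i
    have h1 : Bornology.IsBounded (Icc 0 (Γ.len i)) ∧ Γ.TraceSmallOn i (Icc 0 (Γ.len i)) := by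
      refine isCompact_Icc.induction_on
        (p := fun J => Bornology.IsBounded J ∧ Γ.TraceSmallOn i J) ?_ ?_ ?_ ?_
      · refine ⟨Bornology.isBounded_empty, fun r hr => ⟨∅, 0, le_rfl, by simp, fun η _ => ?_⟩⟩
        simpa using mul_nonneg hr.le (grad_integral_nonneg η Ω)
      · exact fun J J' hJ h => ⟨h.1.subset hJ, h.2.mono hJ h.1⟩
      · exact fun J J' h h' => ⟨h.1.union h'.1, h.2.union h'.2 h.1 h'.1⟩
      · intro s _
        obtain ⟨δ, hδ⟩ := Γ.exists_isPatch i hΩ s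
        refine ⟨_, mem_nhdsWithin_of_mem_nhds (Ioc_mem_nhds ?_ ?_), Metric.isBounded_Ioc _ _,
          hδ.traceSmallOn⟩ <;> linarith [hδ.pos]
    exact h1.2.mono Ioc_subset_Icc_self h1.1
  intro r hr
  set n : ℝ := Fintype.card ι + 1 with hn
  have hn0 : 0 < n := by positivity
  choose 𝒬 C hC hQ hη using fun i => hJ i (r / n) (by positivity)
  set 𝒰 := Finset.univ.biUnion 𝒬 with h𝒰
  set e := 𝒰.equivFin
  refine ⟨𝒰.card, fun k => (e.symm k : Set Plane), ∑ i, C i, Finset.sum_nonneg fun i _ => hC i,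
    fun k => ?_, fun η h1 => ?_⟩
  · obtain ⟨i, -, hi⟩ := Finset.mem_biUnion.1 (e.symm k).2
    exact hQ i _ hi
  · have e1 : ∑ k, ‖∫ x in (e.symm k : Set Plane), η x‖ ^ 2
        = ∑ Q ∈ 𝒰, ‖∫ x in Q, η x‖ ^ 2 := by
      rw [← Finset.sum_coe_sort 𝒰]
      exact e.symm.sum_comp fun Q : 𝒰 => ‖∫ x in (Q : Set Plane), η x‖ ^ 2
    have e2 : ∫ x, ‖η x‖ ^ 2 ∂Γ.arcMeasure
        = ∑ i, ∫ s in Ioc 0 (Γ.len i), ‖η (Γ.M i s)‖ ^ 2 := by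
      have hmeas : ∀ i, AEMeasurable (Γ.M i) (volume.restrict (Ioc 0 (Γ.len i))) := fun i =>
        (Γ.smooth i).continuous.aemeasurable
      have hc : Continuous fun x => ‖η x‖ ^ 2 := h1.1.continuous.norm.pow 2
      rw [arcMeasure, integral_finsetSum_measure]
      · exact Finset.sum_congr rfl fun i _ => integral_map (hmeas i) hc.aestronglyMeasurable
      · intro i _
        rw [integrable_map_measure hc.aestronglyMeasurable (hmeas i)]
        exact ((h1.continuous_comp_M Γ i).continuousOn.integrableOn_compact
          isCompact_Icc).mono_set Ioc_subset_Icc_self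
    rw [e1, e2]
    set G := ∫ x in Ω, ∑ i, ‖pderiv i η x‖ ^ 2 with hG
    have hG0 : 0 ≤ G := grad_integral_nonneg η Ω
    calc ∑ i, ∫ s in Ioc 0 (Γ.len i), ‖η (Γ.M i s)‖ ^ 2
        ≤ ∑ i, (r / n * G + C i * ∑ Q ∈ 𝒰, ‖∫ x in Q, η x‖ ^ 2) := by
          refine Finset.sum_le_sum fun i _ => (hη i η h1).trans ?_
          refine add_le_add le_rfl (mul_le_mul_of_nonneg_left ?_ (hC i))
          exact Finset.sum_le_sum_of_subset_of_nonneg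
            (Finset.subset_biUnion_of_mem 𝒬 (Finset.mem_univ i)) fun _ _ _ => sq_nonneg _
      _ ≤ r * G + (∑ i, C i) * ∑ Q ∈ 𝒰, ‖∫ x in Q, η x‖ ^ 2 := by
          rw [Finset.sum_add_distrib, Finset.sum_mul]
          refine add_le_add ?_ le_rfl
          rw [Finset.sum_const, Finset.card_univ, nsmul_eq_mul]
          have e3 : (Fintype.card ι : ℝ) * (r / n * G) = (Fintype.card ι / n) * (r * G) := by ring
          rw [e3]
          have e4 : (Fintype.card ι : ℝ) / n ≤ 1 := by
            rw [div_le_one hn0]; linarith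
          exact mul_le_of_le_one_left (by positivity) e4

/-! ### The formal quasimode, in polynomials -/

section Recursion

variable {X : Type*} [Inhabited X] {R : ℕ → (ℕ → X) → X → Prop}

/-- The sequence in which every term is chosen in terms of the earlier ones. -/
def recSeq (hR : ∀ j h, ∃ x, R j h x) (j : ℕ) : X :=
  (hR j fun k => if _h : k < j then recSeq hR k else default).choose

/-- Recursion with a relation `R j h x` in which `x` is the `j`-th term and `h` matters only below
`j`. -/
theorem exists_seq_of_step (hR : ∀ j h, ∃ x, R j h x)
    (hcongr : ∀ j h h' x, (∀ k < j, h k = h' k) → R j h x → R j h' x) :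
    ∃ F : ℕ → X, ∀ j, R j F (F j) := by
  refine ⟨recSeq hR, fun j => ?_⟩
  have h1 := (hR j fun k => if _h : k < j then recSeq hR k else default).choose_spec
  rw [recSeq]
  exact hcongr j _ _ _ (fun k hk => by simp [hk]) h1

end Recursion

section Algebra

open Polynomial

/-- The polynomials in the rescaled boundary coordinates `σ = X 0` and `τ = X 1`. -/
abbrev Poly2 : Type := MvPolynomial (Fin 2) ℝ

/-- A polynomial in `σ`, as a polynomial in `σ` and `τ`. -/
def embS : ℝ[X] →ₐ[ℝ] Poly2 := aeval (MvPolynomial.X 0)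

theorem pderiv_zero_embS (p : ℝ[X]) :
    MvPolynomial.pderiv 0 (embS p) = embS (derivative p) := by
  rw [embS, Derivation.map_aeval, MvPolynomial.pderiv_X_self, smul_eq_mul, mul_one]

theorem pderiv_one_embS (p : ℝ[X]) : MvPolynomial.pderiv 1 (embS p) = 0 := by
  rw [embS, Derivation.map_aeval, MvPolynomial.pderiv_X_of_ne (by decide), smul_zero]

theorem embS_C (a : ℝ) : embS (C a) = MvPolynomial.C a := by
  rw [embS, aeval_C]; rfl

theorem embS_X : embS X = MvPolynomial.X 0 := by rw [embS, aeval_X]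

/-- `∂_σ`, conjugated with the weight `e^{-τ} e^{-ασ²/2}`. -/
def polyS (α : ℝ) : Poly2 →ₗ[ℝ] Poly2 :=
  (MvPolynomial.pderiv 0).toLinearMap - LinearMap.mulLeft ℝ (MvPolynomial.C α * MvPolynomial.X 0)

/-- `∂_τ`, conjugated with the weight `e^{-τ} e^{-ασ²/2}`. -/
def polyT : Poly2 →ₗ[ℝ] Poly2 := (MvPolynomial.pderiv 1).toLinearMap - LinearMap.id

theorem polyS_apply (α : ℝ) (p : Poly2) :
    polyS α p = MvPolynomial.pderiv 0 p - MvPolynomial.C α * MvPolynomial.X 0 * p := rfl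

theorem polyT_apply (p : Poly2) : polyT p = MvPolynomial.pderiv 1 p - p := rfl

theorem polyT_embS (p : ℝ[X]) : polyT (embS p) = - embS p := by
  rw [polyT_apply, pderiv_one_embS, zero_sub]

theorem pderiv_one_embS_mul_pow (b : ℝ[X]) (m : ℕ) :
    MvPolynomial.pderiv 1 (embS b * MvPolynomial.X 1 ^ (m + 1))
      = ((m : ℝ) + 1) • (embS b * MvPolynomial.X 1 ^ m) := by
  simp only [Derivation.leibniz, pderiv_one_embS, Derivation.leibniz_pow,
    MvPolynomial.pderiv_X_self, smul_eq_mul, mul_zero, add_zero, mul_one, Nat.add_sub_cancel,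
    nsmul_eq_mul, MvPolynomial.smul_eq_C_mul, map_add, map_natCast, map_one, Nat.cast_add,
    Nat.cast_one]
  ring

/-- The conjugated operator `-∂_τ² + 1` is `q ↦ 2 ∂_τ q - ∂_τ² q`, so it lowers the degree in `τ` by
one. -/
theorem transversal_mul_pow (j : ℕ) (b : ℝ[X]) :
    -polyT (polyT (embS b * MvPolynomial.X 1 ^ (j + 2))) + embS b * MvPolynomial.X 1 ^ (j + 2)
      = (2 * (j + 2) : ℝ) • (embS b * MvPolynomial.X 1 ^ (j + 1))
        - ((j + 2) * (j + 1) : ℝ) • (embS b * MvPolynomial.X 1 ^ j) := by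
  simp only [polyT_apply, map_sub, pderiv_one_embS_mul_pow b (j + 1), map_smul,
    pderiv_one_embS_mul_pow b j]
  push_cast
  module

/-- By induction on the power of `τ`: a multiple of `τ^(j+2)` solves the equation for `τ^(j+1)` up
to a multiple of `τ^j`. The Robin condition for `q e^{-τ}` is `∂_τ q = 0` at `τ = 0`. -/
theorem exists_transversal_solution_mul_pow (j : ℕ) (b : ℝ[X]) :
    ∃ (q : Poly2) (c : ℝ[X]),
      -polyT (polyT q) + q = embS b * MvPolynomial.X 1 ^ j - embS c ∧
      ∀ σ, MvPolynomial.eval ![σ, 0] (MvPolynomial.pderiv 1 q) = 0 := by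
  induction j with
  | zero => exact ⟨0, b, by simp, by simp⟩
  | succ j ih =>
    obtain ⟨q, c, h1, h2⟩ := ih
    refine ⟨(1 / (2 * (j + 2)) : ℝ) • (embS b * MvPolynomial.X 1 ^ (j + 2))
      + ((j + 1) / 2 : ℝ) • q, ((j + 1) / 2 : ℝ) • c, ?_, fun σ => ?_⟩
    · have e1 := transversal_mul_pow j b
      rw [neg_add_eq_iff_eq_add] at h1 e1
      simp only [map_add, map_smul]
      have e2 : ∀ (r s : ℝ) (x y x' y' : Poly2), -(r • x' + s • y') + (r • x + s • y)
          = r • (-x' + x) + s • (-y' + y) := fun r s x y x' y' => by module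
      rw [← neg_add_eq_iff_eq_add] at h1 e1
      rw [e2, h1, e1]
      match_scalars <;> field_simp
      ring
    · simp [Derivation.leibniz, Derivation.leibniz_pow, pderiv_one_embS, h2]

/-- The transversal equation `(P₀ + 1) g = r` with Robin condition is solvable up to a multiple of
the transversal ground state. -/
theorem exists_transversal_solution (r : Poly2) :
    ∃ (q : Poly2) (c : ℝ[X]), -polyT (polyT q) + q = r - embS c ∧
      ∀ σ, MvPolynomial.eval ![σ, 0] (MvPolynomial.pderiv 1 q) = 0 := by
  induction r using MvPolynomial.induction_on' with
  | monomial u a =>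
    obtain ⟨q, c, h1, h2⟩ := exists_transversal_solution_mul_pow (u 1) (C a * X ^ u 0)
    refine ⟨q, c, ?_, h2⟩
    rw [h1, MvPolynomial.monomial_eq, Finsupp.prod_fintype _ _ (by simp), Fin.prod_univ_two,
      map_mul, map_pow, embS_C, embS_X]
    ring
  | add p p' ih ih' =>
    obtain ⟨q, c, h1, h2⟩ := ih
    obtain ⟨q', c', h1', h2'⟩ := ih'
    refine ⟨q + q', c + c', ?_, fun σ => by simp [h2, h2']⟩
    simp only [map_add]
    linear_combination h1 + h1'

/-- The harmonic oscillator `-∂_σ² + α²σ² - (2N+1)α`, conjugated with the Gaussian. -/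
def oscillator (α : ℝ) (N : ℕ) (p : ℝ[X]) : ℝ[X] :=
  -derivative (derivative p) + C (2 * α) * (X * derivative p) - C (2 * α * N) * p

theorem coeff_oscillator (α : ℝ) (N : ℕ) (p : ℝ[X]) (k : ℕ) :
    (oscillator α N p).coeff k
      = -((k + 1) * (k + 2) * p.coeff (k + 2)) + 2 * α * (k - N) * p.coeff k := by
  rw [oscillator, coeff_sub, coeff_add, coeff_neg, coeff_derivative, coeff_derivative, coeff_C_mul,
    coeff_C_mul]
  rcases k with _ | k
  · simp; ring
  · rw [coeff_X_mul, coeff_derivative]; push_cast; ring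

theorem oscillator_add (α : ℝ) (N : ℕ) (p q : ℝ[X]) :
    oscillator α N (p + q) = oscillator α N p + oscillator α N q := by
  simp only [oscillator, map_add]; ring

theorem oscillator_C_mul (α : ℝ) (N : ℕ) (a : ℝ) (p : ℝ[X]) :
    oscillator α N (C a * p) = C a * oscillator α N p := by
  simp only [oscillator, derivative_C_mul]; ring

/-- Below the degree `N` the oscillator is triangular on polynomials with non-zero diagonal entries
`2α(k - N)`, so it is invertible there. -/
theorem exists_oscillator_eq_of_lt {α : ℝ} (hα : α ≠ 0) (N : ℕ) :
    ∀ m ≤ N, ∀ r : ℝ[X], (∀ k ≥ m, r.coeff k = 0) →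
      ∃ v : ℝ[X], (∀ k ≥ m, v.coeff k = 0) ∧ oscillator α N v = r := by
  intro m
  induction m with
  | zero =>
    intro _ r hr
    refine ⟨0, by simp, ?_⟩
    have : r = 0 := by ext k; simpa using hr k (Nat.zero_le k)
    simp [this, oscillator]
  | succ m ih =>
    intro hm r hr
    have hmN : (m : ℝ) - N ≠ 0 := by
      have : (m : ℝ) < N := by exact_mod_cast hm
      linarith
    set b := r.coeff m / (2 * α * (m - N)) with hb
    obtain ⟨v, hv, hDv⟩ := ih (by omega) (r - oscillator α N (C b * X ^ m)) (fun k hk => by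
      rw [coeff_sub, coeff_oscillator, coeff_C_mul_X_pow, coeff_C_mul_X_pow, if_neg (by omega)]
      rcases hk.eq_or_lt with h | h
      · rw [if_pos h.symm, ← h, hb]; field_simp; ring
      · rw [if_neg (by omega), hr k h]; simp)
    refine ⟨v + C b * X ^ m, fun k hk => ?_, ?_⟩
    · rw [coeff_add, hv k (by omega), coeff_C_mul_X_pow, if_neg (by omega), add_zero]
    · rw [oscillator_add, hDv]; ring

/-- Existence of the `N`-th Hermite polynomial. -/
theorem exists_oscillator_eigenfunction {α : ℝ} (hα : α ≠ 0) (N : ℕ) :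
    ∃ f : ℝ[X], oscillator α N f = 0 ∧ f.coeff N = 1 ∧ ∀ k > N, f.coeff k = 0 := by
  obtain ⟨w, hw, hDw⟩ := exists_oscillator_eq_of_lt hα N N le_rfl
    (oscillator α N (X ^ N)) (fun k hk => by
      rw [coeff_oscillator, coeff_X_pow, coeff_X_pow, if_neg (by omega)]
      rcases hk.eq_or_lt with h | h
      · rw [← h]; simp
      · rw [if_neg (by omega)]; simp)
  refine ⟨X ^ N + C (-1) * w, ?_, ?_, fun k hk => ?_⟩
  · rw [oscillator_add, oscillator_C_mul, hDw]; simp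
  · rw [coeff_add, coeff_C_mul, hw N le_rfl]; simp
  · rw [coeff_add, coeff_C_mul, hw k (by omega), coeff_X_pow, if_neg (by omega)]; simp

/-- The oscillator equation is solvable up to a multiple of the eigenfunction. -/
theorem exists_oscillator_eq {α : ℝ} (hα : α ≠ 0) (N : ℕ) {f : ℝ[X]} (hf1 : f.coeff N ≠ 0)
    (hf : ∀ k > N, f.coeff k = 0) :
    ∀ (m : ℕ) (r : ℝ[X]), (∀ k ≥ m, r.coeff k = 0) →
      ∃ (v : ℝ[X]) (ζ : ℝ), oscillator α N v = r + C ζ * f := by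
  intro m
  induction m with
  | zero =>
    intro r hr
    have : r = 0 := by ext k; simpa using hr k (Nat.zero_le k)
    exact ⟨0, 0, by simp [this, oscillator]⟩
  | succ m ih =>
    intro r hr
    by_cases hm : m = N
    -- the one degree in which the diagonal entry vanishes: the multiple of `f` takes its place
    · obtain ⟨v, ζ, h⟩ := ih (r - C (r.coeff m / f.coeff N) * f) (fun k hk => by
        rw [coeff_sub, coeff_C_mul]
        rcases hk.eq_or_lt with h | h
        · rw [← h, hm]; field_simp; ring
        · rw [hr k h, hf k (by omega)]; simp)
      exact ⟨v, ζ - r.coeff m / f.coeff N, by rw [h, map_sub]; ring⟩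
    · have hmN : (m : ℝ) - N ≠ 0 := by
        rw [sub_ne_zero]; exact_mod_cast hm
      set b := r.coeff m / (2 * α * (m - N)) with hb
      obtain ⟨v, ζ, h⟩ := ih (r - oscillator α N (C b * X ^ m)) (fun k hk => by
        rw [coeff_sub, coeff_oscillator, coeff_C_mul_X_pow, coeff_C_mul_X_pow, if_neg (by omega)]
        rcases hk.eq_or_lt with h | h
        · rw [if_pos h.symm, ← h, hb]; field_simp; ring
        · rw [if_neg (by omega), hr k h]; simp)
      exact ⟨v + C b * X ^ m, ζ, by rw [oscillator_add, h]; ring⟩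

/-- `-∂_σ² - α²σ²∂_τ - (2N+1)α`, conjugated with the weight; the third relevant coefficient of the
shifted operator. -/
def polyP3 (α : ℝ) (N : ℕ) : Poly2 →ₗ[ℝ] Poly2 :=
  -(polyS α ∘ₗ polyS α)
    - LinearMap.mulLeft ℝ (MvPolynomial.C (α ^ 2) * MvPolynomial.X 0 ^ 2) ∘ₗ polyT
    - ((2 * N + 1) * α) • LinearMap.id

theorem polyP3_embS (α : ℝ) (N : ℕ) (p : ℝ[X]) :
    polyP3 α N (embS p) = embS (oscillator α N p) := by
  have h : polyP3 α N (embS p) = -polyS α (polyS α (embS p))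
      - (MvPolynomial.C (α ^ 2) * MvPolynomial.X 0 ^ 2) * polyT (embS p)
      - ((2 * N + 1) * α) • embS p := rfl
  rw [h, polyT_embS]
  simp only [polyS_apply, pderiv_zero_embS, map_sub, Derivation.leibniz, MvPolynomial.pderiv_C,
    MvPolynomial.pderiv_X_self, smul_eq_mul, oscillator, map_add, map_neg, map_mul, embS_C, embS_X,
    MvPolynomial.smul_eq_C_mul, map_natCast, map_ofNat, map_one, map_pow]
  ring

/-- The coefficients, by powers of `ε = h^{1/8}`, of the conjugated operator minus the quasi-
eigenvalue. -/
def coefOp (α : ℝ) (N : ℕ) (κ₀ : ℝ) (Q : ℕ → Poly2 →ₗ[ℝ] Poly2) (ζ : ℕ → ℝ) :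
    ℕ → Poly2 →ₗ[ℝ] Poly2
  | 0 => -(polyT ∘ₗ polyT) + LinearMap.id
  | 4 => κ₀ • (polyT + LinearMap.id)
  | 6 => polyP3 α N
  | (j + 7) => Q j - ζ j • LinearMap.id
  | _ => 0

/-- The coefficients of the ansatz: `embS (V b)` from the multiples of the transversal ground
state, `q (b - 7)` from the correctors. -/
def coefPsi (V : ℕ → ℝ[X]) (q : ℕ → Poly2) (b : ℕ) : Poly2 :=
  embS (V b) + if 7 ≤ b then q (b - 7) else 0

/-- The formal series `∑ ε^b Ψ_b` solves the eigenvalue equation to all orders. Up to the order six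
this is the choice of the ground states `V₀`; the order `7 + j` determines `V (j + 1)`, `q j` and `ζ
j`: the corrector `q j` solves the transversal equation up to a multiple of the transversal ground
state, which is cancelled by the oscillator, applied to `V (j + 1)`, up to the multiple `ζ j` of the
eigenfunction. -/
theorem exists_formal_solution {α : ℝ} (hα : α ≠ 0) (N : ℕ) (κ₀ : ℝ) (Q : ℕ → Poly2 →ₗ[ℝ] Poly2)
    {V₀ : ℝ[X]} (hV : oscillator α N V₀ = 0) (hV1 : V₀.coeff N ≠ 0)
    (hV2 : ∀ k > N, V₀.coeff k = 0) :
    ∃ (V : ℕ → ℝ[X]) (q : ℕ → Poly2) (ζ : ℕ → ℝ), V 0 = V₀ ∧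
      (∀ j σ, MvPolynomial.eval ![σ, 0] (MvPolynomial.pderiv 1 (q j)) = 0) ∧
      ∀ k, ∑ a ∈ Finset.range (k + 1), coefOp α N κ₀ Q ζ a (coefPsi V q (k - a)) = 0 := by
  -- one unknown triple `(V (j + 1), q j, ζ j)` for each `j`
  set VV : (ℕ → ℝ[X] × Poly2 × ℝ) → ℕ → ℝ[X] := fun h k => if k = 0 then V₀ else (h (k - 1)).1
    with hVV
  -- the terms of the order `7 + j` that are known before the `j`-th step
  set rest : ℕ → (ℕ → ℝ[X] × Poly2 × ℝ) → Poly2 := fun j h =>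
    κ₀ • (polyT (if 4 ≤ j then (h (j - 4)).2.1 else 0) + if 4 ≤ j then (h (j - 4)).2.1 else 0)
      + polyP3 α N (if 6 ≤ j then (h (j - 6)).2.1 else 0)
      + (∑ i ∈ Finset.range j, (Q i - (h i).2.2 • LinearMap.id : Poly2 →ₗ[ℝ] Poly2)
          (coefPsi (VV h) (fun m => (h m).2.1) (j - i)))
      + Q j (embS V₀) with hrest
  obtain ⟨F, hF⟩ := exists_seq_of_step (X := ℝ[X] × Poly2 × ℝ)
    (R := fun j h x => (-polyT (polyT x.2.1) + x.2.1) + embS (oscillator α N x.1) + rest j h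
      - x.2.2 • embS V₀ = 0 ∧ ∀ σ, MvPolynomial.eval ![σ, 0] (MvPolynomial.pderiv 1 x.2.1) = 0)
    (fun j h => by
      obtain ⟨q, c, h1, h2⟩ := exists_transversal_solution (-rest j h)
      obtain ⟨v, ζ, h3⟩ := exists_oscillator_eq hα N hV1 hV2 (c.natDegree + 1) c
        (fun k hk => coeff_eq_zero_of_natDegree_lt (by omega))
      refine ⟨(v, q, ζ), ?_, h2⟩
      simp only
      rw [h1, h3, map_add, map_mul, embS_C, MvPolynomial.smul_eq_C_mul]
      ring)
    (fun j h h' x hh hx => by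
      refine ⟨?_, hx.2⟩
      -- `rest j` depends only on the triples before the `j`-th one
      have : rest j h = rest j h' := by
        simp only [hrest]
        have e4 : (if 4 ≤ j then (h (j - 4)).2.1 else 0)
            = if 4 ≤ j then (h' (j - 4)).2.1 else 0 := by
          split_ifs with h4
          · rw [hh _ (by omega)]
          · rfl
        have e6 : (if 6 ≤ j then (h (j - 6)).2.1 else 0)
            = if 6 ≤ j then (h' (j - 6)).2.1 else 0 := by
          split_ifs with h4
          · rw [hh _ (by omega)]
          · rfl
        rw [e4, e6]
        congr 2
        refine Finset.sum_congr rfl fun i hi => ?_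
        have hi := Finset.mem_range.1 hi
        have e7 : coefPsi (VV h) (fun m => (h m).2.1) (j - i)
            = coefPsi (VV h') (fun m => (h' m).2.1) (j - i) := by
          simp only [coefPsi, hVV, if_neg (by omega : j - i ≠ 0)]
          rw [hh (j - i - 1) (by omega)]
          split_ifs with h7
          · rw [hh _ (by omega)]
          · rfl
        rw [e7, hh i hi]
      rw [← this]; exact hx.1)
  refine ⟨VV F, fun j => (F j).2.1, fun j => (F j).2.2, by simp [hVV], fun j => (hF j).2, ?_⟩
  -- The operators of order zero and four vanish on multiples of the transversal ground state.
  have hT0 : ∀ p, coefOp α N κ₀ Q (fun j => (F j).2.2) 0 (embS p) = 0 := fun p => by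
    change -polyT (polyT (embS p)) + embS p = 0
    rw [polyT_embS, map_neg, polyT_embS]; ring
  have hT4 : ∀ p, coefOp α N κ₀ Q (fun j => (F j).2.2) 4 (embS p) = 0 := fun p => by
    change κ₀ • (polyT (embS p) + embS p) = 0
    rw [polyT_embS]; simp
  intro k
  -- Below the order seven no corrector occurs, and `V b` meets the oscillator only for `b = 0`.
  rcases lt_or_ge k 7 with hk | hk
  · have hpsi : ∀ b ≤ k, coefPsi (VV F) (fun j => (F j).2.1) b = embS (VV F b) := fun b hb => by
      rw [coefPsi, if_neg (by omega), add_zero]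
    refine Finset.sum_eq_zero fun a ha => ?_
    have ha := Finset.mem_range.1 ha
    rw [hpsi _ (by omega)]
    have ha7 : a < 7 := by omega
    interval_cases a
    · exact hT0 _
    · rfl
    · rfl
    · rfl
    · exact hT4 _
    · rfl
    · have : k - 6 = 0 := by omega
      rw [this]
      change polyP3 α N (embS (VV F 0)) = 0
      rw [polyP3_embS]
      simp [hVV, hV]
  · obtain ⟨j, rfl⟩ := Nat.exists_eq_add_of_le hk
    have hj := (hF j).1
    rw [show 7 + j + 1 = 7 + (j + 1) by ring, Finset.sum_range_add, Finset.sum_range_succ _ j]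
    -- the operators of order zero, four and six, applied to the correctors; the oscillator arises
    -- from the operator of order six, applied to `V (j + 1)`
    have e1 : ∑ a ∈ Finset.range 7, coefOp α N κ₀ Q (fun j => (F j).2.2) a
        (coefPsi (VV F) (fun j => (F j).2.1) (7 + j - a))
        = (-polyT (polyT (F j).2.1) + (F j).2.1)
          + κ₀ • (polyT (if 4 ≤ j then (F (j - 4)).2.1 else 0)
            + if 4 ≤ j then (F (j - 4)).2.1 else 0)
          + (embS (oscillator α N (F j).1)
            + polyP3 α N (if 6 ≤ j then (F (j - 6)).2.1 else 0)) := by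
      simp only [Finset.sum_range_succ, Finset.sum_range_zero, zero_add]
      have z : ∀ a p, a = 1 ∨ a = 2 ∨ a = 3 ∨ a = 5 →
          coefOp α N κ₀ Q (fun j => (F j).2.2) a p = 0 := by
        rintro a p (rfl | rfl | rfl | rfl) <;> rfl
      rw [z 1 _ (by simp), z 2 _ (by simp), z 3 _ (by simp), z 5 _ (by simp)]
      simp only [coefPsi, map_add, hT0, hT4, zero_add, add_zero]
      have c0 : (if 7 ≤ 7 + j - 0 then (F (7 + j - 0 - 7)).2.1 else 0) = (F j).2.1 := by
        rw [if_pos (by omega)]; congr; omega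
      have c4 : (if 7 ≤ 7 + j - 4 then (F (7 + j - 4 - 7)).2.1 else 0)
          = if 4 ≤ j then (F (j - 4)).2.1 else 0 := by
        by_cases h : 4 ≤ j
        · rw [if_pos (by omega), if_pos h]; congr 3; omega
        · rw [if_neg (by omega), if_neg h]
      have c6 : (if 7 ≤ 7 + j - 6 then (F (7 + j - 6 - 7)).2.1 else 0)
          = if 6 ≤ j then (F (j - 6)).2.1 else 0 := by
        by_cases h : 6 ≤ j
        · rw [if_pos (by omega), if_pos h]; congr 3; omega
        · rw [if_neg (by omega), if_neg h]
      have v6 : VV F (7 + j - 6) = (F j).1 := by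
        simp only [hVV, if_neg (by omega : 7 + j - 6 ≠ 0)]; congr; omega
      rw [c0, c4, c6, v6, ← polyP3_embS]
      rfl
    have e2 : ∀ i, coefOp α N κ₀ Q (fun j => (F j).2.2) (7 + i)
        = Q i - (F i).2.2 • LinearMap.id := fun i => by rw [add_comm]; rfl
    have e3 : coefPsi (VV F) (fun j => (F j).2.1) (7 + j - (7 + j)) = embS V₀ := by
      simp [coefPsi, hVV]
    have e4 : ∑ x ∈ Finset.range j, coefOp α N κ₀ Q (fun j => (F j).2.2) (7 + x)
        (coefPsi (VV F) (fun j => (F j).2.1) (7 + j - (7 + x)))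
        = ∑ i ∈ Finset.range j, (Q i - (F i).2.2 • LinearMap.id : Poly2 →ₗ[ℝ] Poly2)
          (coefPsi (VV F) (fun m => (F m).2.1) (j - i)) := by
      refine Finset.sum_congr rfl fun i _ => ?_
      rw [e2, Nat.add_sub_add_left]
    rw [e1, e4, e3, e2]
    refine Eq.trans ?_ hj
    simp only [hrest, LinearMap.sub_apply, LinearMap.smul_apply, LinearMap.id_apply]
    abel

end Algebra

/-! ### Polynomials with a Gaussian weight -/

section Weighted

theorem hasDerivAt_eval_fst (p : Poly2) (σ τ : ℝ) :
    HasDerivAt (fun s => MvPolynomial.eval ![s, τ] p)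
      (MvPolynomial.eval ![σ, τ] (MvPolynomial.pderiv 0 p)) σ := by
  induction p using MvPolynomial.induction_on with
  | C a => simpa using hasDerivAt_const σ a
  | add p q hp hq => simpa using hp.fun_add hq
  | mul_X p i hp =>
    fin_cases i
    · simpa [Derivation.leibniz, mul_comm, add_comm] using hp.fun_mul (hasDerivAt_id' σ)
    · simpa [Derivation.leibniz, MvPolynomial.pderiv_X_of_ne, mul_comm] using hp.mul_const τ

theorem hasDerivAt_eval_snd (p : Poly2) (σ τ : ℝ) :
    HasDerivAt (fun t => MvPolynomial.eval ![σ, t] p)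
      (MvPolynomial.eval ![σ, τ] (MvPolynomial.pderiv 1 p)) τ := by
  induction p using MvPolynomial.induction_on with
  | C a => simpa using hasDerivAt_const τ a
  | add p q hp hq => simpa using hp.fun_add hq
  | mul_X p i hp =>
    fin_cases i
    · simpa [Derivation.leibniz, MvPolynomial.pderiv_X_of_ne, mul_comm] using hp.mul_const σ
    · simpa [Derivation.leibniz, mul_comm, add_comm] using hp.fun_mul (hasDerivAt_id' τ)

theorem contDiff_eval (p : Poly2) :
    ContDiff ℝ ∞ (fun x : ℝ × ℝ => MvPolynomial.eval ![x.1, x.2] p) := by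
  induction p using MvPolynomial.induction_on with
  | C a => simpa using contDiff_const
  | add p q hp hq => simpa using hp.add hq
  | mul_X p i hp =>
    fin_cases i
    · simpa using hp.mul contDiff_fst
    · simpa using hp.mul contDiff_snd

/-- The function `p(σ, τ) e^{-τ - ασ²/2}`. -/
def ev (α : ℝ) (p : Poly2) (σ τ : ℝ) : ℝ :=
  MvPolynomial.eval ![σ, τ] p * Real.exp (-τ - α / 2 * σ ^ 2)

variable (α : ℝ)

theorem ev_add (p q : Poly2) (σ τ : ℝ) : ev α (p + q) σ τ = ev α p σ τ + ev α q σ τ := by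
  simp only [ev, map_add]; ring

theorem ev_neg (p : Poly2) (σ τ : ℝ) : ev α (-p) σ τ = -ev α p σ τ := by
  simp only [ev, map_neg]; ring

theorem ev_sub (p q : Poly2) (σ τ : ℝ) : ev α (p - q) σ τ = ev α p σ τ - ev α q σ τ := by
  simp only [ev, map_sub]; ring

theorem ev_smul (c : ℝ) (p : Poly2) (σ τ : ℝ) : ev α (c • p) σ τ = c * ev α p σ τ := by
  simp only [ev, MvPolynomial.smul_eval]; ring

theorem ev_mul (r p : Poly2) (σ τ : ℝ) :
    ev α (r * p) σ τ = MvPolynomial.eval ![σ, τ] r * ev α p σ τ := by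
  simp only [ev, map_mul]; ring

theorem ev_zero (σ τ : ℝ) : ev α 0 σ τ = 0 := by simp [ev]

theorem ev_sum {κ : Type*} (s : Finset κ) (p : κ → Poly2) (σ τ : ℝ) :
    ev α (∑ i ∈ s, p i) σ τ = ∑ i ∈ s, ev α (p i) σ τ := by
  simp only [ev, map_sum, Finset.sum_mul]

theorem hasDerivAt_ev_fst (p : Poly2) (σ τ : ℝ) :
    HasDerivAt (fun s => ev α p s τ) (ev α (polyS α p) σ τ) σ := by
  have h : HasDerivAt (fun s : ℝ => -τ - α / 2 * s ^ 2) (-(α * σ)) σ := by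
    have := ((hasDerivAt_pow 2 σ).const_mul (α / 2)).const_sub (-τ)
    exact this.congr_deriv (by norm_num; ring)
  refine ((hasDerivAt_eval_fst p σ τ).fun_mul h.exp).congr_deriv ?_
  simp [ev, polyS_apply]; ring

theorem hasDerivAt_ev_snd (p : Poly2) (σ τ : ℝ) :
    HasDerivAt (fun t => ev α p σ t) (ev α (polyT p) σ τ) τ := by
  have h : HasDerivAt (fun t : ℝ => -t - α / 2 * σ ^ 2) (-1) τ :=
    (hasDerivAt_id τ).neg.sub_const _
  refine ((hasDerivAt_eval_snd p σ τ).fun_mul h.exp).congr_deriv ?_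
  simp [ev, polyT_apply]; ring

theorem dS_ev (p : Poly2) : dS (ev α p) = ev α (polyS α p) := by
  funext σ τ; exact (hasDerivAt_ev_fst α p σ τ).deriv

theorem dT_ev (p : Poly2) : dT (ev α p) = ev α (polyT p) := by
  funext σ τ; exact (hasDerivAt_ev_snd α p σ τ).deriv

theorem contDiff_ev (p : Poly2) : ContDiff ℝ ∞ (fun x : ℝ × ℝ => ev α p x.1 x.2) := by
  unfold ev
  exact (contDiff_eval p).mul (by fun_prop)

theorem exists_abs_eval_le (p : Poly2) :
    ∃ (C : ℝ) (d : ℕ), 0 ≤ C ∧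
      ∀ σ τ, |MvPolynomial.eval ![σ, τ] p| ≤ C * (1 + |σ| + |τ|) ^ d := by
  induction p using MvPolynomial.induction_on with
  | C a => exact ⟨|a|, 0, abs_nonneg a, by simp⟩
  | add p q hp hq =>
    obtain ⟨C, d, hC, h⟩ := hp
    obtain ⟨C', d', hC', h'⟩ := hq
    refine ⟨C + C', d + d', by positivity, fun σ τ => ?_⟩
    have h1 : 1 ≤ 1 + |σ| + |τ| := by have := abs_nonneg σ; have := abs_nonneg τ; linarith
    rw [map_add]
    calc _ ≤ _ := abs_add_le _ _
      _ ≤ C * (1 + |σ| + |τ|) ^ (d + d') + C' * (1 + |σ| + |τ|) ^ (d + d') :=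
        add_le_add ((h σ τ).trans (by gcongr; exacts [by omega]))
          ((h' σ τ).trans (by gcongr; exacts [by omega]))
      _ = _ := by ring
  | mul_X p i hp =>
    obtain ⟨C, d, hC, h⟩ := hp
    refine ⟨C, d + 1, hC, fun σ τ => ?_⟩
    have h1 : |(![σ, τ] : Fin 2 → ℝ) i| ≤ 1 + |σ| + |τ| := by
      have := abs_nonneg σ
      have := abs_nonneg τ
      fin_cases i <;> simp <;> linarith
    rw [map_mul, MvPolynomial.eval_X, abs_mul, pow_succ, ← mul_assoc]
    exact mul_le_mul (h σ τ) h1 (abs_nonneg _) (by positivity)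

theorem pow_mul_exp_neg_le {c : ℝ} (hc : 0 < c) (k : ℕ) {x : ℝ} (hx : 0 ≤ x) :
    x ^ k * Real.exp (-(c * x)) ≤ k ! / c ^ k := by
  have h := Real.pow_div_factorial_le_exp (c * x) (by positivity) k
  rw [mul_pow, div_le_iff₀ (by positivity)] at h
  rw [Real.exp_neg, ← div_eq_mul_inv, div_le_div_iff₀ (Real.exp_pos _) (by positivity)]
  linarith

variable {α}

/-- Polynomial factors cost at most half of the weight. -/
theorem exists_pow_mul_ev_le (hα : 0 < α) (p : Poly2) (m : ℕ) :
    ∃ C, 0 < C ∧ ∀ σ τ : ℝ, 0 ≤ τ →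
      (1 + |σ| + |τ|) ^ m * |ev α p σ τ| ≤ C * Real.exp (-τ / 2 - α / 4 * σ ^ 2) := by
  obtain ⟨C, d, hC, h⟩ := exists_abs_eval_le p
  set c := min (1 / 2) (α / 2) with hc
  have hc0 : 0 < c := by positivity
  refine ⟨C * ((m + d) ! / c ^ (m + d) * Real.exp (α / 4 + c)) + 1, by positivity,
    fun σ τ hτ => ?_⟩
  have hx : 0 ≤ 1 + |σ| + |τ| := by positivity
  have h1 := pow_mul_exp_neg_le hc0 (m + d) hx
  -- Half of the weight is bounded by `e^{-c(1 + |σ| + |τ|)}` where `c = min (1/2) (α/2)`, because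
  -- of `α/4 (|σ| - 1)² ≥ 0`; this absorbs all powers of `1 + |σ| + |τ|`.
  have h2 : Real.exp (-τ / 2 - α / 4 * σ ^ 2)
      ≤ Real.exp (α / 4 + c) * Real.exp (-(c * (1 + |σ| + |τ|))) := by
    rw [← Real.exp_add, Real.exp_le_exp, abs_of_nonneg hτ]
    have a1 : c * τ ≤ 1 / 2 * τ := by gcongr; exact min_le_left _ _
    have a2 : c * |σ| ≤ α / 2 * |σ| := by gcongr; exact min_le_right _ _
    have a3 : 0 ≤ α / 4 * (|σ| - 1) ^ 2 := by positivity
    have a4 := sq_abs σ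
    nlinarith
  have e : Real.exp (-τ - α / 2 * σ ^ 2)
      = Real.exp (-τ / 2 - α / 4 * σ ^ 2) * Real.exp (-τ / 2 - α / 4 * σ ^ 2) := by
    rw [← Real.exp_add]; ring_nf
  rw [ev, abs_mul, Real.abs_exp, e]
  set w := Real.exp (-τ / 2 - α / 4 * σ ^ 2) with hw
  have hw0 : 0 < w := Real.exp_pos _
  have h3 : (1 + |σ| + |τ|) ^ (m + d) * w ≤ (m + d) ! / c ^ (m + d) * Real.exp (α / 4 + c) :=
    calc (1 + |σ| + |τ|) ^ (m + d) * w
        ≤ (1 + |σ| + |τ|) ^ (m + d)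
          * (Real.exp (α / 4 + c) * Real.exp (-(c * (1 + |σ| + |τ|)))) := by gcongr
      _ = (1 + |σ| + |τ|) ^ (m + d) * Real.exp (-(c * (1 + |σ| + |τ|)))
          * Real.exp (α / 4 + c) := by ring
      _ ≤ _ := by gcongr
  calc (1 + |σ| + |τ|) ^ m * (|MvPolynomial.eval ![σ, τ] p| * (w * w))
      ≤ (1 + |σ| + |τ|) ^ m * (C * (1 + |σ| + |τ|) ^ d * (w * w)) := by gcongr; exact h σ τ
    _ = C * ((1 + |σ| + |τ|) ^ (m + d) * w) * w := by rw [pow_add]; ring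
    _ ≤ C * ((m + d) ! / c ^ (m + d) * Real.exp (α / 4 + c)) * w := by gcongr
    _ ≤ _ := by nlinarith

end Weighted

/-! ### Expansions in powers of `ε` with polynomial coefficients -/

section Expansion

open Polynomial

/-- A polynomial that is `O(ε^N)` at `0` has no terms of order below `N`. -/
theorem coeff_eq_zero_of_isBigO (N : ℕ) : ∀ (R : ℝ[X]),
    ((fun ε : ℝ => R.eval ε) =O[𝓝[>] 0] fun ε : ℝ => ε ^ N) → ∀ k < N, R.coeff k = 0 := by
  induction N with
  | zero => intro R _ k hk; omega
  | succ N ih =>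
    intro R hR k hk
    have h0 : R.coeff 0 = 0 := by
      have h1 : Tendsto (fun ε : ℝ => ε ^ (N + 1)) (𝓝[>] 0) (𝓝 0) := by
        have : Tendsto (fun ε : ℝ => ε ^ (N + 1)) (𝓝 0) (𝓝 (0 ^ (N + 1))) :=
          (continuous_pow (N + 1)).tendsto 0
        rw [zero_pow (Nat.succ_ne_zero N)] at this
        exact this.mono_left nhdsWithin_le_nhds
      have h2 := hR.trans_tendsto h1
      have h3 : Tendsto (fun ε : ℝ => R.eval ε) (𝓝[>] 0) (𝓝 (R.eval 0)) :=
        (R.continuous.tendsto 0).mono_left nhdsWithin_le_nhds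
      rw [coeff_zero_eq_eval_zero]
      exact tendsto_nhds_unique h3 h2
    have hX : X * R.divX = R := by
      have := X_mul_divX_add R
      rwa [h0, map_zero, add_zero] at this
    rcases k with _ | k
    · exact h0
    · rw [← hX, coeff_X_mul]
      refine ih _ ?_ k (by omega)
      have h4 : (fun ε : ℝ => ε * R.divX.eval ε) =O[𝓝[>] 0] fun ε : ℝ => ε * ε ^ N := by
        convert hR using 2 with ε ε
        · conv_rhs => rw [← hX]
          simp
        · ring
      have h5 := (isBigO_refl (fun ε : ℝ => ε⁻¹) (𝓝[>] 0)).mul h4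
      refine (h5.congr' ?_ ?_) <;>
      · filter_upwards [self_mem_nhdsWithin] with ε hε
        rw [← mul_assoc, inv_mul_cancel₀ (ne_of_gt hε), one_mul]

/-- A polynomial that approximates a smooth function up to `O(ε^N)` has its Taylor coefficients
below the order `N`. -/
theorem taylorCoef_eq_of_isBigO {F : ℝ → ℝ} (hF : ContDiffAt ℝ ∞ F 0) (R : ℝ[X]) (N : ℕ)
    (h : (fun ε : ℝ => F ε - R.eval ε) =O[𝓝[>] 0] fun ε : ℝ => ε ^ N) :
    ∀ k < N, taylorCoef k F = R.coeff k := by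
  have hF' : ContDiffAt ℝ N F 0 := hF.of_le (by exact_mod_cast le_top)
  obtain ⟨u, hu, hFu⟩ := hF'.contDiffOn le_rfl (by simp)
  obtain ⟨r, hr, hru⟩ := Metric.mem_nhds_iff.1 hu
  have hT := taylor_isLittleO (convex_ball (0 : ℝ) r) (Metric.mem_ball_self hr) (hFu.mono hru)
  rw [Metric.isOpen_ball.nhdsWithin_eq (Metric.mem_ball_self hr)] at hT
  set T : ℝ[X] := ∑ k ∈ Finset.range (N + 1), C (taylorCoef k F) * X ^ k with hTdef
  have hTe : ∀ ε, taylorWithinEval F N (Metric.ball 0 r) 0 ε = T.eval ε := fun ε => by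
    rw [taylor_within_apply, hTdef, eval_finsetSum]
    refine Finset.sum_congr rfl fun k _ => ?_
    rw [iteratedDerivWithin_of_isOpen Metric.isOpen_ball (Metric.mem_ball_self hr), taylorCoef]
    simp; ring
  have h1 : (fun ε : ℝ => (T - R).eval ε) =O[𝓝[>] 0] fun ε : ℝ => ε ^ N := by
    have h2 : (fun ε : ℝ => F ε - T.eval ε) =O[𝓝[>] 0] fun ε : ℝ => ε ^ N := by
      have := (hT.isBigO.mono (nhdsWithin_le_nhds (s := Ioi (0 : ℝ))))
      simpa only [hTe, sub_zero] using this
    refine (h.sub h2).congr_left fun ε => ?_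
    rw [eval_sub]; ring
  intro k hk
  have h3 := coeff_eq_zero_of_isBigO N _ h1 k hk
  rw [coeff_sub, sub_eq_zero] at h3
  rw [← h3, hTdef, finsetSum_coeff, Finset.sum_eq_single k]
  · simp
  · intro b _ hb
    rw [coeff_C_mul_X_pow, if_neg (Ne.symm hb)]
  · intro hk'; exact absurd (Finset.mem_range.2 (by omega)) hk'

/-- Smooth functions of two variables near the origin that have Taylor polynomials of every
order. -/
def PolyApprox (G : ℝ × ℝ → ℝ) : Prop :=
  ContDiffAt ℝ ∞ G 0 ∧ ∀ N : ℕ, ∃ P : Poly2,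
    (fun p : ℝ × ℝ => G p - MvPolynomial.eval ![p.1, p.2] P) =O[𝓝 0] fun p => ‖p‖ ^ N

namespace PolyApprox

theorem eval (P : Poly2) : PolyApprox fun p => MvPolynomial.eval ![p.1, p.2] P :=
  ⟨(contDiff_eval P).contDiffAt, fun N => ⟨P, by simpa using isBigO_zero _ _⟩⟩

theorem add {G G' : ℝ × ℝ → ℝ} (hG : PolyApprox G) (hG' : PolyApprox G') :
    PolyApprox fun p => G p + G' p := by
  refine ⟨hG.1.add hG'.1, fun N => ?_⟩
  obtain ⟨P, hP⟩ := hG.2 N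
  obtain ⟨P', hP'⟩ := hG'.2 N
  refine ⟨P + P', (hP.add hP').congr_left fun p => ?_⟩
  rw [map_add]; ring

theorem mul {G G' : ℝ × ℝ → ℝ} (hG : PolyApprox G) (hG' : PolyApprox G') :
    PolyApprox fun p => G p * G' p := by
  refine ⟨hG.1.mul hG'.1, fun N => ?_⟩
  obtain ⟨P, hP⟩ := hG.2 N
  obtain ⟨P', hP'⟩ := hG'.2 N
  have h1 : G' =O[𝓝 0] fun _ => (1 : ℝ) := hG'.1.continuousAt.isBigO_one ℝ
  have h2 : (fun p : ℝ × ℝ => MvPolynomial.eval ![p.1, p.2] P) =O[𝓝 0] fun _ => (1 : ℝ) :=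
    (contDiff_eval P).continuous.continuousAt.isBigO_one ℝ
  have h3 := hP.mul h1
  have h4 := h2.mul hP'
  simp only [mul_one, one_mul] at h3 h4
  refine ⟨P * P', (h3.add h4).congr_left fun p => ?_⟩
  rw [map_mul]; ring

theorem pow {G : ℝ × ℝ → ℝ} (hG : PolyApprox G) (k : ℕ) : PolyApprox fun p => G p ^ k := by
  induction k with
  | zero => simpa using eval 1
  | succ k ih => simpa only [pow_succ] using ih.mul hG

theorem sum {G : ℕ → ℝ × ℝ → ℝ} (hG : ∀ k, PolyApprox (G k)) (N : ℕ) :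
    PolyApprox fun p => ∑ k ∈ Finset.range N, G k p := by
  induction N with
  | zero => simpa using eval 0
  | succ k ih => simpa only [Finset.sum_range_succ] using ih.add (hG k)

theorem comp_fst {k : ℝ → ℝ} (hk : ContDiff ℝ ∞ k) : PolyApprox fun p => k p.1 := by
  refine ⟨(hk.comp contDiff_fst).contDiffAt, fun N => ?_⟩
  have h := taylor_isLittleO_univ (x₀ := (0 : ℝ)) (n := N)
    (hk.of_le (by exact_mod_cast le_top) : ContDiff ℝ N k)
  have hf : Tendsto (fun p : ℝ × ℝ => p.1) (𝓝 0) (𝓝 0) := continuous_fst.tendsto (0 : ℝ × ℝ)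
  refine ⟨∑ j ∈ Finset.range (N + 1),
    MvPolynomial.C ((j ! : ℝ)⁻¹ * iteratedDerivWithin j k univ 0) * MvPolynomial.X 0 ^ j, ?_⟩
  have h1 : ((fun x => (x - 0) ^ N) ∘ fun p : ℝ × ℝ => p.1) =O[𝓝 0] fun p => ‖p‖ ^ N := by
    refine IsBigO.of_bound 1 (Eventually.of_forall fun p => ?_)
    simp only [Function.comp, sub_zero, norm_pow, norm_norm, one_mul]
    exact pow_le_pow_left₀ (norm_nonneg _) (norm_fst_le p) _
  refine ((h.isBigO.comp_tendsto hf).trans h1).congr_left fun p => ?_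
  · simp only [Function.comp, taylor_within_apply, map_sum, map_mul, map_pow, MvPolynomial.eval_C,
      MvPolynomial.eval_X, sub_zero, smul_eq_mul]
    congr 1
    refine Finset.sum_congr rfl fun j _ => ?_
    simp; ring

/-- By the finite geometric series, `(1 - w)⁻¹ - ∑_{k<N} w^k = w^N (1 - w)⁻¹`, which is `O(‖p‖^N)`.
-/
theorem inv_one_sub {w : ℝ × ℝ → ℝ} (hw : PolyApprox w) (h0 : w 0 = 0) :
    PolyApprox fun p => (1 - w p)⁻¹ := by
  have hc : ContDiffAt ℝ ∞ (fun p => (1 - w p)⁻¹) 0 :=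
    (contDiffAt_const.sub hw.1).inv (by simp [h0])
  refine ⟨hc, fun N => ?_⟩
  obtain ⟨P, hP⟩ := (sum (fun j => hw.pow j) N).2 N
  have hO : w =O[𝓝 0] fun p => ‖p‖ := by
    have := (hw.1.differentiableAt (by simp)).isBigO_sub
    simpa [h0] using this.norm_right
  have h1 : (fun p => w p ^ N * (1 - w p)⁻¹) =O[𝓝 0] fun p => ‖p‖ ^ N * (1 : ℝ) :=
    (hO.pow N).mul (hc.continuousAt.isBigO_one ℝ)
  simp only [mul_one] at h1
  refine ⟨P, (hP.add h1).congr' ?_ EventuallyEq.rfl⟩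
  have hne : ∀ᶠ p in 𝓝 (0 : ℝ × ℝ), 1 - w p ≠ 0 :=
    (continuousAt_const.sub hw.1.continuousAt).eventually_ne (by simp [h0])
  filter_upwards [hne] with p hp
  have hg := geom_sum_mul (w p) N
  have : ∑ i ∈ Finset.range N, w p ^ i = (1 - w p ^ N) * (1 - w p)⁻¹ := by
    field_simp
    linear_combination -hg
  rw [this]; ring

end PolyApprox

/-- Substitution of `x = εσ` and `y = ε⁴τ`, as a polynomial in `ε`. -/
def rescale : Poly2 →ₐ[ℝ] Poly2[X] :=
  MvPolynomial.aeval ![C (MvPolynomial.X 0) * X, C (MvPolynomial.X 1) * X ^ 4]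

theorem eval_map_rescale (P : Poly2) (ε σ τ : ℝ) :
    ((rescale P).map (MvPolynomial.eval ![σ, τ])).eval ε
      = MvPolynomial.eval ![ε * σ, ε ^ 4 * τ] P := by
  induction P using MvPolynomial.induction_on with
  | C a => simp [rescale, MvPolynomial.algebraMap_eq]
  | add p q hp hq => simp only [map_add, Polynomial.map_add, eval_add, hp, hq]
  | mul_X p i hp =>
    rw [map_mul, Polynomial.map_mul, eval_mul, hp, map_mul]
    congr 1
    fin_cases i <;> simp [rescale] <;> ring

/-- The rescaling maps a point to one of norm `O(ε)`, with an explicit dependence on the point. -/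
theorem norm_rescale_le {ε : ℝ} (hε : 0 ≤ ε) (hε1 : ε ≤ 1) (σ τ : ℝ) :
    ‖((ε * σ, ε ^ 4 * τ) : ℝ × ℝ)‖ ≤ ε * (1 + |σ| + |τ|) := by
  have := abs_nonneg σ
  have := abs_nonneg τ
  rw [Prod.norm_def, sup_le_iff]
  simp only [Real.norm_eq_abs, abs_mul, abs_pow, abs_of_nonneg hε]
  constructor
  · gcongr; linarith
  · calc ε ^ 4 * |τ| ≤ ε * |τ| := by
          gcongr
          exact pow_le_of_le_one hε hε1 (by norm_num)
      _ ≤ _ := by gcongr; linarith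

/-- A function `ε^m G(εσ, ε⁴τ)` has an expansion in powers of `ε` whose coefficients are
polynomials in `σ` and `τ`, with polynomially bounded remainders. -/
theorem PolyApprox.exists_expansion {G : ℝ × ℝ → ℝ} (hG : PolyApprox G) (m : ℕ) :
    ∃ c : ℕ → Poly2,
      (∀ k σ τ, taylorCoef k (fun ε => ε ^ m * G (ε * σ, ε ^ 4 * τ))
        = MvPolynomial.eval ![σ, τ] (c k)) ∧
      ∀ N : ℕ, ∃ δ > 0, ∃ (C : ℝ) (d : ℕ), 0 ≤ C ∧ ∀ ε σ τ : ℝ, 0 < ε → ε ≤ 1 →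
        |ε * σ| < δ → |ε ^ 4 * τ| < δ →
        |ε ^ m * G (ε * σ, ε ^ 4 * τ)
            - ∑ k ∈ Finset.range N, ε ^ k * MvPolynomial.eval ![σ, τ] (c k)|
          ≤ C * ε ^ N * (1 + |σ| + |τ|) ^ d := by
  choose P hP using hG.2
  -- the rescaled Taylor polynomial of order `N`, as a polynomial in `ε`
  set R : ℕ → Poly2[X] := fun N => X ^ m * rescale (P N) with hR
  have hRe : ∀ N ε σ τ, ((R N).map (MvPolynomial.eval ![σ, τ])).eval ε
      = ε ^ m * MvPolynomial.eval ![ε * σ, ε ^ 4 * τ] (P N) := fun N ε σ τ => by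
    rw [hR, Polynomial.map_mul, eval_mul, eval_map_rescale]; simp
  have hcurve : ∀ σ τ : ℝ, ContDiff ℝ ∞ fun ε : ℝ => ((ε * σ, ε ^ 4 * τ) : ℝ × ℝ) :=
    fun σ τ => by fun_prop
  have hcoef : ∀ N, ∀ k < N, ∀ σ τ, taylorCoef k (fun ε => ε ^ m * G (ε * σ, ε ^ 4 * τ))
      = MvPolynomial.eval ![σ, τ] ((R N).coeff k) := by
    intro N k hk σ τ
    rw [← coeff_map]
    refine taylorCoef_eq_of_isBigO ?_ _ N ?_ k hk
    · refine (contDiff_id.pow m).contDiffAt.mul (ContDiffAt.comp (0 : ℝ) ?_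
        (hcurve σ τ).contDiffAt)
      simpa only [zero_mul, zero_pow (four_ne_zero), Prod.mk_zero_zero] using hG.1
    · have ht : Tendsto (fun ε : ℝ => ((ε * σ, ε ^ 4 * τ) : ℝ × ℝ)) (𝓝[>] 0) (𝓝 0) := by
        have := ((hcurve σ τ).continuous.tendsto 0).mono_left
          (nhdsWithin_le_nhds (s := Ioi (0 : ℝ)))
        simpa only [zero_mul, zero_pow (four_ne_zero), Prod.mk_zero_zero] using this
      have h1 := (hP N).comp_tendsto ht
      have h2 : (fun ε : ℝ => ε ^ m) =O[𝓝[>] 0] fun _ => (1 : ℝ) :=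
        ((continuous_pow m).continuousAt (x := (0 : ℝ))).isBigO_one ℝ |>.mono nhdsWithin_le_nhds
      have h3 : (fun ε : ℝ => (‖((ε * σ, ε ^ 4 * τ) : ℝ × ℝ)‖) ^ N) =O[𝓝[>] 0]
          fun ε : ℝ => ε ^ N := by
        refine IsBigO.of_bound ((1 + |σ| + |τ|) ^ N) ?_
        filter_upwards [Ioo_mem_nhdsGT (one_pos (α := ℝ))] with ε hε
        rw [norm_pow, norm_norm, norm_pow, Real.norm_of_nonneg hε.1.le, ← mul_pow, mul_comm _ ε]
        exact pow_le_pow_left₀ (norm_nonneg _) (norm_rescale_le hε.1.le hε.2.le σ τ) N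
      refine (h2.mul (h1.trans h3)).congr (fun ε => ?_) fun ε => by rw [one_mul]
      rw [hRe]
      simp only [Function.comp]
      ring
  refine ⟨fun k => (R (k + 1)).coeff k, fun k σ τ => hcoef _ _ (by omega) σ τ, fun N => ?_⟩
  -- The coefficient of `ε^k` does not depend on the order `N > k`, being a Taylor coefficient at
  -- every point.
  have hc : ∀ k < N, (R (k + 1)).coeff k = (R N).coeff k := fun k hk => by
    refine MvPolynomial.funext fun x => ?_
    have hx : x = ![x 0, x 1] := by ext i; fin_cases i <;> rfl
    rw [hx, ← hcoef _ _ (by omega), ← hcoef _ _ hk]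
  obtain ⟨C, hC⟩ := (hP N).bound
  obtain ⟨δ, hδ, hball⟩ := Metric.eventually_nhds_iff.1 hC
  -- the terms of order at least `N` in the rescaled Taylor polynomial
  choose B D hB hBD using fun k => exists_abs_eval_le ((R N).coeff k)
  set L := (R N).natDegree + 1 with hL
  refine ⟨δ, hδ, |C| + ∑ k ∈ Finset.range L, B k, N + ∑ k ∈ Finset.range L, D k,
    by positivity [Finset.sum_nonneg fun k (_ : k ∈ Finset.range L) => hB k], ?_⟩
  intro ε σ τ hε hε1 hσ hτ
  set y := 1 + |σ| + |τ| with hy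
  have hy1 : 1 ≤ y := by have := abs_nonneg σ; have := abs_nonneg τ; linarith
  have hdist : dist ((ε * σ, ε ^ 4 * τ) : ℝ × ℝ) 0 < δ := by
    rw [dist_zero_right, Prod.norm_def, sup_lt_iff]; exact ⟨hσ, hτ⟩
  have h1 := hball hdist
  rw [norm_pow, norm_norm, Real.norm_eq_abs] at h1
  have h2 : ε ^ m * MvPolynomial.eval ![ε * σ, ε ^ 4 * τ] (P N)
      = ∑ k ∈ Finset.range L, ε ^ k * MvPolynomial.eval ![σ, τ] ((R N).coeff k) := by
    rw [← hRe, eval_eq_sum_range' (n := L)]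
    · refine Finset.sum_congr rfl fun k _ => ?_
      rw [coeff_map]; ring
    · exact (Nat.lt_succ_of_le natDegree_map_le)
  -- the remainder of the Taylor polynomial
  have h3 : |ε ^ m * G (ε * σ, ε ^ 4 * τ)
      - ε ^ m * MvPolynomial.eval ![ε * σ, ε ^ 4 * τ] (P N)| ≤ |C| * ε ^ N * y ^ N := by
    rw [← mul_sub, abs_mul, abs_of_nonneg (pow_nonneg hε.le m)]
    calc _ ≤ 1 * (C * ‖((ε * σ, ε ^ 4 * τ) : ℝ × ℝ)‖ ^ N) := by
          gcongr
          exact pow_le_one₀ hε.le hε1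
      _ ≤ |C| * (ε * y) ^ N := by
          rw [one_mul]
          gcongr
          · exact le_abs_self C
          · exact norm_rescale_le hε.le hε1 σ τ
      _ = _ := by rw [mul_pow]; ring
  have h4 : |∑ k ∈ Finset.range L, ε ^ k * MvPolynomial.eval ![σ, τ] ((R N).coeff k)
      - ∑ k ∈ Finset.range N, ε ^ k * MvPolynomial.eval ![σ, τ] ((R (k + 1)).coeff k)|
      ≤ ∑ k ∈ Finset.range L, B k * ε ^ N * y ^ (N + ∑ k ∈ Finset.range L, D k) := by
    have h5 : ∑ k ∈ Finset.range N, ε ^ k * MvPolynomial.eval ![σ, τ] ((R (k + 1)).coeff k)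
        = ∑ k ∈ Finset.range L,
          if k < N then ε ^ k * MvPolynomial.eval ![σ, τ] ((R N).coeff k) else 0 := by
      rw [← Finset.sum_filter]
      have h6 : ∑ k ∈ Finset.range N, ε ^ k * MvPolynomial.eval ![σ, τ] ((R (k + 1)).coeff k)
          = ∑ k ∈ Finset.range N, ε ^ k * MvPolynomial.eval ![σ, τ] ((R N).coeff k) :=
        Finset.sum_congr rfl fun k hk => by rw [hc k (Finset.mem_range.1 hk)]
      rw [h6]
      refine (Finset.sum_subset (fun k hk => ?_) fun k hk hk' => ?_).symm
      · exact Finset.mem_range.2 (Finset.mem_filter.1 hk).2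
      · rw [coeff_eq_zero_of_natDegree_lt, map_zero, mul_zero]
        by_contra hlt
        exact hk' (Finset.mem_filter.2 ⟨Finset.mem_range.2 (by omega), Finset.mem_range.1 hk⟩)
    rw [h5, ← Finset.sum_sub_distrib]
    refine (Finset.abs_sum_le_sum_abs _ _).trans (Finset.sum_le_sum fun k hk => ?_)
    split_ifs with hkN
    · rw [sub_self, abs_zero]
      have := hB k
      positivity
    · rw [sub_zero, abs_mul, abs_of_nonneg (pow_nonneg hε.le k)]
      have hD : D k ≤ N + ∑ k ∈ Finset.range L, D k :=
        (Finset.single_le_sum (fun i _ => Nat.zero_le (D i)) hk).trans (Nat.le_add_left _ _)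
      calc _ ≤ ε ^ N * (B k * y ^ D k) := by
            exact mul_le_mul (pow_le_pow_of_le_one hε.le hε1 (by omega)) (hBD k σ τ)
              (abs_nonneg _) (by positivity)
        _ ≤ ε ^ N * (B k * y ^ (N + ∑ k ∈ Finset.range L, D k)) := by
            have := hB k
            gcongr
        _ = _ := by ring
  calc _ ≤ _ := abs_sub_le _ (ε ^ m * MvPolynomial.eval ![ε * σ, ε ^ 4 * τ] (P N)) _
    _ ≤ |C| * ε ^ N * y ^ (N + ∑ k ∈ Finset.range L, D k)
        + ∑ k ∈ Finset.range L, B k * ε ^ N * y ^ (N + ∑ k ∈ Finset.range L, D k) := by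
        refine add_le_add (h3.trans ?_) (by rw [h2]; exact h4)
        gcongr
        omega
    _ = _ := by rw [← Finset.sum_mul, ← Finset.sum_mul]; ring

end Expansion

/-! ### The coefficients of the rescaled operator -/

section Coefficients

theorem tendsto_rescale (σ τ : ℝ) :
    Tendsto (fun ε : ℝ => ((ε * σ, ε ^ 4 * τ) : ℝ × ℝ)) (𝓝 0) (𝓝 0) := by
  have h : Continuous fun ε : ℝ => ((ε * σ, ε ^ 4 * τ) : ℝ × ℝ) := by fun_prop
  simpa only [zero_mul, zero_pow (four_ne_zero), Prod.mk_zero_zero] using h.tendsto 0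

theorem contDiffAt_rescale {G : ℝ × ℝ → ℝ} (hG : ContDiffAt ℝ ∞ G 0) (m : ℕ) (σ τ : ℝ) :
    ContDiffAt ℝ ∞ (fun ε : ℝ => ε ^ m * G (ε * σ, ε ^ 4 * τ)) 0 := by
  have h : ContDiff ℝ ∞ fun ε : ℝ => ((ε * σ, ε ^ 4 * τ) : ℝ × ℝ) := by fun_prop
  refine (contDiff_id.pow m).contDiffAt.mul (ContDiffAt.comp (0 : ℝ) ?_ h.contDiffAt)
  simpa only [zero_mul, zero_pow (four_ne_zero), Prod.mk_zero_zero] using hG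

/-- The leading coefficient of `ε^m G(εσ, ε⁴τ)` is `G(0)`, at the order `m`. -/
theorem taylorCoef_rescale_of_le {G : ℝ × ℝ → ℝ} (hG : ContDiffAt ℝ ∞ G 0) (m : ℕ) (σ τ : ℝ)
    {k : ℕ} (hk : k ≤ m) :
    taylorCoef k (fun ε : ℝ => ε ^ m * G (ε * σ, ε ^ 4 * τ)) = if k = m then G 0 else 0 := by
  have h : (fun ε : ℝ => ε ^ m * G (ε * σ, ε ^ 4 * τ)
      - (Polynomial.C (G 0) * Polynomial.X ^ m : Polynomial ℝ).eval ε) =O[𝓝[>] 0]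
      fun ε : ℝ => ε ^ (m + 1) := by
    have h1 : ContDiffAt ℝ ∞ (fun ε : ℝ => ε ^ 0 * G (ε * σ, ε ^ 4 * τ)) 0 :=
      contDiffAt_rescale hG 0 σ τ
    have h2 := (h1.differentiableAt (by simp)).isBigO_sub
    simp only [pow_zero, one_mul, zero_mul, zero_pow (four_ne_zero), Prod.mk_zero_zero,
      sub_zero] at h2
    refine (((isBigO_refl (fun ε : ℝ => ε ^ m) _).mul h2).mono nhdsWithin_le_nhds).congr
      (fun ε => ?_) fun ε => ?_
    · simp; ring
    · ring
  rw [taylorCoef_eq_of_isBigO (contDiffAt_rescale hG m σ τ) _ _ h k (by omega),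
    Polynomial.coeff_C_mul_X_pow]

variable {κ : ℝ → ℝ} (s₀ : ℝ)

/-- The inverse of the Jacobian, as a function of the unscaled coordinates. -/
def invJac (κ : ℝ → ℝ) (s₀ : ℝ) (p : ℝ × ℝ) : ℝ := (1 - p.2 * κ (s₀ + p.1))⁻¹

theorem invJac_rescale (κ : ℝ → ℝ) (s₀ ε σ τ : ℝ) :
    invJac κ s₀ (ε * σ, ε ^ 4 * τ) = (jac κ s₀ ε σ τ)⁻¹ := rfl

theorem contDiff_shift (hκ : ContDiff ℝ ∞ κ) : ContDiff ℝ ∞ fun x => κ (s₀ + x) :=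
  hκ.comp (contDiff_const.add contDiff_id)

theorem polyApprox_snd : PolyApprox fun p => p.2 := by
  simpa using PolyApprox.eval (MvPolynomial.X 1)

theorem polyApprox_invJac (hκ : ContDiff ℝ ∞ κ) : PolyApprox (invJac κ s₀) :=
  (polyApprox_snd.mul (PolyApprox.comp_fst (contDiff_shift s₀ hκ))).inv_one_sub (by simp)

theorem coefT_eq (κ : ℝ → ℝ) (s₀ ε σ τ : ℝ) :
    coefT κ s₀ ε σ τ = ε ^ 4 * (κ (s₀ + ε * σ) * invJac κ s₀ (ε * σ, ε ^ 4 * τ)) := by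
  have h : HasDerivAt (fun t => jac κ s₀ ε σ t) (-(ε ^ 4 * κ (s₀ + ε * σ))) τ := by
    have := (((hasDerivAt_id' τ).const_mul (ε ^ 4)).mul_const (κ (s₀ + ε * σ))).const_sub 1
    exact this.congr_deriv (by ring)
  rw [coefT, h.deriv, invJac_rescale]; ring

theorem coefSS_eq (κ : ℝ → ℝ) (s₀ ε σ τ : ℝ) :
    coefSS κ s₀ ε σ τ = ε ^ 6 * (-1 * invJac κ s₀ (ε * σ, ε ^ 4 * τ) ^ 2) := by
  rw [coefSS, invJac_rescale]; ring

theorem coefS_eq (hκ : ContDiff ℝ ∞ κ) {ε σ τ : ℝ} (h : jac κ s₀ ε σ τ ≠ 0) :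
    coefS κ s₀ ε σ τ = ε ^ 7 * (-1 * (ε ^ 4 * τ * deriv κ (s₀ + ε * σ))
      * invJac κ s₀ (ε * σ, ε ^ 4 * τ) ^ 3) := by
  have h1 : HasDerivAt (fun s => jac κ s₀ ε s τ) (-(ε ^ 4 * τ * (deriv κ (s₀ + ε * σ) * ε))) σ := by
    have h2 : HasDerivAt (fun s : ℝ => s₀ + ε * s) ε σ := by
      simpa using ((hasDerivAt_id' σ).const_mul ε).const_add s₀
    have h3 := ((hκ.differentiable (by simp)) (s₀ + ε * σ)).hasDerivAt.comp σ h2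
    exact (h3.const_mul (ε ^ 4 * τ)).const_sub 1
  have h2 := h1.fun_inv h
  rw [coefS, h2.deriv, invJac_rescale]
  field_simp

theorem eventually_jac_ne_zero (hκ : ContDiff ℝ ∞ κ) :
    ∀ᶠ p in 𝓝 (0 : ℝ × ℝ), 1 - p.2 * κ (s₀ + p.1) ≠ 0 := by
  have hc : Continuous fun p : ℝ × ℝ => 1 - p.2 * κ (s₀ + p.1) := by
    have := hκ.continuous
    fun_prop
  exact hc.continuousAt.eventually_ne (by simp)

/-- The coefficient of `∂_τ` is `ε⁴ κ(s₀ + εσ) a⁻¹`. Here `a⁻¹ = 1 + O(ε⁴)` and `κ'(s₀) = 0`, so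
that only `κ(s₀)` and `κ''(s₀) σ² / 2` contribute below the order seven. -/
theorem taylorCoef_coefT (hκ : ContDiff ℝ ∞ κ) (hκ1 : deriv κ s₀ = 0) (σ τ : ℝ) {k : ℕ}
    (hk : k < 7) :
    taylorCoef k (fun ε => coefT κ s₀ ε σ τ)
      = if k = 4 then κ s₀ else if k = 6 then iteratedDeriv 2 κ s₀ / 2 * σ ^ 2 else 0 := by
  set K : ℝ → ℝ := fun x => κ (s₀ + x) with hK
  have hKs : ContDiff ℝ ∞ K := contDiff_shift s₀ hκ
  have hG := (PolyApprox.comp_fst hKs).mul (polyApprox_invJac s₀ hκ)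
  have hF : ContDiffAt ℝ ∞ (fun ε => coefT κ s₀ ε σ τ) 0 := by
    simp only [coefT_eq]
    exact contDiffAt_rescale hG.1 4 σ τ
  have hKO : (fun x => K x - (κ s₀ + iteratedDeriv 2 κ s₀ / 2 * x ^ 2)) =O[𝓝 0]
      fun x : ℝ => x ^ 3 := by
    have h1 := (taylor_isLittleO_univ (x₀ := (0 : ℝ)) (n := 3)
      (by exact_mod_cast contDiff_infty.1 hKs 3 : ContDiff ℝ ((3 : ℕ) : WithTop ℕ∞) K)).isBigO
    have h2 := h1.add ((isBigO_refl (fun x : ℝ => (x - 0) ^ 3) (𝓝 0)).const_mul_left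
      ((3 ! : ℝ)⁻¹ * iteratedDeriv 3 K 0))
    simp only [sub_zero] at h2
    refine h2.congr_left fun x => ?_
    have e : ∀ j, iteratedDeriv j K 0 = iteratedDeriv j κ s₀ := fun j => by
      rw [hK, iteratedDeriv_comp_const_add]; simp
    simp only [taylor_within_apply, Finset.sum_range_succ, Finset.sum_range_zero,
      iteratedDerivWithin_univ, e, iteratedDeriv_zero, iteratedDeriv_one, hκ1, sub_zero,
      smul_eq_mul]
    simp [Nat.factorial]
    ring
  have hcur : Tendsto (fun ε : ℝ => ε * σ) (𝓝 0) (𝓝 0) := by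
    simpa using (continuous_id.mul continuous_const).tendsto (0 : ℝ) (f := fun ε : ℝ => ε * σ)
  have hA : (fun ε => invJac κ s₀ (ε * σ, ε ^ 4 * τ)) =O[𝓝 0] fun _ => (1 : ℝ) :=
    (((polyApprox_invJac s₀ hκ).1.continuousAt).tendsto.comp (tendsto_rescale σ τ)).isBigO_one ℝ
  have hKc : (fun ε : ℝ => K (ε * σ)) =O[𝓝 0] fun _ => (1 : ℝ) :=
    ((hKs.continuous.tendsto 0).comp hcur).isBigO_one ℝ
  have h1 : (fun ε : ℝ => K (ε * σ) - (κ s₀ + iteratedDeriv 2 κ s₀ / 2 * (ε * σ) ^ 2)) =O[𝓝 0]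
      fun ε : ℝ => ε ^ 3 := by
    refine (hKO.comp_tendsto hcur).trans (IsBigO.of_bound (‖σ ^ 3‖) (Eventually.of_forall
      fun ε => ?_))
    simp only [Function.comp, mul_pow, norm_mul, mul_comm, le_refl]
  have h2 : (fun ε : ℝ => ε ^ 4 * (τ * (K (ε * σ) * K (ε * σ) *
      invJac κ s₀ (ε * σ, ε ^ 4 * τ)))) =O[𝓝 0] fun ε : ℝ => ε ^ 3 := by
    have h3 : (fun ε : ℝ => ε ^ 4) =O[𝓝 0] fun ε : ℝ => ε ^ 3 := by
      have := (isBigO_refl (fun ε : ℝ => ε ^ 3) (𝓝 0)).mul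
        ((continuous_id.tendsto (0 : ℝ)).isBigO_one ℝ)
      refine this.congr (fun ε => ?_) fun ε => ?_
      · simp only [id]; ring
      · ring
    have h4 := h3.mul (((hKc.mul hKc).mul hA).const_mul_left τ)
    simpa using h4
  -- the Taylor polynomial to be identified
  set R : Polynomial ℝ := Polynomial.C (κ s₀) * Polynomial.X ^ 4
    + Polynomial.C (iteratedDeriv 2 κ s₀ / 2 * σ ^ 2) * Polynomial.X ^ 6 with hR
  have hO : (fun ε : ℝ => coefT κ s₀ ε σ τ - R.eval ε) =O[𝓝[>] 0] fun ε : ℝ => ε ^ 7 := by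
    have h3 := ((isBigO_refl (fun ε : ℝ => ε ^ 4) (𝓝 0)).mul (h1.add h2)).mono
      (nhdsWithin_le_nhds (s := Ioi (0 : ℝ)))
    refine h3.congr' ?_ (Eventually.of_forall fun ε => by ring)
    filter_upwards [((tendsto_rescale σ τ).eventually
      (eventually_jac_ne_zero s₀ hκ)).filter_mono nhdsWithin_le_nhds] with ε hε
    have e : invJac κ s₀ (ε * σ, ε ^ 4 * τ) * (1 - ε ^ 4 * τ * K (ε * σ)) = 1 :=
      inv_mul_cancel₀ hε
    rw [coefT_eq]
    change _ = ε ^ 4 * (K (ε * σ) * _) - _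
    simp only [hR, Polynomial.eval_add, Polynomial.eval_mul, Polynomial.eval_C,
      Polynomial.eval_pow, Polynomial.eval_X]
    linear_combination -ε ^ 4 * K (ε * σ) * e
  rw [taylorCoef_eq_of_isBigO hF R 7 hO k hk, hR, Polynomial.coeff_add,
    Polynomial.coeff_C_mul_X_pow, Polynomial.coeff_C_mul_X_pow]
  interval_cases k <;> simp

theorem taylorCoef_congr {F G : ℝ → ℝ} (h : F =ᶠ[𝓝 0] G) (k : ℕ) :
    taylorCoef k F = taylorCoef k G := by
  rw [taylorCoef, taylorCoef, h.iteratedDeriv_eq]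

theorem poly2_ext {p q : Poly2}
    (h : ∀ σ τ, MvPolynomial.eval ![σ, τ] p = MvPolynomial.eval ![σ, τ] q) : p = q := by
  refine MvPolynomial.funext fun x => ?_
  have hx : x = ![x 0, x 1] := by ext i; fin_cases i <;> rfl
  rw [hx]; exact h _ _

/-- The expansion of the coefficients of the rescaled operator in powers of `ε`, when the
curvature is critical at `s₀`. -/
theorem exists_coef_expansion (hκ : ContDiff ℝ ∞ κ) (hκ1 : deriv κ s₀ = 0) :
    ∃ cT cSS cS : ℕ → Poly2,
      (∀ k σ τ, taylorCoef k (fun ε => coefT κ s₀ ε σ τ) = MvPolynomial.eval ![σ, τ] (cT k)) ∧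
      (∀ k σ τ, taylorCoef k (fun ε => coefSS κ s₀ ε σ τ) = MvPolynomial.eval ![σ, τ] (cSS k)) ∧
      (∀ k σ τ, taylorCoef k (fun ε => coefS κ s₀ ε σ τ) = MvPolynomial.eval ![σ, τ] (cS k)) ∧
      (∀ k < 7, cT k = if k = 4 then MvPolynomial.C (κ s₀) else if k = 6 then
        MvPolynomial.C (iteratedDeriv 2 κ s₀ / 2) * MvPolynomial.X 0 ^ 2 else 0) ∧
      (∀ k < 7, cSS k = if k = 6 then -1 else 0) ∧
      (∀ k < 7, cS k = 0) ∧
      ∀ N : ℕ, ∃ δ > 0, ∃ (C : ℝ) (d : ℕ), 0 ≤ C ∧ ∀ ε σ τ : ℝ, 0 < ε → ε ≤ 1 →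
        |ε * σ| < δ → |ε ^ 4 * τ| < δ →
        |coefT κ s₀ ε σ τ - ∑ k ∈ Finset.range N, ε ^ k * MvPolynomial.eval ![σ, τ] (cT k)|
          ≤ C * ε ^ N * (1 + |σ| + |τ|) ^ d ∧
        |coefSS κ s₀ ε σ τ - ∑ k ∈ Finset.range N, ε ^ k * MvPolynomial.eval ![σ, τ] (cSS k)|
          ≤ C * ε ^ N * (1 + |σ| + |τ|) ^ d ∧
        |coefS κ s₀ ε σ τ - ∑ k ∈ Finset.range N, ε ^ k * MvPolynomial.eval ![σ, τ] (cS k)|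
          ≤ C * ε ^ N * (1 + |σ| + |τ|) ^ d := by
  have hA := polyApprox_invJac s₀ hκ
  have hm : PolyApprox fun _ => (-1 : ℝ) := by simpa using PolyApprox.eval (-1)
  have hGT := (PolyApprox.comp_fst (contDiff_shift s₀ hκ)).mul hA
  have hGSS := hm.mul (hA.pow 2)
  have hκ' : ContDiff ℝ ∞ (deriv κ) := ((contDiff_infty_iff_deriv (𝕜 := ℝ)).1 hκ).2
  have hGS := (hm.mul (polyApprox_snd.mul (PolyApprox.comp_fst (contDiff_shift s₀ hκ')))).mul
    (hA.pow 3)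
  obtain ⟨cT, hT1, hT2⟩ := hGT.exists_expansion 4
  obtain ⟨cSS, hSS1, hSS2⟩ := hGSS.exists_expansion 6
  obtain ⟨cS, hS1, hS2⟩ := hGS.exists_expansion 7
  have eT : ∀ k σ τ, taylorCoef k (fun ε => coefT κ s₀ ε σ τ)
      = MvPolynomial.eval ![σ, τ] (cT k) := fun k σ τ => by
    rw [← hT1]; congr 1; funext ε; exact coefT_eq κ s₀ ε σ τ
  have eSS : ∀ k σ τ, taylorCoef k (fun ε => coefSS κ s₀ ε σ τ)
      = MvPolynomial.eval ![σ, τ] (cSS k) := fun k σ τ => by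
    rw [← hSS1]; congr 1; funext ε; exact coefSS_eq κ s₀ ε σ τ
  have eS : ∀ k σ τ, taylorCoef k (fun ε => coefS κ s₀ ε σ τ)
      = MvPolynomial.eval ![σ, τ] (cS k) := fun k σ τ => by
    rw [← hS1]
    refine taylorCoef_congr ?_ k
    filter_upwards [(tendsto_rescale σ τ).eventually (eventually_jac_ne_zero s₀ hκ)] with ε hε
    exact coefS_eq s₀ hκ hε
  refine ⟨cT, cSS, cS, eT, eSS, eS, fun k hk => ?_, fun k hk => ?_, fun k hk => ?_, fun N => ?_⟩
  · refine poly2_ext fun σ τ => ?_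
    rw [← eT, taylorCoef_coefT s₀ hκ hκ1 σ τ hk]
    split_ifs <;> simp
  · refine poly2_ext fun σ τ => ?_
    rw [← hSS1, taylorCoef_rescale_of_le hGSS.1 6 σ τ (by omega)]
    split_ifs <;> simp [invJac]
  · refine poly2_ext fun σ τ => ?_
    rw [← hS1, taylorCoef_rescale_of_le hGS.1 7 σ τ (by omega), if_neg (by omega), map_zero]
  · obtain ⟨δ1, h1, C1, d1, hC1, hb1⟩ := hT2 N
    obtain ⟨δ2, h2, C2, d2, hC2, hb2⟩ := hSS2 N
    obtain ⟨δ3, h3, C3, d3, hC3, hb3⟩ := hS2 N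
    obtain ⟨δ4, h4, hb4⟩ := Metric.eventually_nhds_iff.1 (eventually_jac_ne_zero s₀ hκ)
    refine ⟨min (min δ1 δ2) (min δ3 δ4), by positivity, C1 + C2 + C3, d1 + d2 + d3,
      by positivity, fun ε σ τ hε hε1 hσ hτ => ?_⟩
    simp only [lt_min_iff] at hσ hτ
    have hy1 : 1 ≤ 1 + |σ| + |τ| := by have := abs_nonneg σ; have := abs_nonneg τ; linarith
    have hj : jac κ s₀ ε σ τ ≠ 0 := by
      refine hb4 (y := (ε * σ, ε ^ 4 * τ)) ?_
      rw [dist_zero_right, Prod.norm_def, sup_lt_iff]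
      exact ⟨hσ.2.2, hτ.2.2⟩
    rw [coefT_eq, coefSS_eq, coefS_eq s₀ hκ hj]
    refine ⟨(hb1 ε σ τ hε hε1 hσ.1.1 hτ.1.1).trans ?_,
      (hb2 ε σ τ hε hε1 hσ.1.2 hτ.1.2).trans ?_, (hb3 ε σ τ hε hε1 hσ.2.1 hτ.2.1).trans ?_⟩
    · gcongr
      · linarith
      · omega
    · gcongr
      · linarith
      · omega
    · gcongr
      · linarith
      · omega

end Coefficients

/-! ### The residual of the ansatz in rescaled coordinates -/

section Residual

/-- The terms of total order below `n` in a double expansion cancel; what is left is `O(ε^n)`. -/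
theorem exists_ev_double_sum_le {α : ℝ} (hα : 0 < α) (n : ℕ) (x : ℕ → ℕ → Poly2)
    (hx : ∀ k < n, ∑ a ∈ Finset.range (k + 1), x a (k - a) = 0) :
    ∃ C, 0 < C ∧ ∀ ε σ τ : ℝ, 0 < ε → ε ≤ 1 → 0 ≤ τ →
      |ev α (∑ a ∈ Finset.range n, ∑ b ∈ Finset.range n, ε ^ (a + b) • x a b) σ τ|
        ≤ C * ε ^ n * Real.exp (-τ / 2 - α / 4 * σ ^ 2) := by
  choose K hK0 hK using fun a b => exists_pow_mul_ev_le hα (x a b) 0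
  simp only [pow_zero, one_mul] at hK
  set S := Finset.range n ×ˢ Finset.range n with hS
  refine ⟨∑ p ∈ S, K p.1 p.2 + 1, by
    have := Finset.sum_nonneg fun p (_ : p ∈ S) => (hK0 p.1 p.2).le
    positivity, fun ε σ τ hε hε1 hτ => ?_⟩
  set w := Real.exp (-τ / 2 - α / 4 * σ ^ 2) with hw
  have hw0 : 0 < w := Real.exp_pos _
  have h1 : ∑ p ∈ S with p.1 + p.2 < n, ε ^ (p.1 + p.2) • x p.1 p.2 = 0 := by
    rw [← Finset.sum_fiberwise_of_maps_to (t := Finset.range n) (g := fun p : ℕ × ℕ => p.1 + p.2)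
      (fun p hp => Finset.mem_range.2 (Finset.mem_filter.1 hp).2)]
    refine Finset.sum_eq_zero fun k hk => ?_
    have hk := Finset.mem_range.1 hk
    have e : ((S.filter fun p => p.1 + p.2 < n).filter fun p => p.1 + p.2 = k)
        = Finset.HasAntidiagonal.antidiagonal k := by
      ext p
      simp only [hS, Finset.mem_filter, Finset.mem_product, Finset.mem_range,
        Finset.HasAntidiagonal.mem_antidiagonal]
      omega
    rw [e, Finset.Nat.sum_antidiagonal_eq_sum_range_succ (fun a b => ε ^ (a + b) • x a b)]
    calc _ = ∑ a ∈ Finset.range (k + 1), ε ^ k • x a (k - a) :=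
          Finset.sum_congr rfl fun a ha => by
            rw [Nat.add_sub_cancel' (Nat.lt_succ_iff.1 (Finset.mem_range.1 ha))]
      _ = 0 := by rw [← Finset.smul_sum, hx k hk, smul_zero]
  rw [← Finset.sum_product', ← hS,
    ← Finset.sum_filter_add_sum_filter_not S (fun p => p.1 + p.2 < n), h1, zero_add, ev_sum]
  calc _ ≤ ∑ p ∈ S with ¬ p.1 + p.2 < n, |ev α (ε ^ (p.1 + p.2) • x p.1 p.2) σ τ| :=
        Finset.abs_sum_le_sum_abs _ _
    _ ≤ ∑ p ∈ S with ¬ p.1 + p.2 < n, K p.1 p.2 * (ε ^ n * w) := by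
        refine Finset.sum_le_sum fun p hp => ?_
        have hp := (Finset.mem_filter.1 hp).2
        rw [ev_smul, abs_mul, abs_of_pos (pow_pos hε _)]
        calc ε ^ (p.1 + p.2) * |ev α (x p.1 p.2) σ τ| ≤ ε ^ n * (K p.1 p.2 * w) :=
              mul_le_mul (pow_le_pow_of_le_one hε.le hε1 (by omega)) (hK p.1 p.2 σ τ hτ)
                (abs_nonneg _) (by positivity)
          _ = _ := by ring
    _ ≤ ∑ p ∈ S, K p.1 p.2 * (ε ^ n * w) :=
        Finset.sum_le_sum_of_subset_of_nonneg (Finset.filter_subset _ _) fun p _ _ => by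
          have := (hK0 p.1 p.2).le
          positivity
    _ = (∑ p ∈ S, K p.1 p.2) * (ε ^ n * w) := by rw [Finset.sum_mul]
    _ ≤ _ := by
        have : 0 < ε ^ n * w := by positivity
        nlinarith

variable {κ : ℝ → ℝ} {s₀ : ℝ} {N : ℕ}

/-- The `k`-th coefficient of the first-order part and the tangential part of the conjugated
operator. -/
def opCoef (α : ℝ) (cT cSS cS : ℕ → Poly2) (k : ℕ) : Poly2 →ₗ[ℝ] Poly2 :=
  LinearMap.mulLeft ℝ (cT k) ∘ₗ polyT + LinearMap.mulLeft ℝ (cSS k) ∘ₗ polyS α ∘ₗ polyS α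
    + LinearMap.mulLeft ℝ (cS k) ∘ₗ polyS α

theorem opCoef_apply (α : ℝ) (cT cSS cS : ℕ → Poly2) (k : ℕ) (p : Poly2) :
    opCoef α cT cSS cS k p
      = cT k * polyT p + cSS k * polyS α (polyS α p) + cS k * polyS α p := rfl

/-- The coefficients, by powers of `ε = h^{1/8}`, of the quasi-eigenvalue. -/
def quasiCoef (α : ℝ) (N : ℕ) (κ₀ : ℝ) (ζ : ℕ → ℝ) : ℕ → ℝ
  | 0 => -1
  | 4 => -κ₀
  | 6 => (2 * N + 1) * α
  | (j + 7) => ζ j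
  | _ => 0

variable (κ s₀ N) in
/-- All coefficients of the quasimode expansion at a critical point `s₀` of `κ`: `cT`, `cSS`, `cS`
are those of the rescaled operator, `V` and `q` those of the ansatz (see `coefPsi`), and `ζ` those
of the quasi-eigenvalue. The Gaussian weight is `e^{-ασ²/2}`. -/
structure QuasimodeData where
  α : ℝ
  α_pos : 0 < α
  α_sq : α ^ 2 = -iteratedDeriv 2 κ s₀ / 2
  cT : ℕ → Poly2
  cSS : ℕ → Poly2
  cS : ℕ → Poly2
  taylor_T : ∀ k σ τ, taylorCoef k (fun ε => coefT κ s₀ ε σ τ) = MvPolynomial.eval ![σ, τ] (cT k)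
  taylor_SS : ∀ k σ τ,
    taylorCoef k (fun ε => coefSS κ s₀ ε σ τ) = MvPolynomial.eval ![σ, τ] (cSS k)
  taylor_S : ∀ k σ τ, taylorCoef k (fun ε => coefS κ s₀ ε σ τ) = MvPolynomial.eval ![σ, τ] (cS k)
  low_T : ∀ k < 7, cT k = if k = 4 then MvPolynomial.C (κ s₀) else if k = 6 then
    MvPolynomial.C (iteratedDeriv 2 κ s₀ / 2) * MvPolynomial.X 0 ^ 2 else 0
  low_SS : ∀ k < 7, cSS k = if k = 6 then -1 else 0
  low_S : ∀ k < 7, cS k = 0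
  remainder : ∀ n : ℕ, ∃ δ > 0, ∃ (C : ℝ) (d : ℕ), 0 ≤ C ∧ ∀ ε σ τ : ℝ, 0 < ε → ε ≤ 1 →
    |ε * σ| < δ → |ε ^ 4 * τ| < δ →
    |coefT κ s₀ ε σ τ - ∑ k ∈ Finset.range n, ε ^ k * MvPolynomial.eval ![σ, τ] (cT k)|
      ≤ C * ε ^ n * (1 + |σ| + |τ|) ^ d ∧
    |coefSS κ s₀ ε σ τ - ∑ k ∈ Finset.range n, ε ^ k * MvPolynomial.eval ![σ, τ] (cSS k)|
      ≤ C * ε ^ n * (1 + |σ| + |τ|) ^ d ∧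
    |coefS κ s₀ ε σ τ - ∑ k ∈ Finset.range n, ε ^ k * MvPolynomial.eval ![σ, τ] (cS k)|
      ≤ C * ε ^ n * (1 + |σ| + |τ|) ^ d
  V : ℕ → Polynomial ℝ
  q : ℕ → Poly2
  ζ : ℕ → ℝ
  oscillator_V : oscillator α N (V 0) = 0
  normalized : ∫ σ, ((V 0).eval σ / √2 * Real.exp (-(α / 2 * σ ^ 2))) ^ 2 = 1
  robin : ∀ j σ, MvPolynomial.eval ![σ, 0] (MvPolynomial.pderiv 1 (q j)) = 0
  formal : ∀ k, ∑ a ∈ Finset.range (k + 1),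
    coefOp α N (κ s₀) (fun j => opCoef α cT cSS cS (7 + j)) ζ a (coefPsi V q (k - a)) = 0

namespace QuasimodeData

variable (D : QuasimodeData κ s₀ N)

/-- The `k`-th coefficient of the conjugated operator minus the quasi-eigenvalue. -/
def opMinus (k : ℕ) : Poly2 →ₗ[ℝ] Poly2 :=
  coefOp D.α N (κ s₀) (fun j => opCoef D.α D.cT D.cSS D.cS (7 + j)) D.ζ k

/-- The coefficients used for the formal solution are those of the rescaled operator; here `α² =
k₂/2` enters, at the order six. -/
theorem opMinus_apply (k : ℕ) (p : Poly2) :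
    D.opMinus k p = (if k = 0 then -polyT (polyT p) else 0) + opCoef D.α D.cT D.cSS D.cS k p
      - quasiCoef D.α N (κ s₀) D.ζ k • p := by
  rcases lt_or_ge k 7 with hk | hk
  · rw [opCoef_apply, D.low_T k hk, D.low_SS k hk, D.low_S k hk]
    interval_cases k
    · change -polyT (polyT p) + p = _
      simp [quasiCoef]
    · change 0 = _; simp [quasiCoef]
    · change 0 = _; simp [quasiCoef]
    · change 0 = _; simp [quasiCoef]
    · change κ s₀ • (polyT p + p) = _
      simp [quasiCoef, MvPolynomial.smul_eq_C_mul]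
    · change 0 = _; simp [quasiCoef]
    · change -polyS D.α (polyS D.α p)
        - (MvPolynomial.C (D.α ^ 2) * MvPolynomial.X 0 ^ 2) * polyT p - ((2 * N + 1) * D.α) • p = _
      rw [D.α_sq]
      simp only [quasiCoef, neg_div, map_neg]
      norm_num
      ring
  · obtain ⟨j, rfl⟩ := Nat.exists_eq_add_of_le' hk
    change opCoef D.α D.cT D.cSS D.cS (7 + j) p - D.ζ j • p = _
    rw [if_neg (by omega), zero_add, add_comm 7 j]
    rfl

/-- The `b`-th coefficient of the ansatz with `M + 1` correctors. -/
def ansatzCoef (M b : ℕ) : Poly2 :=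
  embS (if b ≤ M + 1 then D.V b else 0) + if 7 ≤ b then D.q (b - 7) else 0

/-- The ansatz with `M + 1` correctors, without its weight. -/
def ansatzPoly (M : ℕ) (ε : ℝ) : Poly2 :=
  ∑ b ∈ Finset.range (8 + M), ε ^ b • D.ansatzCoef M b

/-- The multiples of the transversal ground state are in the kernel of the coefficients below the
order six. -/
theorem opMinus_embS (p : Polynomial ℝ) {k : ℕ} (hk : k < 6) : D.opMinus k (embS p) = 0 := by
  interval_cases k
  · change -polyT (polyT (embS p)) + embS p = 0
    rw [polyT_embS, map_neg, polyT_embS]; ring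
  · rfl
  · rfl
  · rfl
  · change κ s₀ • (polyT (embS p) + embS p) = 0
    rw [polyT_embS]; simp
  · rfl

/-- Truncating the sequence `V` after the term `M + 1` does no harm below the order `8 + M`, since
`V b` contributes first at the order `b + 6`. -/
theorem sum_opMinus_ansatzCoef (M : ℕ) {k : ℕ} (hk : k < 8 + M) :
    ∑ a ∈ Finset.range (k + 1), D.opMinus a (D.ansatzCoef M (k - a)) = 0 := by
  rw [← D.formal k]
  refine Finset.sum_congr rfl fun a ha => ?_
  have ha := Finset.mem_range.1 ha
  by_cases h : k - a ≤ M + 1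
  · rw [ansatzCoef, if_pos h]; rfl
  · change _ = D.opMinus a (coefPsi D.V D.q (k - a))
    rw [ansatzCoef, coefPsi, if_neg h, map_add, map_add, D.opMinus_embS _ (by omega),
      D.opMinus_embS _ (by omega)]

/-- The ansatz solves the eigenvalue equation of the truncated operator up to `O(ε^{8+M})`,
uniformly with respect to a Gaussian weight. -/
theorem exists_ev_sum_opMinus_le (M : ℕ) :
    ∃ C, 0 < C ∧ ∀ ε σ τ : ℝ, 0 < ε → ε ≤ 1 → 0 ≤ τ →
      |ev D.α (∑ a ∈ Finset.range (8 + M), ε ^ a • D.opMinus a (D.ansatzPoly M ε)) σ τ|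
        ≤ C * ε ^ (8 + M) * Real.exp (-τ / 2 - D.α / 4 * σ ^ 2) := by
  obtain ⟨C, hC, h⟩ := exists_ev_double_sum_le D.α_pos (8 + M)
    (fun a b => D.opMinus a (D.ansatzCoef M b)) fun k hk => D.sum_opMinus_ansatzCoef M hk
  refine ⟨C, hC, fun ε σ τ hε hε1 hτ => ?_⟩
  suffices e : ∑ a ∈ Finset.range (8 + M), ε ^ a • D.opMinus a (D.ansatzPoly M ε)
      = ∑ a ∈ Finset.range (8 + M), ∑ b ∈ Finset.range (8 + M),
        ε ^ (a + b) • D.opMinus a (D.ansatzCoef M b) by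
    rw [e]; exact h ε σ τ hε hε1 hτ
  refine Finset.sum_congr rfl fun a _ => ?_
  rw [ansatzPoly, map_sum, Finset.smul_sum]
  refine Finset.sum_congr rfl fun b _ => ?_
  rw [map_smul, smul_smul, pow_add]

/-- The ansatz and its derivatives decay, uniformly in `ε`, faster than any power. -/
theorem exists_pow_mul_ev_ansatz_le (M m : ℕ) (L : Poly2 →ₗ[ℝ] Poly2) :
    ∃ C, 0 < C ∧ ∀ ε σ τ : ℝ, 0 < ε → ε ≤ 1 → 0 ≤ τ →
      (1 + |σ| + |τ|) ^ m * |ev D.α (L (D.ansatzPoly M ε)) σ τ|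
        ≤ C * Real.exp (-τ / 2 - D.α / 4 * σ ^ 2) := by
  choose K hK0 hK using fun b => exists_pow_mul_ev_le D.α_pos (L (D.ansatzCoef M b)) m
  refine ⟨∑ b ∈ Finset.range (8 + M), K b, Finset.sum_pos (fun b _ => hK0 b) (by simp),
    fun ε σ τ hε hε1 hτ => ?_⟩
  rw [ansatzPoly, map_sum, ev_sum, Finset.sum_mul]
  calc _ ≤ (1 + |σ| + |τ|) ^ m
        * ∑ b ∈ Finset.range (8 + M), |ev D.α (L (ε ^ b • D.ansatzCoef M b)) σ τ| := by
        gcongr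
        exact Finset.abs_sum_le_sum_abs _ _
    _ = ∑ b ∈ Finset.range (8 + M),
        ε ^ b * ((1 + |σ| + |τ|) ^ m * |ev D.α (L (D.ansatzCoef M b)) σ τ|) := by
        rw [Finset.mul_sum]
        refine Finset.sum_congr rfl fun b _ => ?_
        rw [map_smul, ev_smul, abs_mul, abs_of_pos (pow_pos hε _)]; ring
    _ ≤ _ := Finset.sum_le_sum fun b _ => (mul_le_of_le_one_left (by positivity)
        (pow_le_one₀ hε.le hε1)).trans (hK b σ τ hτ)

/-- The quasi-eigenvalue with `M + 1` corrections, as a polynomial in `ε`. -/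
def quasi (M : ℕ) (ε : ℝ) : ℝ :=
  ∑ k ∈ Finset.range (8 + M), ε ^ k * quasiCoef D.α N (κ s₀) D.ζ k

/-- The truncated operator minus the quasi-eigenvalue, in terms of the truncated coefficients. -/
theorem ev_sum_opMinus (M : ℕ) (ε σ τ : ℝ) (p : Poly2) :
    ev D.α (∑ a ∈ Finset.range (8 + M), ε ^ a • D.opMinus a p) σ τ
      = -ev D.α (polyT (polyT p)) σ τ
        + (∑ k ∈ Finset.range (8 + M), ε ^ k * MvPolynomial.eval ![σ, τ] (D.cT k))
          * ev D.α (polyT p) σ τ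
        + (∑ k ∈ Finset.range (8 + M), ε ^ k * MvPolynomial.eval ![σ, τ] (D.cSS k))
          * ev D.α (polyS D.α (polyS D.α p)) σ τ
        + (∑ k ∈ Finset.range (8 + M), ε ^ k * MvPolynomial.eval ![σ, τ] (D.cS k))
          * ev D.α (polyS D.α p) σ τ
        - D.quasi M ε * ev D.α p σ τ := by
  rw [ev_sum]
  have h0 : -ev D.α (polyT (polyT p)) σ τ = ∑ k ∈ Finset.range (8 + M),
      ε ^ k * if k = 0 then -ev D.α (polyT (polyT p)) σ τ else 0 := by
    rw [Finset.sum_eq_single 0]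
    · simp
    · intro b _ hb; simp [hb]
    · intro h; simp at h
  rw [h0, quasi]
  simp only [Finset.sum_mul]
  rw [← Finset.sum_add_distrib, ← Finset.sum_add_distrib, ← Finset.sum_add_distrib,
    ← Finset.sum_sub_distrib]
  refine Finset.sum_congr rfl fun k _ => ?_
  rw [ev_smul, opMinus_apply, ev_sub, ev_add, opCoef_apply, ev_add, ev_add, ev_mul, ev_mul, ev_mul,
    ev_smul]
  split_ifs
  · rw [ev_neg]; ring
  · rw [ev_zero]; ring

/-- The ansatz solves the eigenvalue equation of the full rescaled operator, near the boundary
point, up to `O(ε^{8+M})`. -/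
theorem exists_full_residual_le (M : ℕ) :
    ∃ δ > 0, ∃ C, 0 < C ∧ ∀ ε σ τ : ℝ, 0 < ε → ε ≤ 1 → 0 ≤ τ → |ε * σ| < δ → ε ^ 4 * τ < δ →
      |-ev D.α (polyT (polyT (D.ansatzPoly M ε))) σ τ
        + coefT κ s₀ ε σ τ * ev D.α (polyT (D.ansatzPoly M ε)) σ τ
        + coefSS κ s₀ ε σ τ * ev D.α (polyS D.α (polyS D.α (D.ansatzPoly M ε))) σ τ
        + coefS κ s₀ ε σ τ * ev D.α (polyS D.α (D.ansatzPoly M ε)) σ τ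
        - D.quasi M ε * ev D.α (D.ansatzPoly M ε) σ τ|
        ≤ C * ε ^ (8 + M) * Real.exp (-τ / 2 - D.α / 4 * σ ^ 2) := by
  obtain ⟨δ, hδ, C, d, hC, hrem⟩ := D.remainder (8 + M)
  obtain ⟨C₀, hC₀, h0⟩ := D.exists_ev_sum_opMinus_le M
  obtain ⟨C₁, hC₁, h1⟩ := D.exists_pow_mul_ev_ansatz_le M d polyT
  obtain ⟨C₂, hC₂, h2⟩ := D.exists_pow_mul_ev_ansatz_le M d (polyS D.α ∘ₗ polyS D.α)
  obtain ⟨C₃, hC₃, h3⟩ := D.exists_pow_mul_ev_ansatz_le M d (polyS D.α)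
  refine ⟨δ, hδ, C₀ + C * (C₁ + C₂ + C₃), by positivity, fun ε σ τ hε hε1 hτ hσδ hτδ => ?_⟩
  obtain ⟨r1, r2, r3⟩ := hrem ε σ τ hε hε1 hσδ (by rwa [abs_of_nonneg (by positivity)])
  have b0 := h0 ε σ τ hε hε1 hτ
  have b1 := h1 ε σ τ hε hε1 hτ
  have b2 := h2 ε σ τ hε hε1 hτ
  have b3 := h3 ε σ τ hε hε1 hτ
  rw [LinearMap.comp_apply] at b2
  rw [ev_sum_opMinus] at b0
  set w := Real.exp (-τ / 2 - D.α / 4 * σ ^ 2) with hw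
  -- The remainders of the coefficients grow polynomially, which the decay of the ansatz makes up
  -- for.
  have key : ∀ (u v e K : ℝ), |u - v| ≤ C * ε ^ (8 + M) * (1 + |σ| + |τ|) ^ d →
      (1 + |σ| + |τ|) ^ d * |e| ≤ K * w → |(u - v) * e| ≤ C * ε ^ (8 + M) * (K * w) := by
    intro u v e K h h'
    rw [abs_mul]
    calc _ ≤ C * ε ^ (8 + M) * (1 + |σ| + |τ|) ^ d * |e| := by gcongr
      _ = C * ε ^ (8 + M) * ((1 + |σ| + |τ|) ^ d * |e|) := by ring
      _ ≤ _ := by gcongr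
  have k1 := key _ _ _ _ r1 b1
  have k2 := key _ _ _ _ r2 b2
  have k3 := key _ _ _ _ r3 b3
  rw [abs_le] at *
  constructor <;> nlinarith [b0.1, b0.2, k1.1, k1.2, k2.1, k2.2, k3.1, k3.2]

end QuasimodeData

end Residual

/-! ### Schwartz functions and the quasimode expansion -/

section Schwartz

theorem eval_embS (p : Polynomial ℝ) (σ τ : ℝ) :
    MvPolynomial.eval ![σ, τ] (embS p) = p.eval σ := by
  induction p using Polynomial.induction_on' with
  | add p q hp hq => rw [map_add, map_add, hp, hq, Polynomial.eval_add]
  | monomial n a => simp [embS, MvPolynomial.algebraMap_eq]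

theorem fderiv_ev (α : ℝ) (p : Poly2) :
    fderiv ℝ (fun x : ℝ × ℝ => ev α p x.1 x.2) = fun x =>
      ev α (polyS α p) x.1 x.2 • ContinuousLinearMap.fst ℝ ℝ ℝ
        + ev α (polyT p) x.1 x.2 • ContinuousLinearMap.snd ℝ ℝ ℝ := by
  funext x
  have hd := ((contDiff_ev α p).differentiable (by simp) x).hasFDerivAt
  set A := fderiv ℝ (fun x : ℝ × ℝ => ev α p x.1 x.2) x with hA
  have h1 : HasDerivAt (fun s => ev α p s x.2) (A (1, 0)) x.1 := by
    have h2 : HasDerivAt (fun s : ℝ => (s, x.2)) ((1 : ℝ), (0 : ℝ)) x.1 :=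
      (hasDerivAt_id _).prodMk (hasDerivAt_const _ _)
    exact hd.comp_hasDerivAt (f := fun s : ℝ => (s, x.2)) x.1 h2
  have h1' : HasDerivAt (fun t => ev α p x.1 t) (A (0, 1)) x.2 := by
    have h2 : HasDerivAt (fun t : ℝ => (x.1, t)) ((0 : ℝ), (1 : ℝ)) x.2 :=
      (hasDerivAt_const _ _).prodMk (hasDerivAt_id _)
    exact hd.comp_hasDerivAt (f := fun t : ℝ => (x.1, t)) x.2 h2
  have e1 := h1.unique (hasDerivAt_ev_fst α p x.1 x.2)
  have e2 := h1'.unique (hasDerivAt_ev_snd α p x.1 x.2)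
  refine ContinuousLinearMap.ext fun y => ?_
  have : y = y.1 • ((1 : ℝ), (0 : ℝ)) + y.2 • ((0 : ℝ), (1 : ℝ)) := by ext <;> simp
  conv_lhs => rw [this, map_add, map_smul, map_smul, e1, e2]
  simp [mul_comm]

/-- A polynomial times `e^{-τ - ασ²/2}` is smooth on the plane, and rapidly decreasing for `τ ≥ 0`.
-/
theorem isSchwartzHalf_ev {α : ℝ} (hα : 0 < α) (p : Poly2) : IsSchwartzHalf (ev α p) := by
  refine ⟨contDiff_ev α p, fun k m => ?_⟩
  induction m generalizing p with
  | zero =>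
    obtain ⟨C, hC, h⟩ := exists_pow_mul_ev_le hα p k
    refine ⟨C, fun x hx => ?_⟩
    have h1 : ‖x‖ ≤ 1 + |x.1| + |x.2| := by
      rw [Prod.norm_def, sup_le_iff, Real.norm_eq_abs, Real.norm_eq_abs]
      constructor <;> linarith [abs_nonneg x.1, abs_nonneg x.2]
    rw [norm_iteratedFDeriv_zero, Real.norm_eq_abs]
    calc _ ≤ (1 + |x.1| + |x.2|) ^ k * |ev α p x.1 x.2| := by gcongr
      _ ≤ _ := h x.1 x.2 hx
      _ ≤ C * 1 := by
        gcongr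
        rw [Real.exp_le_one_iff]
        have : 0 ≤ α / 4 * x.1 ^ 2 := by positivity
        linarith
      _ = C := mul_one C
  | succ m ih =>
    obtain ⟨C1, h1⟩ := ih (polyS α p)
    obtain ⟨C2, h2⟩ := ih (polyT p)
    set L1 : ℝ →L[ℝ] (ℝ × ℝ →L[ℝ] ℝ) :=
      (ContinuousLinearMap.id ℝ ℝ).smulRight (ContinuousLinearMap.fst ℝ ℝ ℝ) with hL1
    set L2 : ℝ →L[ℝ] (ℝ × ℝ →L[ℝ] ℝ) :=
      (ContinuousLinearMap.id ℝ ℝ).smulRight (ContinuousLinearMap.snd ℝ ℝ ℝ) with hL2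
    have c1 := contDiff_ev α (polyS α p)
    have c2 := contDiff_ev α (polyT p)
    have hle : ((m : ℕ) : WithTop ℕ∞) ≤ ∞ := by exact_mod_cast le_top
    have e : fderiv ℝ (fun x : ℝ × ℝ => ev α p x.1 x.2)
        = (L1 ∘ fun x : ℝ × ℝ => ev α (polyS α p) x.1 x.2)
          + (L2 ∘ fun x : ℝ × ℝ => ev α (polyT p) x.1 x.2) := by
      rw [fderiv_ev]; rfl
    refine ⟨‖L1‖ * C1 + ‖L2‖ * C2, fun x hx => ?_⟩
    rw [← norm_iteratedFDeriv_fderiv, e, iteratedFDeriv_add_apply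
      ((L1.contDiff.comp c1).contDiffAt.of_le hle) ((L2.contDiff.comp c2).contDiffAt.of_le hle)]
    have b1 := L1.norm_iteratedFDeriv_comp_left (x := x) c1.contDiffAt hle
    have b2 := L2.norm_iteratedFDeriv_comp_left (x := x) c2.contDiffAt hle
    calc _ ≤ ‖x‖ ^ k * (‖L1‖ * ‖iteratedFDeriv ℝ m (fun x : ℝ × ℝ => ev α (polyS α p) x.1 x.2) x‖
          + ‖L2‖ * ‖iteratedFDeriv ℝ m (fun x : ℝ × ℝ => ev α (polyT p) x.1 x.2) x‖) := by
          gcongr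
          exact (norm_add_le _ _).trans (add_le_add b1 b2)
      _ = ‖L1‖ * (‖x‖ ^ k * ‖iteratedFDeriv ℝ m (fun x : ℝ × ℝ => ev α (polyS α p) x.1 x.2) x‖)
          + ‖L2‖ * (‖x‖ ^ k * ‖iteratedFDeriv ℝ m (fun x : ℝ × ℝ => ev α (polyT p) x.1 x.2) x‖) := by
          ring
      _ ≤ _ := by
          gcongr
          · exact h1 x hx
          · exact h2 x hx

/-- The function `2^{-1/2} p(σ) e^{-ασ²/2}`; its product with the transversal ground state is
`ev α (embS p)`. -/
def profile (α : ℝ) (p : Polynomial ℝ) (σ : ℝ) : ℝ :=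
  p.eval σ / √2 * Real.exp (-(α / 2 * σ ^ 2))

theorem profile_eq (α : ℝ) (p : Polynomial ℝ) (σ : ℝ) :
    profile α p σ = (√2)⁻¹ * ev α (embS p) σ 0 := by
  rw [profile, ev, eval_embS, neg_zero, zero_sub]; ring

theorem u0_mul_profile (α : ℝ) (p : Polynomial ℝ) (σ τ : ℝ) :
    u0 τ * profile α p σ = ev α (embS p) σ τ := by
  have h : √2 ≠ 0 := by positivity
  rw [profile, ev, eval_embS, u0, sub_eq_add_neg, Real.exp_add]
  field_simp

theorem iteratedDeriv_profile (α : ℝ) (p : Polynomial ℝ) (m : ℕ) :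
    iteratedDeriv m (profile α p) = fun σ => (√2)⁻¹ * ev α ((polyS α)^[m] (embS p)) σ 0 := by
  induction m with
  | zero => rw [iteratedDeriv_zero]; funext σ; exact profile_eq α p σ
  | succ m ih =>
    rw [iteratedDeriv_succ, ih]
    funext σ
    rw [Function.iterate_succ_apply']
    exact ((hasDerivAt_ev_fst α _ σ 0).const_mul _).deriv

/-- `profile` as a Schwartz function. -/
def profileSchwartz {α : ℝ} (hα : 0 < α) (p : Polynomial ℝ) : 𝓢(ℝ, ℝ) where
  toFun := profile α p
  smooth' := by
    have h : ContDiff ℝ ∞ fun σ : ℝ => p.eval σ := by simpa using p.contDiff_aeval (𝕜 := ℝ) (n := ∞)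
    unfold profile
    exact (h.div_const _).mul (by fun_prop)
  decay' := fun k m => by
    obtain ⟨C, hC, h⟩ := exists_pow_mul_ev_le hα ((polyS α)^[m] (embS p)) k
    refine ⟨(√2)⁻¹ * C, fun σ => ?_⟩
    rw [norm_iteratedFDeriv_eq_norm_iteratedDeriv, iteratedDeriv_profile, Real.norm_eq_abs,
      Real.norm_eq_abs, abs_mul, abs_of_pos (by positivity : 0 < (√2)⁻¹)]
    have h1 := h σ 0 le_rfl
    have h2 : Real.exp (-0 / 2 - α / 4 * σ ^ 2) ≤ 1 := by
      rw [Real.exp_le_one_iff]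
      have : 0 ≤ α / 4 * σ ^ 2 := by positivity
      linarith
    calc |σ| ^ k * ((√2)⁻¹ * |ev α ((polyS α)^[m] (embS p)) σ 0|)
        = (√2)⁻¹ * (|σ| ^ k * |ev α ((polyS α)^[m] (embS p)) σ 0|) := by ring
      _ ≤ (√2)⁻¹ * ((1 + |σ| + |0|) ^ k * |ev α ((polyS α)^[m] (embS p)) σ 0|) := by
          gcongr
          linarith [abs_nonneg (0 : ℝ)]
      _ ≤ (√2)⁻¹ * C := by
          gcongr
          exact h1.trans (by nlinarith)

theorem coe_profileSchwartz {α : ℝ} (hα : 0 < α) (p : Polynomial ℝ) :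
    ⇑(profileSchwartz hα p) = profile α p := rfl

theorem continuous_profile (α : ℝ) (p : Polynomial ℝ) : Continuous (profile α p) := by
  unfold profile; fun_prop

theorem integrable_profile_sq {α : ℝ} (hα : 0 < α) (p : Polynomial ℝ) :
    Integrable fun σ => profile α p σ ^ 2 := by
  have := (profileSchwartz hα p).memLp 2 volume
  exact (memLp_two_iff_integrable_sq this.1).1 this

theorem integral_profile_sq_pos {α : ℝ} (hα : 0 < α) {p : Polynomial ℝ} (hp : p ≠ 0) :
    0 < ∫ σ, profile α p σ ^ 2 := by
  have hc : Continuous fun σ => profile α p σ ^ 2 := (continuous_profile α p).pow 2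
  rw [integral_pos_iff_support_of_nonneg (fun σ => sq_nonneg _) (integrable_profile_sq hα p)]
  refine hc.isOpen_support.measure_pos _ ?_
  by_contra hne
  rw [Set.not_nonempty_iff_eq_empty, Function.support_eq_empty_iff] at hne
  refine hp (Polynomial.funext fun σ => ?_)
  have h := congrFun hne σ
  have h2 : √2 ≠ 0 := by positivity
  simpa [profile, Real.exp_ne_zero, h2] using h

theorem integrableOn_weight {c : ℝ} (hc : 0 < c) :
    IntegrableOn (fun p : ℝ × ℝ => Real.exp (-p.2 - c * p.1 ^ 2)) {p : ℝ × ℝ | 0 < p.2} := by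
  have h1 : Integrable (fun x : ℝ => Real.exp (-c * x ^ 2)) := integrable_exp_neg_mul_sq hc
  have h2 : IntegrableOn (fun x : ℝ => Real.exp (-x)) (Ioi 0) := integrableOn_exp_neg_Ioi 0
  have h3 := h1.mul_prod h2.integrable
  have e : (volume : Measure ℝ).prod (volume.restrict (Ioi 0))
      = (volume : Measure (ℝ × ℝ)).restrict {p : ℝ × ℝ | 0 < p.2} := by
    have : {p : ℝ × ℝ | 0 < p.2} = univ ×ˢ Ioi 0 := by ext; simp
    rw [this, Measure.volume_eq_prod, ← Measure.prod_restrict, Measure.restrict_univ]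
  rw [e] at h3
  refine h3.congr (Eventually.of_forall fun p => ?_)
  simp only [← Real.exp_add]
  congr 1; ring

theorem memLp_weight {α : ℝ} (hα : 0 < α) :
    MemLp (fun p : ℝ × ℝ => Real.exp (-p.2 / 2 - α / 4 * p.1 ^ 2)) 2
      (volume.restrict {p : ℝ × ℝ | 0 < p.2}) := by
  rw [memLp_two_iff_integrable_sq (by fun_prop)]
  refine (integrableOn_weight (c := α / 2) (by positivity)).congr (Eventually.of_forall fun p => ?_)
  simp only [sq, ← Real.exp_add]
  congr 1; ring

end Schwartz

section Existence

variable {κ : ℝ → ℝ} {s₀ : ℝ}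

/-- At a non-degenerate maximum of `κ` the quasimode exists, with the Gaussian exponent `α =
√(-κ''(s₀)/2)` and with the normalized Hermite function as leading profile. -/
theorem nonempty_quasimodeData (hκ : ContDiff ℝ ∞ κ) (h1 : deriv κ s₀ = 0)
    (h2 : iteratedDeriv 2 κ s₀ < 0) (N : ℕ) : Nonempty (QuasimodeData κ s₀ N) := by
  obtain ⟨cT, cSS, cS, hT, hSS, hS, lT, lSS, lS, hrem⟩ := exists_coef_expansion s₀ hκ h1
  set α := √(-iteratedDeriv 2 κ s₀ / 2) with hα
  have hα0 : 0 < α := Real.sqrt_pos.2 (by linarith)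
  obtain ⟨H, hH0, hHN, hHk⟩ := exists_oscillator_eigenfunction hα0.ne' N
  have hH : H ≠ 0 := fun h => by simp [h] at hHN
  have hI := integral_profile_sq_pos hα0 hH
  set c := (√(∫ σ, profile α H σ ^ 2))⁻¹ with hc
  have hc0 : 0 < c := by positivity
  obtain ⟨V, q, ζ, hV0, hq, hF⟩ := exists_formal_solution hα0.ne' N (κ s₀)
    (fun j => opCoef α cT cSS cS (7 + j)) (V₀ := Polynomial.C c * H)
    (by rw [oscillator_C_mul, hH0, mul_zero])
    (by rw [Polynomial.coeff_C_mul, hHN, mul_one]; exact hc0.ne')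
    (fun k hk => by rw [Polynomial.coeff_C_mul, hHk k hk, mul_zero])
  refine ⟨⟨α, hα0, Real.sq_sqrt (by linarith), cT, cSS, cS, hT, hSS, hS, lT, lSS, lS, hrem, V, q, ζ,
    ?_, ?_, hq, hF⟩⟩
  · rw [hV0, oscillator_C_mul, hH0, mul_zero]
  · have e : ∀ σ, ((V 0).eval σ / √2 * Real.exp (-(α / 2 * σ ^ 2))) ^ 2
        = c ^ 2 * profile α H σ ^ 2 := fun σ => by
      rw [hV0, profile, Polynomial.eval_mul, Polynomial.eval_C]; ring
    simp only [e]
    rw [integral_const_mul, hc, inv_pow, Real.sq_sqrt hI.le, inv_mul_cancel₀ hI.ne']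

namespace QuasimodeData

variable {N : ℕ} (D : QuasimodeData κ s₀ N)

theorem rpow_eighth {h : ℝ} (hh : 0 < h) (k : ℕ) : h ^ ((k : ℝ) / 8) = (h ^ (1 / 8 : ℝ)) ^ k := by
  rw [← Real.rpow_natCast, ← Real.rpow_mul hh.le]
  congr 1; ring

theorem quasiEigenvalue_eq {h : ℝ} (hh : 0 < h) (M : ℕ) :
    quasiEigenvalue κ s₀ (N + 1) D.ζ M h = D.quasi M (h ^ (1 / 8 : ℝ)) := by
  have h4 := rpow_eighth hh 4
  have h6 := rpow_eighth hh 6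
  have h7 := rpow_eighth hh 7
  norm_num at h4 h6 h7
  rw [quasiEigenvalue, quasi, show 8 + M = 7 + (M + 1) by ring, Finset.sum_range_add _ 7,
    ← D.α_sq, Real.sqrt_sq D.α_pos.le]
  have e : ∀ j, quasiCoef D.α N (κ s₀) D.ζ (7 + j) = D.ζ j := fun j => by rw [add_comm]; rfl
  simp only [e, rpow_eighth hh]
  rw [h4, h6, h7, Finset.mul_sum]
  generalize h ^ (1 / 8 : ℝ) = ε
  have e7 : ∑ k ∈ Finset.range 7, ε ^ k * quasiCoef D.α N (κ s₀) D.ζ k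
      = -1 - ε ^ 4 * κ s₀ + ε ^ 6 * ((2 * N + 1) * D.α) := by
    simp [Finset.sum_range_succ, quasiCoef]; ring
  rw [e7]
  congr 1
  · push_cast; ring
  · exact Finset.sum_congr rfl fun j _ => by ring

/-- The ansatz is a single weighted polynomial. -/
theorem ansatz_eq {h : ℝ} (hh : 0 < h) (M : ℕ) :
    ansatz (profile D.α (D.V 0)) (fun j => profile D.α (D.V j)) (fun j => ev D.α (D.q j)) M h
      = ev D.α (D.ansatzPoly M (h ^ (1 / 8 : ℝ))) := by
  funext σ τ
  have h7 := rpow_eighth hh 7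
  norm_num at h7
  set ε := h ^ (1 / 8 : ℝ) with hε
  simp only [ansatz, rpow_eighth hh, ← hε, u0_mul_profile]
  rw [h7, ansatzPoly, ev_sum]
  simp only [ev_smul, ansatzCoef, ev_add, mul_add, Finset.sum_add_distrib]
  congr 1
  · have e : ∑ b ∈ Finset.range (8 + M), ε ^ b * ev D.α (embS (if b ≤ M + 1 then D.V b else 0)) σ τ
        = ∑ b ∈ Finset.range (M + 2), ε ^ b * ev D.α (embS (D.V b)) σ τ := by
      rw [show 8 + M = (M + 2) + 6 by ring, Finset.sum_range_add _ (M + 2)]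
      rw [Finset.sum_eq_zero (s := Finset.range 6), add_zero]
      · refine Finset.sum_congr rfl fun b hb => ?_
        rw [if_pos (by have := Finset.mem_range.1 hb; omega)]
      · intro b _
        rw [if_neg (by omega), map_zero, ev_zero, mul_zero]
    rw [e, Finset.range_eq_Ico, Finset.sum_eq_sum_Ico_succ_bot (by omega), pow_zero, one_mul]
    congr 1
  · rw [show 8 + M = 7 + (M + 1) by ring, Finset.sum_range_add _ 7, Finset.sum_eq_zero
      (s := Finset.range 7), zero_add, Finset.mul_sum]
    · refine Finset.sum_congr rfl fun b _ => ?_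
      rw [if_pos (by omega), Nat.add_sub_cancel_left, pow_add]; ring
    · intro b hb
      rw [if_neg (by have := Finset.mem_range.1 hb; omega), ev_zero, mul_zero]

/-- The operator `opTrunc` acts on weighted polynomials as the conjugated operator, with `ε =
h^{1/8}`. -/
theorem opTrunc_sub_eq {h : ℝ} (hh : 0 < h) (M : ℕ) (p : Poly2) (σ τ : ℝ) :
    opTrunc κ s₀ M h (ev D.α p) σ τ - quasiEigenvalue κ s₀ (N + 1) D.ζ M h * ev D.α p σ τ
      = ev D.α (∑ a ∈ Finset.range (8 + M), (h ^ (1 / 8 : ℝ)) ^ a • D.opMinus a p) σ τ := by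
  rw [D.ev_sum_opMinus, D.quasiEigenvalue_eq hh]
  congr 1
  have h4 := rpow_eighth hh 4
  have h6 := rpow_eighth hh 6
  have h7 := rpow_eighth hh 7
  norm_num at h4 h6 h7
  set ε := h ^ (1 / 8 : ℝ) with hε
  simp only [opTrunc, rpow_eighth hh, ← hε, opQ, dT_ev, dS_ev, D.taylor_T, D.taylor_SS, D.taylor_S]
  rw [h4, h6, h7, show 8 + M = 7 + (M + 1) by ring, Finset.sum_range_add _ 7,
    Finset.sum_range_add _ 7, Finset.sum_range_add _ 7]
  have lT : ∑ k ∈ Finset.range 7, ε ^ k * MvPolynomial.eval ![σ, τ] (D.cT k)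
      = ε ^ 4 * κ s₀ + ε ^ 6 * (iteratedDeriv 2 κ s₀ / 2 * σ ^ 2) := by
    rw [Finset.sum_congr rfl fun k hk => by rw [D.low_T k (Finset.mem_range.1 hk)]]
    simp [Finset.sum_range_succ]
  have lSS : ∑ k ∈ Finset.range 7, ε ^ k * MvPolynomial.eval ![σ, τ] (D.cSS k) = -ε ^ 6 := by
    rw [Finset.sum_congr rfl fun k hk => by rw [D.low_SS k (Finset.mem_range.1 hk)]]
    simp [Finset.sum_range_succ]
  have lS : ∑ k ∈ Finset.range 7, ε ^ k * MvPolynomial.eval ![σ, τ] (D.cS k) = 0 := by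
    rw [Finset.sum_congr rfl fun k hk => by rw [D.low_S k (Finset.mem_range.1 hk)]]
    simp
  rw [lT, lSS, lS]
  simp only [add_mul, Finset.sum_mul, Finset.mul_sum, mul_add, Finset.sum_add_distrib, pow_add]
  rw [Finset.sum_congr rfl fun j _ => (by ring : ε ^ 7 * ε ^ j
      * (MvPolynomial.eval ![σ, τ]) (D.cT (7 + j)) * ev D.α (polyT p) σ τ = ε ^ 7 * (ε ^ j
      * ((MvPolynomial.eval ![σ, τ]) (D.cT (7 + j)) * ev D.α (polyT p) σ τ))),
    Finset.sum_congr rfl fun j _ => (by ring : ε ^ 7 * ε ^ j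
      * (MvPolynomial.eval ![σ, τ]) (D.cSS (7 + j)) * ev D.α (polyS D.α (polyS D.α p)) σ τ
      = ε ^ 7 * (ε ^ j
      * ((MvPolynomial.eval ![σ, τ]) (D.cSS (7 + j)) * ev D.α (polyS D.α (polyS D.α p)) σ τ))),
    Finset.sum_congr rfl fun j _ => (by ring : ε ^ 7 * ε ^ j
      * (MvPolynomial.eval ![σ, τ]) (D.cS (7 + j)) * ev D.α (polyS D.α p) σ τ = ε ^ 7 * (ε ^ j
      * ((MvPolynomial.eval ![σ, τ]) (D.cS (7 + j)) * ev D.α (polyS D.α p) σ τ)))]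
  ring

theorem isQuasimodeExpansion : IsQuasimodeExpansion κ s₀ (N + 1) D.ζ := by
  refine ⟨profileSchwartz D.α_pos (D.V 0), fun j => profileSchwartz D.α_pos (D.V j),
    fun j => ev D.α (D.q j), D.normalized, fun σ => ?_, fun j => isSchwartzHalf_ev D.α_pos _,
    fun j σ => ?_, fun M => ?_⟩
  -- The polynomial identity for `V 0`, evaluated at `τ = 0`, is the equation of the harmonic
  -- oscillator.
  · have h := polyP3_embS D.α N (D.V 0)
    rw [D.oscillator_V, map_zero] at h
    have h' : -polyS D.α (polyS D.α (embS (D.V 0)))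
        - (MvPolynomial.C (D.α ^ 2) * MvPolynomial.X 0 ^ 2) * polyT (embS (D.V 0))
        - ((2 * N + 1) * D.α) • embS (D.V 0) = 0 := h
    have h2 := congrArg (fun p => ev D.α p σ 0) h'
    simp only [polyT_embS, ev_sub, ev_neg, ev_mul, ev_smul, ev_zero] at h2
    simp only [map_mul, MvPolynomial.eval_C, map_pow, MvPolynomial.eval_X] at h2
    rw [coe_profileSchwartz, iteratedDeriv_profile, profile_eq, ← D.α_sq, Real.sqrt_sq D.α_pos.le]
    simp only [Function.iterate_succ, Function.iterate_zero, Function.comp, id]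
    simp only [Matrix.cons_val_zero] at h2
    push_cast
    linear_combination (√2)⁻¹ * h2
  · simp only [dT_ev, ev, polyT_apply, map_sub, D.robin]; ring
  · obtain ⟨C, hC, h⟩ := D.exists_ev_sum_opMinus_le M
    set w : ℝ × ℝ → ℝ := fun p => Real.exp (-p.2 / 2 - D.α / 4 * p.1 ^ 2) with hw
    have hwL := memLp_weight D.α_pos
    set W := (eLpNorm w 2 (volume.restrict {p : ℝ × ℝ | 0 < p.2})).toReal with hW
    have hW0 : 0 ≤ W := ENNReal.toReal_nonneg
    refine ⟨C * (W + 1), by positivity, 1, one_pos, fun h₁ hh => ?_⟩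
    have hε : 0 < h₁ ^ (1 / 8 : ℝ) := Real.rpow_pos_of_pos hh.1 _
    have hε1 : h₁ ^ (1 / 8 : ℝ) ≤ 1 := Real.rpow_le_one hh.1.le hh.2.le (by norm_num)
    have e8 : h₁ ^ (7 / 8 + ((M : ℝ) + 1) / 8) = (h₁ ^ (1 / 8 : ℝ)) ^ (8 + M) := by
      rw [← rpow_eighth hh.1]; congr 1; push_cast; ring
    set ε := h₁ ^ (1 / 8 : ℝ) with hεd
    have hb : eLpNorm (fun p : ℝ × ℝ =>
        ev D.α (∑ a ∈ Finset.range (8 + M), ε ^ a • D.opMinus a (D.ansatzPoly M ε)) p.1 p.2) 2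
        (volume.restrict {p : ℝ × ℝ | 0 < p.2})
        ≤ eLpNorm (fun p => C * ε ^ (8 + M) * w p) 2
          (volume.restrict {p : ℝ × ℝ | 0 < p.2}) := by
      refine eLpNorm_mono_ae_real ?_
      filter_upwards [ae_restrict_mem (measurableSet_lt measurable_const measurable_snd)] with p hp
      exact h ε p.1 p.2 hε hε1 (le_of_lt hp)
    have hc : eLpNorm (fun p => C * ε ^ (8 + M) * w p) 2
        (volume.restrict {p : ℝ × ℝ | 0 < p.2})
        = ENNReal.ofReal (C * ε ^ (8 + M) * W) := by
      have := eLpNorm_const_smul (C * ε ^ (8 + M)) w 2 (volume.restrict {p : ℝ × ℝ | 0 < p.2})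
      rw [ENNReal.ofReal_mul (by positivity), hW, ENNReal.ofReal_toReal hwL.eLpNorm_ne_top,
        ← Real.enorm_of_nonneg (by positivity)]
      exact this
    simp only [coe_profileSchwartz, D.ansatz_eq hh.1, D.opTrunc_sub_eq hh.1]
    refine hb.trans (hc.le.trans (ENNReal.ofReal_le_ofReal ?_))
    rw [e8]
    have : 0 < C * ε ^ (8 + M) := by positivity
    nlinarith

end QuasimodeData

end Existence

/-! ### Functions supported near a boundary point -/

namespace BoundaryParam

section Push

variable {Ω : Set Plane} {ι : Type} (Γ : BoundaryParam Ω ι) (i : ι)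

/-- The function on the plane that is `W` in the boundary coordinates on `box s₀ δ` and vanishes
elsewhere. -/
def push (s₀ δ : ℝ) (W : ℝ × ℝ → ℂ) : Plane → ℂ :=
  (Γ.tube i '' box s₀ δ).indicator fun x => W (Function.invFunOn (Γ.tube i) (box s₀ δ) x)

theorem push_of_notMem {s₀ δ : ℝ} {W : ℝ × ℝ → ℂ} {x : Plane} (hx : x ∉ Γ.tube i '' box s₀ δ) :
    Γ.push i s₀ δ W x = 0 :=
  indicator_of_notMem hx _

variable {Γ i} {s₀ δ : ℝ}

theorem IsPatch.push_tube (h : Γ.IsPatch i s₀ δ) (W : ℝ × ℝ → ℂ) {p : ℝ × ℝ}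
    (hp : p ∈ box s₀ δ) : Γ.push i s₀ δ W (Γ.tube i p) = W p := by
  rw [push, indicator_of_mem (mem_image_of_mem _ hp), h.injOn.leftInvOn_invFunOn hp]

theorem IsPatch.tubeJac_pos (h : Γ.IsPatch i s₀ δ) {p : ℝ × ℝ} (hp : p ∈ box s₀ δ) :
    0 < Γ.tubeJac i p := by
  have := (h.jac_mem p hp).1
  linarith

/-- Locally `push` is the composition with a smooth inverse of the boundary coordinates. -/
theorem IsPatch.push_eventuallyEq (h : Γ.IsPatch i s₀ δ) (W : ℝ × ℝ → ℂ) {p : ℝ × ℝ}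
    (hp : p ∈ box s₀ δ) :
    ∃ g : Plane → ℝ × ℝ, ContDiffAt ℝ ∞ g (Γ.tube i p) ∧ g (Γ.tube i p) = p ∧
      Γ.push i s₀ δ W =ᶠ[𝓝 (Γ.tube i p)] W ∘ g := by
  have hc : ContDiffAt ℝ ∞ (Γ.tube i) p := (Γ.contDiff_tube i).contDiffAt
  have hf : HasFDerivAt (Γ.tube i)
      (Γ.tubeDerivEquiv i p (h.tubeJac_pos hp).ne' : ℝ × ℝ →L[ℝ] Plane) p :=
    Γ.hasFDerivAt_tube i p
  have hg := hc.to_localInverse hf (by simp)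
  have hgp := hc.localInverse_apply_image hf (by simp)
  refine ⟨_, hg, hgp, ?_⟩
  have h1 : ∀ᶠ y in 𝓝 (Γ.tube i p), Γ.tube i (hc.localInverse hf (by simp) y) = y :=
    (hc.hasStrictFDerivAt' hf (by simp)).eventually_right_inverse
  have h2 : ∀ᶠ y in 𝓝 (Γ.tube i p), hc.localInverse hf (by simp) y ∈ box s₀ δ :=
    hg.continuousAt.eventually (by rw [hgp]; exact (isOpen_box s₀ δ).mem_nhds hp)
  filter_upwards [h1, h2] with y hy1 hy2
  conv_lhs => rw [← hy1]
  rw [h.push_tube W hy2]; rfl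

/-- The result is smooth on the whole plane, across the boundary of `Ω`. -/
theorem IsPatch.isTest_push (h : Γ.IsPatch i s₀ δ) {W : ℝ × ℝ → ℂ} (hW : ContDiff ℝ ∞ W)
    (hWc : HasCompactSupport W) (hWs : tsupport W ⊆ box s₀ δ) : IsTest (Γ.push i s₀ δ W) := by
  have hK : IsCompact (Γ.tube i '' tsupport W) := hWc.isCompact.image (Γ.contDiff_tube i).continuous
  have h0 : ∀ x ∉ Γ.tube i '' tsupport W, Γ.push i s₀ δ W x = 0 := fun x hx => by
    by_cases hx' : x ∈ Γ.tube i '' box s₀ δ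
    · obtain ⟨p, hp, rfl⟩ := hx'
      rw [h.push_tube W hp]
      by_contra hne
      exact hx ⟨p, subset_tsupport W hne, rfl⟩
    · exact Γ.push_of_notMem i hx'
  refine ⟨contDiff_iff_contDiffAt.2 fun x => ?_, HasCompactSupport.intro hK h0⟩
  by_cases hx : x ∈ Γ.tube i '' tsupport W
  · obtain ⟨p, hp, rfl⟩ := hx
    obtain ⟨g, hg, hgp, he⟩ := h.push_eventuallyEq W (hWs hp)
    exact (hW.contDiffAt.comp _ hg).congr_of_eventuallyEq he
  · refine contDiffAt_const (c := (0 : ℂ)) |>.congr_of_eventuallyEq ?_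
    filter_upwards [hK.isClosed.isOpen_compl.mem_nhds hx] with y hy using h0 y hy

/-- The change of variables for functions supported near a boundary point; `Ω` becomes the
half-plane `t > 0`. -/
theorem IsPatch.setIntegral_eq (h : Γ.IsPatch i s₀ δ) (hΩ : IsOpen Ω) {E : Type*}
    [NormedAddCommGroup E] [NormedSpace ℝ E] {g : Plane → E}
    {G : ℝ × ℝ → E} (hg : ∀ x ∉ Γ.tube i '' box s₀ δ, g x = 0) (hG : ∀ p ∉ box s₀ δ, G p = 0)
    (hgG : ∀ p ∈ box s₀ δ, Γ.tubeJac i p • g (Γ.tube i p) = G p) :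
    ∫ x in Ω, g x = ∫ p in {p : ℝ × ℝ | 0 < p.2}, G p := by
  have hhalf : MeasurableSet {p : ℝ × ℝ | 0 < p.2} :=
    measurableSet_lt measurable_const measurable_snd
  have hS : MeasurableSet (box s₀ δ ∩ {p : ℝ × ℝ | 0 < p.2}) :=
    (isOpen_box s₀ δ).measurableSet.inter hhalf
  have e1 : ∫ x in Ω, g x = ∫ x in Γ.tube i '' (box s₀ δ ∩ {p : ℝ × ℝ | 0 < p.2}), g x := by
    refine setIntegral_eq_of_subset_of_forall_sdiff_eq_zero hΩ.measurableSet ?_ ?_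
    · rintro _ ⟨p, ⟨hp, hp0⟩, rfl⟩
      exact h.mem p hp hp0
    · rintro x ⟨hx, hx'⟩
      refine hg x ?_
      rintro ⟨p, hp, rfl⟩
      rcases lt_or_ge 0 p.2 with h0 | h0
      · exact hx' ⟨p, ⟨hp, h0⟩, rfl⟩
      · exact h.notMem p hp h0 hx
  have e2 : ∫ p in {p : ℝ × ℝ | 0 < p.2}, G p
      = ∫ p in box s₀ δ ∩ {p : ℝ × ℝ | 0 < p.2}, G p := by
    refine setIntegral_eq_of_subset_of_forall_sdiff_eq_zero hhalf inter_subset_right ?_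
    rintro p ⟨hp, hp'⟩
    exact hG p fun hb => hp' ⟨hb, hp⟩
  rw [e1, e2, Γ.setIntegral_tube i hS (h.injOn.mono inter_subset_left)]
  refine setIntegral_congr_fun hS fun p hp => ?_
  rw [abs_of_pos (h.tubeJac_pos hp.1), hgG p hp.1]

/-- On the boundary, `push` takes the values of `W` at `t = 0`, with parameters in one period about
`s₀`. -/
theorem IsPatch.push_M (h : Γ.IsPatch i s₀ δ) {W : ℝ × ℝ → ℂ} (hW : ∀ p ∉ box s₀ δ, W p = 0)
    {s : ℝ} (hs : |s - s₀| ≤ Γ.len i / 2) : Γ.push i s₀ δ W (Γ.M i s) = W (s, 0) := by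
  by_cases hs' : (s, (0 : ℝ)) ∈ box s₀ δ
  · rw [← tube_zero, h.push_tube W hs']
  · rw [hW _ hs', push_of_notMem]
    rintro ⟨p, hp, hpe⟩
    have h1 : Γ.tube i p ∈ frontier Ω := by
      rw [hpe, Γ.frontier_eq]; exact mem_iUnion.2 ⟨i, mem_range_self _⟩
    have h2 := h.eq_zero p hp h1
    have h3 : p = (p.1, 0) := Prod.ext rfl h2
    rw [h3, tube_zero] at hpe
    obtain ⟨-, k, hk⟩ := Γ.simple _ _ _ _ hpe
    have hl := Γ.len_pos i
    have h4 := h.le_half_len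
    have hp1 := hp.1
    rw [abs_le] at hs
    have hk1 : |(k : ℝ)| < 1 := by
      rw [← mul_lt_mul_iff_left₀ hl, ← abs_of_pos hl, ← abs_mul, abs_of_pos hl, one_mul, abs_lt]
      constructor <;> linarith [hp1.1, hp1.2, hs.1, hs.2]
    have hk0 : k = 0 := by
      have : |k| < 1 := by exact_mod_cast hk1
      exact Int.abs_lt_one_iff.1 this
    rw [hk0, Int.cast_zero, zero_mul, add_zero] at hk
    refine hs' ?_
    rw [hk]
    exact ⟨hp1, by simpa using h.pos⟩

/-- The boundary integral of a function supported near a boundary point. -/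
theorem IsPatch.integral_arcMeasure [Fintype ι] (h : Γ.IsPatch i s₀ δ) {W : ℝ × ℝ → ℂ}
    (hW : ∀ p ∉ box s₀ δ, W p = 0) (hT : IsTest (Γ.push i s₀ δ W)) {η : Plane → ℂ}
    (hη : IsTest η) :
    ∫ x, Γ.push i s₀ δ W x * conj (η x) ∂Γ.arcMeasure
      = ∫ s, W (s, 0) * conj (η (Γ.M i s)) := by
  classical
  set F : Plane → ℂ := fun x => Γ.push i s₀ δ W x * conj (η x) with hF
  have hFc : Continuous F := hT.1.continuous.mul hη.conj.1.continuous
  have hFi : Integrable F Γ.arcMeasure :=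
    (hT.memLp 2 Γ.arcMeasure).integrable_mul (hη.conj.memLp 2 Γ.arcMeasure)
  have hmap : ∀ j, ∫ x, F x ∂((volume.restrict (Ioc 0 (Γ.len j))).map (Γ.M j))
      = ∫ s in Ioc 0 (Γ.len j), F (Γ.M j s) := fun j =>
    integral_map (Γ.smooth j).continuous.aemeasurable hFc.aestronglyMeasurable
  have e1 : ∫ x, F x ∂Γ.arcMeasure = ∑ j, ∫ s in Ioc 0 (Γ.len j), F (Γ.M j s) := by
    have e2 := integral_finsetSum_measure (integrable_finsetSum_measure.1 hFi)
    exact e2.trans (Finset.sum_congr rfl fun j _ => hmap j)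
  rw [e1, Finset.sum_eq_single i]
  · have hper : Function.Periodic (fun s => F (Γ.M i s)) (Γ.len i) := fun s => by
      simp only [Γ.periodic i s]
    have hl := Γ.len_pos i
    -- The period is moved so that `s₀` is its midpoint; it then contains the support.
    have e3 := hper.intervalIntegral_add_eq 0 (s₀ - Γ.len i / 2)
    rw [zero_add, intervalIntegral.integral_of_le hl.le,
      intervalIntegral.integral_of_le (by linarith)] at e3
    rw [e3]
    have e4 : ∫ s in Ioc (s₀ - Γ.len i / 2) (s₀ - Γ.len i / 2 + Γ.len i), F (Γ.M i s)
        = ∫ s in Ioc (s₀ - Γ.len i / 2) (s₀ - Γ.len i / 2 + Γ.len i),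
          W (s, 0) * conj (η (Γ.M i s)) := by
      refine setIntegral_congr_fun measurableSet_Ioc fun s hs => ?_
      simp only [hF]
      rw [h.push_M hW (abs_le.2 ⟨by linarith [hs.1], by linarith [hs.2]⟩)]
    rw [e4]
    refine setIntegral_eq_integral_of_forall_compl_eq_zero fun s hs => ?_
    rw [hW, zero_mul]
    intro hb
    have h4 := h.le_half_len
    exact hs ⟨by linarith [hb.1.1], by linarith [hb.1.2]⟩
  · intro j _ hj
    have : ∀ s, F (Γ.M j s) = 0 := fun s => by
      simp only [hF]
      rw [push_of_notMem, zero_mul]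
      rintro ⟨p, hp, hpe⟩
      have h1 : Γ.tube i p ∈ frontier Ω := by
        rw [hpe, Γ.frontier_eq]; exact mem_iUnion.2 ⟨j, mem_range_self _⟩
      have h2 := h.eq_zero p hp h1
      have h3 : p = (p.1, 0) := Prod.ext rfl h2
      rw [h3, tube_zero] at hpe
      exact hj (Γ.simple _ _ _ _ hpe).1.symm
    simp [this]
  · intro hi; exact absurd (Finset.mem_univ i) hi

end Push

end BoundaryParam

/-! ### Green's formula in boundary coordinates -/

section HalfPlane

variable {E : Type*} [NormedAddCommGroup E] [NormedSpace ℝ E]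

/-- The partial derivative in the first variable. -/
def dFst (W : ℝ × ℝ → E) (p : ℝ × ℝ) : E := fderiv ℝ W p (1, 0)

/-- The partial derivative in the second variable. -/
def dSnd (W : ℝ × ℝ → E) (p : ℝ × ℝ) : E := fderiv ℝ W p (0, 1)

variable {W : ℝ × ℝ → E}

theorem hasDerivAt_dFst (hW : Differentiable ℝ W) (p : ℝ × ℝ) :
    HasDerivAt (fun s => W (s, p.2)) (dFst W p) p.1 := by
  have h2 : HasDerivAt (fun s : ℝ => (s, p.2)) ((1 : ℝ), (0 : ℝ)) p.1 :=
    (hasDerivAt_id _).prodMk (hasDerivAt_const _ _)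
  exact (hW p).hasFDerivAt.comp_hasDerivAt (f := fun s : ℝ => (s, p.2)) p.1 h2

theorem hasDerivAt_dSnd (hW : Differentiable ℝ W) (p : ℝ × ℝ) :
    HasDerivAt (fun t => W (p.1, t)) (dSnd W p) p.2 := by
  have h2 : HasDerivAt (fun t : ℝ => (p.1, t)) ((0 : ℝ), (1 : ℝ)) p.2 :=
    (hasDerivAt_const _ _).prodMk (hasDerivAt_id _)
  exact (hW p).hasFDerivAt.comp_hasDerivAt (f := fun t : ℝ => (p.1, t)) p.2 h2

theorem contDiff_dFst (hW : ContDiff ℝ ∞ W) : ContDiff ℝ ∞ (dFst W) :=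
  (hW.fderiv_right (m := ∞) (by simp)).clm_apply contDiff_const

theorem contDiff_dSnd (hW : ContDiff ℝ ∞ W) : ContDiff ℝ ∞ (dSnd W) :=
  (hW.fderiv_right (m := ∞) (by simp)).clm_apply contDiff_const

theorem tsupport_dFst_subset (W : ℝ × ℝ → E) : tsupport (dFst W) ⊆ tsupport W :=
  tsupport_fderiv_apply_subset ℝ _

theorem tsupport_dSnd_subset (W : ℝ × ℝ → E) : tsupport (dSnd W) ⊆ tsupport W :=
  tsupport_fderiv_apply_subset ℝ _

theorem prod_restrict_Ioi : (volume : Measure ℝ).prod (volume.restrict (Ioi 0))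
    = (volume : Measure (ℝ × ℝ)).restrict {p : ℝ × ℝ | 0 < p.2} := by
  have : {p : ℝ × ℝ | 0 < p.2} = univ ×ˢ Ioi 0 := by ext; simp
  rw [this, Measure.volume_eq_prod, ← Measure.prod_restrict, Measure.restrict_univ]

theorem isClosedEmbedding_prodMk_left (t : ℝ) :
    Topology.IsClosedEmbedding fun s : ℝ => ((s, t) : ℝ × ℝ) :=
  (Isometry.of_dist_eq fun s s' => by simp [Prod.dist_eq]).isClosedEmbedding

theorem isClosedEmbedding_prodMk_right (s : ℝ) :
    Topology.IsClosedEmbedding fun t : ℝ => ((s, t) : ℝ × ℝ) :=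
  (Isometry.of_dist_eq fun t t' => by simp [Prod.dist_eq]).isClosedEmbedding

theorem hasCompactSupport_dFst (hc : HasCompactSupport W) : HasCompactSupport (dFst W) :=
  hc.fderiv_apply ℝ _

theorem hasCompactSupport_dSnd (hc : HasCompactSupport W) : HasCompactSupport (dSnd W) :=
  hc.fderiv_apply ℝ _

theorem integral_half_dFst {W : ℝ × ℝ → ℂ} (hW : ContDiff ℝ ∞ W) (hc : HasCompactSupport W) :
    ∫ p in {p : ℝ × ℝ | 0 < p.2}, dFst W p = 0 := by
  have hi : Integrable (dFst W) :=
    (contDiff_dFst hW).continuous.integrable_of_hasCompactSupport (hasCompactSupport_dFst hc)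
  rw [← prod_restrict_Ioi, integral_prod_symm _ (by rw [prod_restrict_Ioi]; exact hi.restrict)]
  refine integral_eq_zero_of_ae (Eventually.of_forall fun t => ?_)
  have hemb := isClosedEmbedding_prodMk_left t
  refine integral_eq_zero_of_hasDerivAt_of_integrable (f := fun s => W (s, t))
    (fun s => hasDerivAt_dFst (hW.differentiable (by simp)) (s, t)) ?_ ?_
  · exact ((contDiff_dFst hW).continuous.comp hemb.continuous).integrable_of_hasCompactSupport
      ((hasCompactSupport_dFst hc).comp_isClosedEmbedding hemb)
  · exact (hW.continuous.comp hemb.continuous).integrable_of_hasCompactSupport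
      (hc.comp_isClosedEmbedding hemb)

theorem integral_half_dSnd {W : ℝ × ℝ → ℂ} (hW : ContDiff ℝ ∞ W) (hc : HasCompactSupport W) :
    ∫ p in {p : ℝ × ℝ | 0 < p.2}, dSnd W p = -∫ s, W (s, 0) := by
  have hi : Integrable (dSnd W) :=
    (contDiff_dSnd hW).continuous.integrable_of_hasCompactSupport (hasCompactSupport_dSnd hc)
  rw [← prod_restrict_Ioi, integral_prod _ (by rw [prod_restrict_Ioi]; exact hi.restrict),
    ← integral_neg]
  refine integral_congr_ae (Eventually.of_forall fun s => ?_)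
  have hemb := isClosedEmbedding_prodMk_right s
  have h1 : ContDiff ℝ ∞ fun t : ℝ => W (s, t) := hW.comp (contDiff_const.prodMk contDiff_id)
  have h2 := HasCompactSupport.integral_Ioi_deriv_eq (h1.of_le (by exact_mod_cast le_top))
    (hc.comp_isClosedEmbedding hemb) 0
  have h3 : ∀ t, deriv (fun t : ℝ => W (s, t)) t = dSnd W (s, t) := fun t =>
    (hasDerivAt_dSnd (hW.differentiable (by simp)) (s, t)).deriv
  simp only [← h3]
  exact h2

/-- A smooth function with compact support in an open set stays smooth when it is multiplied with
a function that is smooth on this set. -/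
theorem contDiff_mul_of_tsupport {a w : ℝ × ℝ → ℝ} {U : Set (ℝ × ℝ)}
    (ha : ∀ p ∈ U, ContDiffAt ℝ ∞ a p) (hw : ContDiff ℝ ∞ w) (hU : tsupport w ⊆ U) :
    ContDiff ℝ ∞ fun p => a p * w p := by
  refine contDiff_iff_contDiffAt.2 fun p => ?_
  by_cases hp : p ∈ tsupport w
  · exact (ha p (hU hp)).mul hw.contDiffAt
  · refine contDiffAt_const (c := (0 : ℝ)) |>.congr_of_eventuallyEq ?_
    filter_upwards [notMem_tsupport_iff_eventuallyEq.1 hp] with q hq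
    rw [hq]; simp

end HalfPlane

theorem fderiv_conj {η : Plane → ℂ} (hη : Differentiable ℝ η) (x v : Plane) :
    fderiv ℝ (fun x => conj (η x)) x v = conj (fderiv ℝ η x v) := by
  have h : HasFDerivAt (fun x => conj (η x))
      ((Complex.conjCLE : ℂ →L[ℝ] ℂ) ∘L fderiv ℝ η x) x :=
    (Complex.conjCLE : ℂ →L[ℝ] ℂ).hasFDerivAt.comp x (hη x).hasFDerivAt
  rw [h.fderiv]; rfl

namespace BoundaryParam

variable {Ω : Set Plane} {ι : Type} (Γ : BoundaryParam Ω ι) (i : ι)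

/-- The tangential component of the flux, `a⁻¹ ∂_s W`. -/
def fluxFst (W : ℝ × ℝ → ℝ) (p : ℝ × ℝ) : ℝ := (Γ.tubeJac i p)⁻¹ * dFst W p

/-- The normal component of the flux, `a ∂_t W`. -/
def fluxSnd (W : ℝ × ℝ → ℝ) (p : ℝ × ℝ) : ℝ := Γ.tubeJac i p * dSnd W p

/-- The function `(𝓛_h - μ) W` in the boundary coordinates. -/
def residual (h μ : ℝ) (W : ℝ × ℝ → ℝ) (p : ℝ × ℝ) : ℝ :=
  -h ^ 2 * ((Γ.tubeJac i p)⁻¹ * (dFst (Γ.fluxFst i W) p + dSnd (Γ.fluxSnd i W) p)) - μ * W p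

variable {Γ i} {s₀ δ : ℝ} {W : ℝ × ℝ → ℝ}

theorem IsPatch.contDiffAt_inv_tubeJac (h : Γ.IsPatch i s₀ δ) {p : ℝ × ℝ} (hp : p ∈ box s₀ δ) :
    ContDiffAt ℝ ∞ (fun p => (Γ.tubeJac i p)⁻¹) p :=
  (Γ.contDiff_tubeJac i).contDiffAt.inv (h.tubeJac_pos hp).ne'

theorem tsupport_mul_subset_right (a w : ℝ × ℝ → ℝ) : tsupport (fun p => a p * w p) ⊆ tsupport w :=
  closure_mono fun p hp h0 => hp (by simp only [h0, mul_zero])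

theorem IsPatch.contDiff_fluxFst (h : Γ.IsPatch i s₀ δ) (hW : ContDiff ℝ ∞ W)
    (hWs : tsupport W ⊆ box s₀ δ) : ContDiff ℝ ∞ (Γ.fluxFst i W) :=
  contDiff_mul_of_tsupport (fun _ hp => h.contDiffAt_inv_tubeJac hp) (contDiff_dFst hW)
    ((tsupport_dFst_subset W).trans hWs)

variable (Γ i) in
theorem tsupport_fluxFst (W : ℝ × ℝ → ℝ) : tsupport (Γ.fluxFst i W) ⊆ tsupport W :=
  (tsupport_mul_subset_right _ _).trans (tsupport_dFst_subset W)

variable (Γ i) in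
theorem contDiff_fluxSnd (hW : ContDiff ℝ ∞ W) : ContDiff ℝ ∞ (Γ.fluxSnd i W) :=
  (Γ.contDiff_tubeJac i).mul (contDiff_dSnd hW)

variable (Γ i) in
theorem tsupport_fluxSnd (W : ℝ × ℝ → ℝ) : tsupport (Γ.fluxSnd i W) ⊆ tsupport W :=
  (tsupport_mul_subset_right _ _).trans (tsupport_dSnd_subset W)

variable (Γ i) in
theorem tsupport_div_subset (W : ℝ × ℝ → ℝ) :
    tsupport (fun p => dFst (Γ.fluxFst i W) p + dSnd (Γ.fluxSnd i W) p) ⊆ tsupport W := by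
  refine (tsupport_add _ _).trans (union_subset ?_ ?_)
  · exact (tsupport_dFst_subset _).trans (Γ.tsupport_fluxFst i W)
  · exact (tsupport_dSnd_subset _).trans (Γ.tsupport_fluxSnd i W)

theorem IsPatch.contDiff_residual (h : Γ.IsPatch i s₀ δ) (hW : ContDiff ℝ ∞ W)
    (hWs : tsupport W ⊆ box s₀ δ) (h₁ μ : ℝ) : ContDiff ℝ ∞ (Γ.residual i h₁ μ W) := by
  refine (contDiff_const.mul (contDiff_mul_of_tsupport (U := box s₀ δ)
    (fun _ hp => h.contDiffAt_inv_tubeJac hp) ?_ ((Γ.tsupport_div_subset i W).trans hWs))).sub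
    (contDiff_const.mul hW)
  exact (contDiff_dFst (h.contDiff_fluxFst hW hWs)).add
    (contDiff_dSnd (Γ.contDiff_fluxSnd i hW))

variable (Γ i) in
theorem tsupport_residual (h₁ μ : ℝ) (W : ℝ × ℝ → ℝ) :
    tsupport (Γ.residual i h₁ μ W) ⊆ tsupport W := by
  refine (tsupport_sub _ _).trans (union_subset ?_ (tsupport_mul_subset_right _ _))
  exact (tsupport_mul_subset_right _ _).trans
    ((tsupport_mul_subset_right _ _).trans (Γ.tsupport_div_subset i W))

/-- A real function of the boundary coordinates, transported to the plane. -/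
abbrev pushR (Γ : BoundaryParam Ω ι) (i : ι) (s₀ δ : ℝ) (W : ℝ × ℝ → ℝ) : Plane → ℂ :=
  Γ.push i s₀ δ fun p => (W p : ℂ)

theorem IsPatch.isTest_pushR (h : Γ.IsPatch i s₀ δ) (hW : ContDiff ℝ ∞ W)
    (hWc : HasCompactSupport W) (hWs : tsupport W ⊆ box s₀ δ) : IsTest (Γ.pushR i s₀ δ W) := by
  have hs : tsupport (fun p => (W p : ℂ)) ⊆ tsupport W :=
    closure_mono fun p hp h0 => hp (by simp only [h0, Complex.ofReal_zero])
  exact h.isTest_push (Complex.ofRealCLM.contDiff.comp hW)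
    (hWc.comp_left (g := fun x : ℝ => (x : ℂ)) Complex.ofReal_zero) (hs.trans hWs)

/-- The two components of the gradient in boundary coordinates. -/
theorem IsPatch.dFst_eq (h : Γ.IsPatch i s₀ δ) (hW : ContDiff ℝ ∞ W)
    (hT : IsTest (Γ.pushR i s₀ δ W)) {p : ℝ × ℝ} (hp : p ∈ box s₀ δ) :
    ((dFst W p : ℝ) : ℂ) = (Γ.tubeJac i p : ℂ)
      * fderiv ℝ (Γ.pushR i s₀ δ W) (Γ.tube i p) (Γ.tangent i p.1) ∧
    ((dSnd W p : ℝ) : ℂ) = -fderiv ℝ (Γ.pushR i s₀ δ W) (Γ.tube i p) (Γ.normal i p.1) := by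
  have hd := hW.differentiable (by simp)
  have hmem := (isOpen_box s₀ δ).mem_nhds hp
  constructor
  · have h1 := (hasDerivAt_dFst hd p).ofReal_comp
    have h2 := Γ.hasDerivAt_comp_tube_fst i (hT.1.differentiable (by simp)) p.1 p.2
    refine h1.unique (h2.congr_of_eventuallyEq ?_)
    have hc : Tendsto (fun s : ℝ => ((s, p.2) : ℝ × ℝ)) (𝓝 p.1) (𝓝 p) :=
      (Continuous.prodMk_left p.2).tendsto p.1
    filter_upwards [hc.eventually hmem] with s hs
    exact (h.push_tube (fun p => (W p : ℂ)) hs).symm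
  · have h1 := (hasDerivAt_dSnd hd p).ofReal_comp
    have h2 := Γ.hasDerivAt_comp_tube_snd i (hT.1.differentiable (by simp)) p.1 p.2
    refine h1.unique (h2.congr_of_eventuallyEq ?_)
    have hc : Tendsto (fun t : ℝ => ((p.1, t) : ℝ × ℝ)) (𝓝 p.2) (𝓝 p) :=
      (Continuous.prodMk_right p.1).tendsto p.2
    filter_upwards [hc.eventually hmem] with s hs
    exact (h.push_tube (fun p => (W p : ℂ)) hs).symm

/-- Green's formula in boundary coordinates: the weak form of the eigenvalue equation for a
function given near the boundary point that satisfies the Robin condition. -/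
theorem IsPatch.weak_form [Fintype ι] (h : Γ.IsPatch i s₀ δ) (hΩ : IsOpen Ω)
    (hW : ContDiff ℝ ∞ W) (hWc : HasCompactSupport W) (hWs : tsupport W ⊆ box s₀ δ) {h₁ b μ : ℝ}
    (hrobin : ∀ s, h₁ ^ 2 * dSnd W (s, 0) = -(b * W (s, 0))) {η : Plane → ℂ} (hη : IsTest η) :
    ((h₁ ^ 2 : ℝ) : ℂ)
        * (∫ x in Ω, ∑ k, pderiv k (Γ.pushR i s₀ δ W) x * conj (pderiv k η x))
      - ((b : ℝ) : ℂ) * (∫ x, Γ.pushR i s₀ δ W x * conj (η x) ∂Γ.arcMeasure)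
      - (μ : ℂ) * (∫ x in Ω, Γ.pushR i s₀ δ W x * conj (η x))
      = ∫ x in Ω, Γ.pushR i s₀ δ (Γ.residual i h₁ μ W) x * conj (η x) := by
  have hT := h.isTest_pushR hW hWc hWs
  have hW0 : ∀ p ∉ box s₀ δ, W p = 0 := fun p hp =>
    image_eq_zero_of_notMem_tsupport fun hp' => hp (hWs hp')
  set U₁ := Γ.fluxFst i W with hU₁
  set U₂ := Γ.fluxSnd i W with hU₂
  have hU₁s : ContDiff ℝ ∞ U₁ := h.contDiff_fluxFst hW hWs
  have hU₂s : ContDiff ℝ ∞ U₂ := Γ.contDiff_fluxSnd i hW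
  have hU₁c : HasCompactSupport U₁ :=
    hWc.mono' (subset_closure.trans (Γ.tsupport_fluxFst i W))
  have hU₂c : HasCompactSupport U₂ :=
    hWc.mono' (subset_closure.trans (Γ.tsupport_fluxSnd i W))
  have hU₁0 : ∀ p ∉ box s₀ δ, U₁ p = 0 := fun p hp =>
    image_eq_zero_of_notMem_tsupport fun hp' => hp (hWs (Γ.tsupport_fluxFst i W hp'))
  have hU₂0 : ∀ p ∉ box s₀ δ, U₂ p = 0 := fun p hp =>
    image_eq_zero_of_notMem_tsupport fun hp' => hp (hWs (Γ.tsupport_fluxSnd i W hp'))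
  -- the conjugate of the test function, in boundary coordinates
  set E : ℝ × ℝ → ℂ := fun p => conj (η (Γ.tube i p)) with hE
  have hEs : ContDiff ℝ ∞ E := hη.conj.1.comp (Γ.contDiff_tube i)
  have hEd := hEs.differentiable (by simp)
  have hE1 : ∀ p, dFst E p
      = (Γ.tubeJac i p : ℂ) * conj (fderiv ℝ η (Γ.tube i p) (Γ.tangent i p.1)) := fun p => by
    rw [← fderiv_conj (hη.1.differentiable (by simp))]
    exact (hasDerivAt_dFst hEd p).unique
      (Γ.hasDerivAt_comp_tube_fst i (hη.conj.1.differentiable (by simp)) p.1 p.2)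
  have hE2 : ∀ p, dSnd E p = -conj (fderiv ℝ η (Γ.tube i p) (Γ.normal i p.1)) := fun p => by
    rw [← fderiv_conj (hη.1.differentiable (by simp))]
    exact (hasDerivAt_dSnd hEd p).unique
      (Γ.hasDerivAt_comp_tube_snd i (hη.conj.1.differentiable (by simp)) p.1 p.2)
  -- the divergence theorem on the half-plane
  have hG : ∀ U : ℝ × ℝ → ℝ, ContDiff ℝ ∞ U → HasCompactSupport U →
      ContDiff ℝ ∞ (fun p => (U p : ℂ) * E p) ∧ HasCompactSupport (fun p => (U p : ℂ) * E p) :=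
    fun U h1 h2 => ⟨(Complex.ofRealCLM.contDiff.comp h1).mul hEs,
      (h2.comp_left (g := fun x : ℝ => (x : ℂ)) Complex.ofReal_zero).mul_right⟩
  obtain ⟨g1, c1⟩ := hG U₁ hU₁s hU₁c
  obtain ⟨g2, c2⟩ := hG U₂ hU₂s hU₂c
  have hint : ∀ (U : ℝ × ℝ → ℝ) (e : ℝ × ℝ → ℂ), Continuous U → HasCompactSupport U →
      Continuous e → Integrable fun p => (U p : ℂ) * e p := fun U e h1 h2 h3 =>
    ((Complex.continuous_ofReal.comp h1).mul h3).integrable_of_hasCompactSupport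
      (h2.comp_left (g := fun x : ℝ => (x : ℂ)) Complex.ofReal_zero).mul_right
  set S : Set (ℝ × ℝ) := {p : ℝ × ℝ | 0 < p.2} with hS
  have d1 : ∫ p in S, (((dFst U₁ p : ℝ) : ℂ) * E p + (U₁ p : ℂ) * dFst E p) = 0 := by
    rw [← integral_half_dFst g1 c1]
    refine integral_congr_ae (Eventually.of_forall fun p => ?_)
    exact ((hasDerivAt_dFst (hU₁s.differentiable (by simp)) p).ofReal_comp.mul
      (hasDerivAt_dFst hEd p)).unique (hasDerivAt_dFst (g1.differentiable (by simp)) p)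
  have d2 : ∫ p in S, (((dSnd U₂ p : ℝ) : ℂ) * E p + (U₂ p : ℂ) * dSnd E p)
      = -∫ s, (U₂ (s, 0) : ℂ) * E (s, 0) := by
    rw [← integral_half_dSnd g2 c2]
    refine integral_congr_ae (Eventually.of_forall fun p => ?_)
    exact ((hasDerivAt_dSnd (hU₂s.differentiable (by simp)) p).ofReal_comp.mul
      (hasDerivAt_dSnd hEd p)).unique (hasDerivAt_dSnd (g2.differentiable (by simp)) p)
  have i1 := (hint _ _ (contDiff_dFst hU₁s).continuous (hasCompactSupport_dFst hU₁c)
    hEs.continuous).restrict (s := S)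
  have i2 := (hint _ _ hU₁s.continuous hU₁c (contDiff_dFst hEs).continuous).restrict (s := S)
  have i3 := (hint _ _ (contDiff_dSnd hU₂s).continuous (hasCompactSupport_dSnd hU₂c)
    hEs.continuous).restrict (s := S)
  have i4 := (hint _ _ hU₂s.continuous hU₂c (contDiff_dSnd hEs).continuous).restrict (s := S)
  have i5 := (hint _ _ ((Γ.contDiff_tubeJac i).mul hW).continuous hWc.mul_left
    hEs.continuous).restrict (s := S)
  rw [integral_add i1 i2] at d1
  rw [integral_add i3 i4] at d2
  -- the four terms in boundary coordinates
  have t1 : ∫ x in Ω, ∑ k, pderiv k (Γ.pushR i s₀ δ W) x * conj (pderiv k η x)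
      = (∫ p in S, (U₁ p : ℂ) * dFst E p) + ∫ p in S, (U₂ p : ℂ) * dSnd E p := by
    rw [← integral_add i2 i4]
    refine h.setIntegral_eq hΩ (fun x hx => ?_) (fun p hp => ?_) fun p hp => ?_
    · refine Finset.sum_eq_zero fun k _ => ?_
      have hx' : x ∉ tsupport (Γ.pushR i s₀ δ W) := by
        intro hx'
        have hK : IsCompact (Γ.tube i '' tsupport W) :=
          hWc.isCompact.image (Γ.contDiff_tube i).continuous
        have hsub : tsupport (Γ.pushR i s₀ δ W) ⊆ Γ.tube i '' tsupport W := by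
          refine closure_minimal (fun y hy => ?_) hK.isClosed
          by_contra hne
          refine hy ?_
          by_cases hyb : y ∈ Γ.tube i '' box s₀ δ
          · obtain ⟨p, hp, rfl⟩ := hyb
            rw [pushR, h.push_tube _ hp, image_eq_zero_of_notMem_tsupport fun hp' => hne ⟨p, hp', rfl⟩]
            simp
          · exact Γ.push_of_notMem i hyb
        exact hx (image_mono hWs (hsub hx'))
      rw [pderiv, fderiv_of_notMem_tsupport ℝ hx']
      simp
    · rw [hU₁0 p hp, hU₂0 p hp]; simp
    · obtain ⟨e1, e2⟩ := h.dFst_eq hW hT hp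
      have ha : (Γ.tubeJac i p : ℂ) ≠ 0 := by exact_mod_cast (h.tubeJac_pos hp).ne'
      rw [← Γ.frame_inner i _ η _ p.1, hE1, hE2]
      simp only [hU₁, hU₂, fluxFst, fluxSnd]
      push_cast
      rw [e1, e2, Complex.real_smul]
      field_simp
  have t2 : ∫ x, Γ.pushR i s₀ δ W x * conj (η x) ∂Γ.arcMeasure
      = ∫ s, (W (s, 0) : ℂ) * E (s, 0) := by
    rw [h.integral_arcMeasure (fun p hp => by simp [hW0 p hp]) hT hη]
    simp only [hE, tube_zero]
  have t3 : ∫ x in Ω, Γ.pushR i s₀ δ W x * conj (η x)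
      = ∫ p in S, ((Γ.tubeJac i p * W p : ℝ) : ℂ) * E p := by
    refine h.setIntegral_eq hΩ (fun x hx => ?_) (fun p hp => ?_) fun p hp => ?_
    · rw [pushR, Γ.push_of_notMem i hx, zero_mul]
    · rw [hW0 p hp]; simp
    · rw [pushR, h.push_tube _ hp, Complex.real_smul]; push_cast; ring
  have t4 : ∫ x in Ω, Γ.pushR i s₀ δ (Γ.residual i h₁ μ W) x * conj (η x)
      = -((h₁ ^ 2 : ℝ) : ℂ) * ((∫ p in S, ((dFst U₁ p : ℝ) : ℂ) * E p) + ∫ p in S, ((dSnd U₂ p : ℝ) : ℂ) * E p)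
        - (μ : ℂ) * ∫ p in S, ((Γ.tubeJac i p * W p : ℝ) : ℂ) * E p := by
    rw [← integral_add i1 i3, ← integral_const_mul, ← integral_const_mul,
      ← integral_sub ((i1.fun_add i3).const_mul _) (i5.const_mul _)]
    refine h.setIntegral_eq hΩ (fun x hx => ?_) (fun p hp => ?_) fun p hp => ?_
    · rw [pushR, Γ.push_of_notMem i hx, zero_mul]
    · have z1 : dFst U₁ p = 0 := image_eq_zero_of_notMem_tsupport fun hp' =>
        hp (hWs (Γ.tsupport_fluxFst i W (tsupport_dFst_subset _ hp')))
      have z2 : dSnd U₂ p = 0 := image_eq_zero_of_notMem_tsupport fun hp' =>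
        hp (hWs (Γ.tsupport_fluxSnd i W (tsupport_dSnd_subset _ hp')))
      rw [hW0 p hp, z1, z2]; simp
    · have ha : (Γ.tubeJac i p : ℂ) ≠ 0 := by exact_mod_cast (h.tubeJac_pos hp).ne'
      rw [pushR, h.push_tube _ hp, Complex.real_smul, residual]
      simp only [← hU₁, ← hU₂, hE]
      push_cast
      field_simp
  have t5 : ((h₁ ^ 2 : ℝ) : ℂ) * (∫ s, (U₂ (s, 0) : ℂ) * E (s, 0))
      = -(b : ℂ) * ∫ s, (W (s, 0) : ℂ) * E (s, 0) := by
    rw [← integral_const_mul, ← integral_const_mul]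
    refine integral_congr_ae (Eventually.of_forall fun s => ?_)
    have hj : U₂ (s, 0) = dSnd W (s, 0) := by simp [hU₂, fluxSnd, tubeJac]
    have hr := congrArg (fun x : ℝ => (x : ℂ)) (hrobin s)
    push_cast at hr
    simp only [hj]
    push_cast
    linear_combination E (s, 0) * hr
  rw [t1, t2, t3, t4]
  linear_combination ((h₁ ^ 2 : ℝ) : ℂ) * d1 + ((h₁ ^ 2 : ℝ) : ℂ) * d2 - t5

end BoundaryParam

/-! ### The ansatz with cutoff functions -/

section Cutoff

/-- A smooth cutoff function `χ` at scale `δ`, with bounds for its first two derivatives. -/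
structure IsCutoff (δ C : ℝ) (χ : ℝ → ℝ) : Prop where
  smooth : ContDiff ℝ ∞ χ
  eq_one : ∀ x, |x| ≤ δ / 3 → χ x = 1
  tsupport_subset : tsupport χ ⊆ Icc (-(2 * δ / 3)) (2 * δ / 3)
  abs_le_one : ∀ x, |χ x| ≤ 1
  abs_deriv_le : ∀ x, |deriv χ x| ≤ C
  abs_deriv_two_le : ∀ x, |deriv (deriv χ) x| ≤ C

theorem exists_isCutoff {δ : ℝ} (hδ : 0 < δ) : ∃ C χ, 0 ≤ C ∧ IsCutoff δ C χ := by
  let χ : ContDiffBump (0 : ℝ) := ⟨δ / 3, 2 * δ / 3, by positivity, by linarith⟩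
  have hs : ContDiff ℝ ∞ χ := χ.contDiff
  have h1 : ContDiff ℝ ∞ (deriv χ) := (contDiff_infty_iff_deriv.1 hs).2
  have h2 : ContDiff ℝ ∞ (deriv (deriv χ)) := (contDiff_infty_iff_deriv.1 h1).2
  have hc : HasCompactSupport χ := χ.hasCompactSupport
  obtain ⟨C₁, hC₁⟩ := h1.continuous.bounded_above_of_compact_support hc.deriv
  obtain ⟨C₂, hC₂⟩ := h2.continuous.bounded_above_of_compact_support hc.deriv.deriv
  refine ⟨max C₁ C₂, χ, (norm_nonneg _).trans ((hC₁ 0).trans (le_max_left _ _)), hs, fun x hx => ?_,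
    ?_, fun x => ?_, fun x => (hC₁ x).trans (le_max_left _ _),
    fun x => (hC₂ x).trans (le_max_right _ _)⟩
  · exact χ.one_of_mem_closedBall (by simpa using hx)
  · rw [χ.tsupport_eq, Real.closedBall_eq_Icc, zero_sub, zero_add]
  · rw [abs_of_nonneg χ.nonneg]; exact χ.le_one

variable {δ C : ℝ} {χ : ℝ → ℝ}

theorem IsCutoff.deriv_eq_zero (h : IsCutoff δ C χ) {x : ℝ} (hx : |x| < δ / 3) :
    deriv χ x = 0 ∧ deriv (deriv χ) x = 0 := by
  have h1 : χ =ᶠ[𝓝 x] fun _ => 1 := by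
    filter_upwards [continuous_abs.continuousAt.eventually (gt_mem_nhds hx)] with y hy
    exact h.eq_one y (le_of_lt hy)
  have h2 : deriv χ =ᶠ[𝓝 x] fun _ => 0 := by
    simpa using h1.deriv
  exact ⟨h2.eq_of_nhds, by simpa using h2.deriv_eq⟩

end Cutoff

section Localized

/-- The function `A(s - s₀) B(t) p(σ, τ) e^{-τ - ασ²/2}` of the boundary coordinates `s`, `t`, with
`s = s₀ + εσ` and `t = ε⁴τ`. -/
def cutEv (α s₀ ε : ℝ) (A B : ℝ → ℝ) (p : Poly2) (x : ℝ × ℝ) : ℝ :=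
  A (x.1 - s₀) * B x.2 * ev α p ((x.1 - s₀) / ε) (x.2 / ε ^ 4)

variable {α s₀ ε : ℝ} {A B : ℝ → ℝ}

theorem contDiff_cutEv (hA : ContDiff ℝ ∞ A) (hB : ContDiff ℝ ∞ B) (p : Poly2) :
    ContDiff ℝ ∞ (cutEv α s₀ ε A B p) := by
  have h1 : ContDiff ℝ ∞ fun x : ℝ × ℝ => x.1 - s₀ := contDiff_fst.sub contDiff_const
  have h2 : ContDiff ℝ ∞ fun x : ℝ × ℝ => ((x.1 - s₀) / ε, x.2 / ε ^ 4) :=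
    (h1.div_const _).prodMk (contDiff_snd.div_const _)
  have h3 := (contDiff_ev α p).comp h2
  simp only [Function.comp_def] at h3
  have h4 : ContDiff ℝ ∞ fun x : ℝ × ℝ => A (x.1 - s₀) := hA.comp h1
  have h5 : ContDiff ℝ ∞ fun x : ℝ × ℝ => B x.2 := hB.comp contDiff_snd
  exact (h4.mul h5).mul h3

theorem hasDerivAt_cutEv_fst (hA : ContDiff ℝ ∞ A) (B : ℝ → ℝ) (p : Poly2) (s t : ℝ) :
    HasDerivAt (fun s => cutEv α s₀ ε A B p (s, t))
      (cutEv α s₀ ε (deriv A) B p (s, t) + ε⁻¹ * cutEv α s₀ ε A B (polyS α p) (s, t)) s := by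
  have h0 : HasDerivAt (fun s : ℝ => s - s₀) 1 s := (hasDerivAt_id s).sub_const _
  have h1 := ((hA.differentiable (by simp)) (s - s₀)).hasDerivAt.comp s h0
  have h2 := (hasDerivAt_ev_fst α p ((s - s₀) / ε) (t / ε ^ 4)).comp s (h0.div_const ε)
  refine ((h1.mul_const (B t)).fun_mul h2).congr_deriv ?_
  simp only [cutEv, Function.comp_apply]
  ring

theorem hasDerivAt_cutEv_snd (A : ℝ → ℝ) (hB : ContDiff ℝ ∞ B) (p : Poly2) (s t : ℝ) :
    HasDerivAt (fun t => cutEv α s₀ ε A B p (s, t))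
      (cutEv α s₀ ε A (deriv B) p (s, t) + (ε ^ 4)⁻¹ * cutEv α s₀ ε A B (polyT p) (s, t)) t := by
  have h1 := ((hB.differentiable (by simp)) t).hasDerivAt
  have h2 := (hasDerivAt_ev_snd α p ((s - s₀) / ε) (t / ε ^ 4)).comp t
    ((hasDerivAt_id t).div_const (ε ^ 4))
  refine ((h1.const_mul (A (s - s₀))).fun_mul h2).congr_deriv ?_
  simp only [cutEv, Function.comp_apply, id]
  ring

theorem dFst_cutEv (hA : ContDiff ℝ ∞ A) (hB : ContDiff ℝ ∞ B) (p : Poly2) :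
    dFst (cutEv α s₀ ε A B p) = fun x =>
      cutEv α s₀ ε (deriv A) B p x + ε⁻¹ * cutEv α s₀ ε A B (polyS α p) x :=
  funext fun x => (hasDerivAt_dFst ((contDiff_cutEv hA hB p).differentiable (by simp)) x).unique
    (hasDerivAt_cutEv_fst hA B p x.1 x.2)

theorem dSnd_cutEv (hA : ContDiff ℝ ∞ A) (hB : ContDiff ℝ ∞ B) (p : Poly2) :
    dSnd (cutEv α s₀ ε A B p) = fun x =>
      cutEv α s₀ ε A (deriv B) p x + (ε ^ 4)⁻¹ * cutEv α s₀ ε A B (polyT p) x :=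
  funext fun x => (hasDerivAt_dSnd ((contDiff_cutEv hA hB p).differentiable (by simp)) x).unique
    (hasDerivAt_cutEv_snd A hB p x.1 x.2)

theorem IsCutoff.tsupport_cutEv {δ C : ℝ} {χ : ℝ → ℝ} (hχ : IsCutoff δ C χ) (p : Poly2) :
    tsupport (cutEv α s₀ ε χ χ p)
      ⊆ Icc (s₀ - 2 * δ / 3) (s₀ + 2 * δ / 3) ×ˢ Icc (-(2 * δ / 3)) (2 * δ / 3) := by
  refine closure_minimal (fun x hx => ?_) (isClosed_Icc.prod isClosed_Icc)
  have h1 : χ (x.1 - s₀) ≠ 0 := fun h => hx (by simp [cutEv, h])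
  have h2 : χ x.2 ≠ 0 := fun h => hx (by simp [cutEv, h])
  obtain ⟨h3, h4⟩ := hχ.tsupport_subset (subset_tsupport χ h1)
  exact ⟨⟨by linarith, by linarith⟩, hχ.tsupport_subset (subset_tsupport χ h2)⟩

theorem IsCutoff.hasCompactSupport_cutEv {δ C : ℝ} {χ : ℝ → ℝ} (hχ : IsCutoff δ C χ)
    (p : Poly2) : HasCompactSupport (cutEv α s₀ ε χ χ p) :=
  (isCompact_Icc.prod isCompact_Icc).of_isClosed_subset (isClosed_tsupport _) (hχ.tsupport_cutEv p)

theorem IsCutoff.tsupport_cutEv_subset_box {δ C : ℝ} {χ : ℝ → ℝ} (hχ : IsCutoff δ C χ)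
    (hδ : 0 < δ) (p : Poly2) :
    tsupport (cutEv α s₀ ε χ χ p) ⊆ BoundaryParam.box s₀ δ := fun x hx => by
  have := hχ.tsupport_cutEv p hx
  exact ⟨⟨by linarith [this.1.1], by linarith [this.1.2]⟩,
    by linarith [this.2.1], by linarith [this.2.2]⟩

theorem abs_cutEv_le {a b : ℝ} (hA : ∀ x, |A x| ≤ a)
    (hB : ∀ x, |B x| ≤ b) (p : Poly2) (x : ℝ × ℝ) :
    |cutEv α s₀ ε A B p x| ≤ a * b * |ev α p ((x.1 - s₀) / ε) (x.2 / ε ^ 4)| := by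
  rw [cutEv, abs_mul, abs_mul]
  have := (abs_nonneg _).trans (hA 0)
  gcongr
  · exact hA _
  · exact hB _

end Localized

namespace BoundaryParam

variable {Ω : Set Plane} {ι : Type} (Γ : BoundaryParam Ω ι) (i : ι)

/-- The terms of `𝓛_h W` in which a derivative falls on the cutoff functions. -/
def commutator (α s₀ ε : ℝ) (A B : ℝ → ℝ) (p : Poly2) (x : ℝ × ℝ) : ℝ :=
  x.2 * deriv (Γ.curvature i) x.1 * (Γ.tubeJac i x)⁻¹ ^ 3 * cutEv α s₀ ε (deriv A) B p x
    + (Γ.tubeJac i x)⁻¹ ^ 2 * (cutEv α s₀ ε (deriv (deriv A)) B p x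
      + 2 * ε⁻¹ * cutEv α s₀ ε (deriv A) B (polyS α p) x)
    - (Γ.tubeJac i x)⁻¹ * Γ.curvature i x.1 * cutEv α s₀ ε A (deriv B) p x
    + (cutEv α s₀ ε A (deriv (deriv B)) p x
      + 2 * (ε ^ 4)⁻¹ * cutEv α s₀ ε A (deriv B) (polyT p) x)

/-- With `h = ε⁸`, the residual of the cut-off function is the cut-off of the residual in the
rescaled coordinates, apart from the commutator terms. -/
theorem residual_cutEv {α s₀ ε : ℝ} (hε : 0 < ε) {A B : ℝ → ℝ} (hA : ContDiff ℝ ∞ A)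
    (hB : ContDiff ℝ ∞ B) (p : Poly2) (μ : ℝ) {x : ℝ × ℝ} (hx : Γ.tubeJac i x ≠ 0) :
    Γ.residual i (ε ^ 8) (ε ^ 8 * μ) (cutEv α s₀ ε A B p) x
      = ε ^ 8 * (A (x.1 - s₀) * B x.2 *
        (-ev α (polyT (polyT p)) ((x.1 - s₀) / ε) (x.2 / ε ^ 4)
        + coefT (Γ.curvature i) s₀ ε ((x.1 - s₀) / ε) (x.2 / ε ^ 4)
          * ev α (polyT p) ((x.1 - s₀) / ε) (x.2 / ε ^ 4)
        + coefSS (Γ.curvature i) s₀ ε ((x.1 - s₀) / ε) (x.2 / ε ^ 4)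
          * ev α (polyS α (polyS α p)) ((x.1 - s₀) / ε) (x.2 / ε ^ 4)
        + coefS (Γ.curvature i) s₀ ε ((x.1 - s₀) / ε) (x.2 / ε ^ 4)
          * ev α (polyS α p) ((x.1 - s₀) / ε) (x.2 / ε ^ 4)
        - μ * ev α p ((x.1 - s₀) / ε) (x.2 / ε ^ 4)))
      - ε ^ 16 * Γ.commutator i α s₀ ε A B p x := by
  obtain ⟨s, t⟩ := x
  have hκ := Γ.contDiff_curvature i
  have hA1 : ContDiff ℝ ∞ (deriv A) := (contDiff_infty_iff_deriv.1 hA).2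
  have hB1 : ContDiff ℝ ∞ (deriv B) := (contDiff_infty_iff_deriv.1 hB).2
  have e1 : s₀ + ε * ((s - s₀) / ε) = s := by field_simp; ring
  have e2 : ε ^ 4 * (t / ε ^ 4) = t := by field_simp
  have hjac : jac (Γ.curvature i) s₀ ε ((s - s₀) / ε) (t / ε ^ 4) = Γ.tubeJac i (s, t) := by
    rw [jac, e1, e2]; rfl
  have hinv : invJac (Γ.curvature i) s₀ (ε * ((s - s₀) / ε), ε ^ 4 * (t / ε ^ 4))
      = (Γ.tubeJac i (s, t))⁻¹ := by rw [invJac_rescale, hjac]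
  have e3 := coefS_eq s₀ hκ (hjac ▸ hx)
  rw [hinv, e1, e2] at e3
  have ha1 : HasDerivAt (fun s => Γ.tubeJac i (s, t)) (-(t * deriv (Γ.curvature i) s)) s :=
    (((hκ.differentiable (by simp)) s).hasDerivAt.const_mul t).const_sub 1
  have ha2 : HasDerivAt (fun t => Γ.tubeJac i (s, t)) (-Γ.curvature i s) t :=
    (((hasDerivAt_id t).mul_const (Γ.curvature i s)).const_sub 1).congr_deriv (by ring)
  have hW := contDiff_cutEv (α := α) (s₀ := s₀) (ε := ε) hA hB p
  have f1 := (hasDerivAt_cutEv_fst (α := α) (s₀ := s₀) (ε := ε) hA1 B p s t).fun_add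
    ((hasDerivAt_cutEv_fst (α := α) (s₀ := s₀) (ε := ε) hA B (polyS α p) s t).const_mul ε⁻¹)
  have f2 := (hasDerivAt_cutEv_snd (α := α) (s₀ := s₀) (ε := ε) A hB1 p s t).fun_add
    ((hasDerivAt_cutEv_snd (α := α) (s₀ := s₀) (ε := ε) A hB (polyT p) s t).const_mul (ε ^ 4)⁻¹)
  have hd : DifferentiableAt ℝ (Γ.fluxFst i (cutEv α s₀ ε A B p)) (s, t) :=
    (((Γ.contDiff_tubeJac i).contDiffAt.inv hx).mul
      (contDiff_dFst hW).contDiffAt).differentiableAt (by simp)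
  have hd' : HasDerivAt (fun s => Γ.fluxFst i (cutEv α s₀ ε A B p) (s, t))
      (dFst (Γ.fluxFst i (cutEv α s₀ ε A B p)) (s, t)) s :=
    hd.hasFDerivAt.comp_hasDerivAt (f := fun s : ℝ => (s, t)) s
      ((hasDerivAt_id _).prodMk (hasDerivAt_const _ _))
  have hd'' : HasDerivAt (fun t => Γ.fluxSnd i (cutEv α s₀ ε A B p) (s, t))
      (dSnd (Γ.fluxSnd i (cutEv α s₀ ε A B p)) (s, t)) t :=
    hasDerivAt_dSnd ((Γ.contDiff_fluxSnd i hW).differentiable (by simp)) (s, t)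
  simp only [fluxFst, fluxSnd, dFst_cutEv hA hB, dSnd_cutEv hA hB] at hd' hd''
  have d1 := hd'.unique ((ha1.fun_inv hx).fun_mul f1)
  have d2 := hd''.unique (ha2.fun_mul f2)
  rw [residual]
  rw [d1, d2, coefT_eq, coefSS_eq, e3, hinv, e1, commutator]
  simp only [cutEv]
  set a := Γ.tubeJac i (s, t)
  field_simp
  ring

end BoundaryParam

/-! ### The residual of the ansatz in boundary coordinates -/

namespace BoundaryParam

section ResidualBound

variable {Ω : Set Plane} {ι : Type} {Γ : BoundaryParam Ω ι} {i : ι}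

/-- The commutator terms live at distance at least `δ / 3` from the boundary point, where the
ansatz is smaller than any power of `ε`. -/
theorem IsPatch.exists_commutator_le {s₀ δ C : ℝ} {χ : ℝ → ℝ} (h : Γ.IsPatch i s₀ δ)
    (hC : 0 ≤ C) (hχ : IsCutoff δ C χ) {N : ℕ} (D : QuasimodeData (Γ.curvature i) s₀ N) (M : ℕ) :
    ∃ K, 0 < K ∧ ∀ (ε : ℝ) (x : ℝ × ℝ), 0 < ε → ε ≤ 1 → 0 ≤ x.2 → x ∈ box s₀ δ →
      ε ^ 16 * |Γ.commutator i D.α s₀ ε χ χ (D.ansatzPoly M ε) x|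
        ≤ K * ε ^ (16 + M)
          * Real.exp (-(x.2 / ε ^ 4) / 2 - D.α / 4 * ((x.1 - s₀) / ε) ^ 2) := by
  have hδ := h.pos
  have hκ := Γ.contDiff_curvature i
  have hκ1 : ContDiff ℝ ∞ (deriv (Γ.curvature i)) := (contDiff_infty_iff_deriv.1 hκ).2
  obtain ⟨K₀, hK₀⟩ := isCompact_Icc.exists_bound_of_continuousOn
    (s := Icc (s₀ - δ) (s₀ + δ)) hκ.continuous.continuousOn
  obtain ⟨K₁, hK₁⟩ := isCompact_Icc.exists_bound_of_continuousOn
    (s := Icc (s₀ - δ) (s₀ + δ)) hκ1.continuous.continuousOn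
  have hs₀ : s₀ ∈ Icc (s₀ - δ) (s₀ + δ) := ⟨by linarith, by linarith⟩
  have hK₀0 : 0 ≤ K₀ := (norm_nonneg _).trans (hK₀ s₀ hs₀)
  have hK₁0 : 0 ≤ K₁ := (norm_nonneg _).trans (hK₁ s₀ hs₀)
  obtain ⟨C₀, hC₀, h0⟩ := D.exists_pow_mul_ev_ansatz_le M (8 + M) LinearMap.id
  obtain ⟨C₁, hC₁, h1⟩ := D.exists_pow_mul_ev_ansatz_le M (8 + M) (polyS D.α)
  obtain ⟨C₂, hC₂, h2⟩ := D.exists_pow_mul_ev_ansatz_le M (8 + M) polyT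
  set C' := C₀ + C₁ + C₂ with hC'
  refine ⟨(8 * δ * K₁ + 2 * K₀ + 15) * ((C + 1) * (C' * (3 / δ) ^ (8 + M))), by positivity,
    fun ε x hε hε1 hx2 hx => ?_⟩
  obtain ⟨⟨hs1, hs2⟩, ht1, ht2⟩ := hx
  have hx : x ∈ box s₀ δ := ⟨⟨hs1, hs2⟩, ht1, ht2⟩
  set P := D.ansatzPoly M ε with hP
  set σ := (x.1 - s₀) / ε with hσ
  set τ := x.2 / ε ^ 4 with hτ
  have hτ0 : 0 ≤ τ := by positivity
  set w := Real.exp (-τ / 2 - D.α / 4 * σ ^ 2) with hw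
  -- Near the boundary point the cutoff functions are constant.
  by_cases hin : |x.1 - s₀| < δ / 3 ∧ |x.2| < δ / 3
  · obtain ⟨z1, z2⟩ := hχ.deriv_eq_zero hin.1
    obtain ⟨z3, z4⟩ := hχ.deriv_eq_zero hin.2
    have : Γ.commutator i D.α s₀ ε χ χ P x = 0 := by
      simp [commutator, cutEv, z1, z2, z3, z4]
    rw [this, abs_zero, mul_zero]; positivity
  -- Elsewhere the rescaled coordinates are at least of order `ε⁻¹`, and powers of them are absorbed
  -- by the ansatz.
  have hfar : δ / (3 * ε) ≤ 1 + |σ| + |τ| := by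
    have hσa : |σ| = |x.1 - s₀| / ε := by rw [hσ, abs_div, abs_of_pos hε]
    have hτa : |τ| = |x.2| / ε ^ 4 := by rw [hτ, abs_div, abs_of_pos (by positivity : 0 < ε ^ 4)]
    have e : δ / (3 * ε) = δ / 3 / ε := by field_simp
    rw [not_and_or, not_lt, not_lt] at hin
    rcases hin with hin | hin
    · have : δ / (3 * ε) ≤ |σ| := by rw [hσa, e]; gcongr
      have := abs_nonneg τ
      linarith
    · have : δ / (3 * ε) ≤ |τ| := by
        rw [hτa, e]
        gcongr
        exact pow_le_of_le_one hε.le hε1 (by norm_num)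
      have := abs_nonneg σ
      linarith
  have hsmall : ∀ e c : ℝ, 0 < c → c ≤ C' → (1 + |σ| + |τ|) ^ (8 + M) * |e| ≤ c * w →
      |e| ≤ C' * (3 / δ) ^ (8 + M) * ε ^ (8 + M) * w := fun e c hc hcC he => by
    have hpos : 0 < (δ / (3 * ε)) ^ (8 + M) := by positivity
    have h3 : (δ / (3 * ε)) ^ (8 + M) * |e| ≤ C' * w :=
      (mul_le_mul_of_nonneg_right (pow_le_pow_left₀ (by positivity) hfar _) (abs_nonneg _)).trans
        (he.trans (by gcongr))
    rw [← le_div_iff₀' hpos] at h3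
    refine h3.trans_eq ?_
    rw [div_pow, div_pow, mul_pow]
    field_simp
  set b := (C + 1) * (C' * (3 / δ) ^ (8 + M) * ε ^ (8 + M) * w) with hb
  have hb0 : 0 ≤ b := by positivity
  have f0 := hsmall _ C₀ hC₀ (by rw [hC']; linarith) (h0 ε σ τ hε hε1 hτ0)
  have f1 := hsmall _ C₁ hC₁ (by rw [hC']; linarith) (h1 ε σ τ hε hε1 hτ0)
  have f2 := hsmall _ C₂ hC₂ (by rw [hC']; linarith) (h2 ε σ τ hε hε1 hτ0)
  rw [LinearMap.id_apply] at f0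
  have hcut : ∀ (A B : ℝ → ℝ) (p : Poly2), ((∀ y, |A y| ≤ C) ∧ ∀ y, |B y| ≤ 1) ∨
      ((∀ y, |A y| ≤ 1) ∧ ∀ y, |B y| ≤ C) →
      |ev D.α p σ τ| ≤ C' * (3 / δ) ^ (8 + M) * ε ^ (8 + M) * w → |cutEv D.α s₀ ε A B p x| ≤ b := by
    intro A B p hAB he
    have h3 : |cutEv D.α s₀ ε A B p x| ≤ C * |ev D.α p σ τ| := by
      rcases hAB with ⟨hA, hB⟩ | ⟨hA, hB⟩
      · simpa using abs_cutEv_le (α := D.α) (s₀ := s₀) (ε := ε) hA hB p x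
      · simpa using abs_cutEv_le (α := D.α) (s₀ := s₀) (ε := ε) hA hB p x
    exact h3.trans (by rw [hb]; gcongr; linarith)
  have t1 := hcut (deriv χ) χ P (.inl ⟨hχ.abs_deriv_le, hχ.abs_le_one⟩) f0
  have t2 := hcut (deriv (deriv χ)) χ P (.inl ⟨hχ.abs_deriv_two_le, hχ.abs_le_one⟩) f0
  have t3 := hcut (deriv χ) χ (polyS D.α P) (.inl ⟨hχ.abs_deriv_le, hχ.abs_le_one⟩) f1
  have t4 := hcut χ (deriv χ) P (.inr ⟨hχ.abs_le_one, hχ.abs_deriv_le⟩) f0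
  have t5 := hcut χ (deriv (deriv χ)) P (.inr ⟨hχ.abs_le_one, hχ.abs_deriv_two_le⟩) f0
  have t6 := hcut χ (deriv χ) (polyT P) (.inr ⟨hχ.abs_le_one, hχ.abs_deriv_le⟩) f2
  have ha := h.tubeJac_pos hx
  have hinv : (Γ.tubeJac i x)⁻¹ ≤ 2 := by
    have := (h.jac_mem x hx).1
    rw [inv_le_comm₀ ha (by norm_num)]; linarith
  have hinv0 : 0 ≤ (Γ.tubeJac i x)⁻¹ := (inv_pos.2 ha).le
  have hκx := hK₀ x.1 ⟨hs1.le, hs2.le⟩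
  have hκx1 := hK₁ x.1 ⟨hs1.le, hs2.le⟩
  rw [Real.norm_eq_abs] at hκx hκx1
  -- Each derivative of the ansatz costs at most `ε⁻⁴`, and `ε^{8+M}` is gained from the decay; this
  -- leaves the power `16 + M`.
  have hε16 : ε ^ 16 ≤ ε ^ 8 := pow_le_pow_of_le_one hε.le hε1 (by norm_num)
  have hε15 : ε ^ 16 * ε⁻¹ ≤ ε ^ 8 := by
    rw [show ε ^ 16 * ε⁻¹ = ε ^ 15 by field_simp]
    exact pow_le_pow_of_le_one hε.le hε1 (by norm_num)
  have hε12 : ε ^ 16 * (ε ^ 4)⁻¹ ≤ ε ^ 8 := by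
    rw [show ε ^ 16 * (ε ^ 4)⁻¹ = ε ^ 12 by field_simp]
    exact pow_le_pow_of_le_one hε.le hε1 (by norm_num)
  have u : ∀ (c y k : ℝ), |c| ≤ k → |y| ≤ b → |c * y| ≤ k * b := fun c y k hc hy => by
    rw [abs_mul]; exact mul_le_mul hc hy (abs_nonneg _) ((abs_nonneg _).trans hc)
  have u1 := u (ε ^ 16 * (x.2 * deriv (Γ.curvature i) x.1 * (Γ.tubeJac i x)⁻¹ ^ 3)) _
    (ε ^ 8 * (δ * K₁ * 2 ^ 3)) (by
      rw [abs_mul, abs_mul, abs_mul, abs_of_nonneg hx2, abs_of_nonneg (by positivity : 0 ≤ ε ^ 16),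
        abs_of_nonneg (pow_nonneg hinv0 3)]
      gcongr) t1
  have u2 := u (ε ^ 16 * (Γ.tubeJac i x)⁻¹ ^ 2) _ (ε ^ 8 * 2 ^ 2) (by
      rw [abs_of_nonneg (by positivity)]; gcongr) t2
  have u3 := u ((ε ^ 16 * ε⁻¹) * (2 * (Γ.tubeJac i x)⁻¹ ^ 2)) _ (ε ^ 8 * (2 * 2 ^ 2)) (by
      rw [abs_of_nonneg (by positivity)]; gcongr) t3
  have u4 := u (ε ^ 16 * ((Γ.tubeJac i x)⁻¹ * Γ.curvature i x.1)) _ (ε ^ 8 * (2 * K₀)) (by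
      rw [abs_mul, abs_mul, abs_of_nonneg hinv0, abs_of_nonneg (by positivity : 0 ≤ ε ^ 16)]
      gcongr) t4
  have u5 := u (ε ^ 16) _ (ε ^ 8) (by rw [abs_of_nonneg (by positivity)]; exact hε16) t5
  have u6 := u ((ε ^ 16 * (ε ^ 4)⁻¹) * 2) _ (ε ^ 8 * 2) (by
      rw [abs_of_nonneg (by positivity)]; gcongr) t6
  have e1 : ε ^ 16 * |Γ.commutator i D.α s₀ ε χ χ P x|
      = |ε ^ 16 * Γ.commutator i D.α s₀ ε χ χ P x| := by
    rw [abs_mul, abs_of_pos (by positivity : 0 < ε ^ 16)]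
  have e2 : (8 * δ * K₁ + 2 * K₀ + 15) * ((C + 1) * (C' * (3 / δ) ^ (8 + M))) * ε ^ (16 + M) * w
      = ε ^ 8 * (8 * δ * K₁ + 2 * K₀ + 15) * b := by
    rw [hb, show 16 + M = 8 + (8 + M) by omega, pow_add ε 8 (8 + M)]; ring
  rw [e1, e2, commutator, abs_le]
  rw [abs_le] at u1 u2 u3 u4 u5 u6
  constructor <;> linarith

/-- The cut-off ansatz solves the eigenvalue equation of `𝓛_h` in the boundary coordinates up to an
error `O(ε^{16+M})`, relative to a Gaussian weight; `ε^8` of it is due to the factor `h` in `𝓛_h = h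
(h⁻¹ 𝓛_h)`. -/
theorem exists_isPatch_residual_le [Finite ι] (hΩ : IsOpen Ω) {s₀ : ℝ} {N : ℕ}
    (D : QuasimodeData (Γ.curvature i) s₀ N) (M : ℕ) :
    ∃ (δ C : ℝ) (χ : ℝ → ℝ), Γ.IsPatch i s₀ δ ∧ IsCutoff δ C χ ∧ ∃ K, 0 < K ∧
      ∀ (ε : ℝ) (x : ℝ × ℝ), 0 < ε → ε ≤ 1 → 0 ≤ x.2 →
        |Γ.residual i (ε ^ 8) (ε ^ 8 * D.quasi M ε)
            (cutEv D.α s₀ ε χ χ (D.ansatzPoly M ε)) x|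
          ≤ K * ε ^ (16 + M)
            * Real.exp (-(x.2 / ε ^ 4) / 2 - D.α / 4 * ((x.1 - s₀) / ε) ^ 2) := by
  obtain ⟨δ₁, h₁⟩ := Γ.exists_isPatch (i := i) hΩ s₀
  obtain ⟨δ₂, hδ₂, C₂, hC₂, hres⟩ := D.exists_full_residual_le M
  have hδ : 0 < min δ₁ δ₂ := lt_min h₁.pos hδ₂
  have h := h₁.mono hδ (min_le_left _ _)
  have hδle : min δ₁ δ₂ ≤ δ₂ := min_le_right _ _
  set δ := min δ₁ δ₂
  obtain ⟨C, χ, hC, hχ⟩ := exists_isCutoff hδ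
  obtain ⟨K, hK, hcom⟩ := h.exists_commutator_le hC hχ D M
  refine ⟨δ, C, χ, h, hχ, C₂ + K, by positivity, fun ε x hε hε1 hx2 => ?_⟩
  by_cases hx : x ∈ box s₀ δ
  · have hr := hres ε ((x.1 - s₀) / ε) (x.2 / ε ^ 4) hε hε1 (by positivity)
      (by
        rw [show ε * ((x.1 - s₀) / ε) = x.1 - s₀ by field_simp]
        have := hx.1.1
        have := hx.1.2
        rw [abs_lt]; constructor <;> linarith)
      (by
        rw [show ε ^ 4 * (x.2 / ε ^ 4) = x.2 by field_simp]
        exact hx.2.2.trans_le hδle)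
    have hc := hcom ε x hε hε1 hx2 hx
    rw [Γ.residual_cutEv i hε hχ.smooth hχ.smooth _ _ (h.tubeJac_pos hx).ne']
    refine (abs_sub _ _).trans ?_
    rw [abs_mul, abs_mul, abs_mul, abs_mul, abs_of_pos (by positivity : 0 < ε ^ 8),
      abs_of_pos (by positivity : 0 < ε ^ 16)]
    have hXY : |χ (x.1 - s₀)| * |χ x.2| ≤ 1 :=
      mul_le_one₀ (hχ.abs_le_one _) (abs_nonneg _) (hχ.abs_le_one _)
    have h1 := mul_le_mul_of_nonneg_left ((mul_le_of_le_one_left (abs_nonneg _) hXY).trans hr)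
      (by positivity : 0 ≤ ε ^ 8)
    refine (add_le_add h1 hc).trans_eq ?_
    rw [show 16 + M = 8 + (8 + M) by omega, pow_add ε 8 (8 + M)]; ring
  · have h0 : Γ.residual i (ε ^ 8) (ε ^ 8 * D.quasi M ε)
        (cutEv D.α s₀ ε χ χ (D.ansatzPoly M ε)) x = 0 := by
      refine image_eq_zero_of_notMem_tsupport fun hx' => hx ?_
      exact hχ.tsupport_cutEv_subset_box hδ _ (Γ.tsupport_residual i _ _ _ hx')
    rw [h0, abs_zero]; positivity

end ResidualBound

end BoundaryParam

/-! ### Norms of functions near a boundary point -/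

section Norms

/-- The Gaussian weight in the rescaled coordinates has mass of order `ε⁵`. -/
theorem integral_rescaled_weight {c ε : ℝ} (hc : 0 < c) (hε : 0 < ε) (s₀ : ℝ) :
    IntegrableOn (fun x : ℝ × ℝ => Real.exp (-(x.2 / ε ^ 4) - c * ((x.1 - s₀) / ε) ^ 2))
      {x : ℝ × ℝ | 0 < x.2} ∧
    ∫ x in {x : ℝ × ℝ | 0 < x.2}, Real.exp (-(x.2 / ε ^ 4) - c * ((x.1 - s₀) / ε) ^ 2)
      = ε ^ 5 * √(Real.pi / c) := by
  have hε4 : -(ε ^ 4)⁻¹ < 0 := neg_lt_zero.2 (by positivity)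
  have h1 : Integrable (fun s : ℝ => Real.exp (-c * ((s - s₀) / ε) ^ 2)) :=
    ((integrable_exp_neg_mul_sq hc).comp_div hε.ne').comp_sub_right s₀
  have h2 := integrableOn_exp_mul_Ioi hε4 0
  have e1 : ∫ s : ℝ, Real.exp (-c * ((s - s₀) / ε) ^ 2) = ε * √(Real.pi / c) := by
    rw [integral_sub_right_eq_self (fun s : ℝ => Real.exp (-c * (s / ε) ^ 2)) s₀,
      Measure.integral_comp_div (fun s : ℝ => Real.exp (-c * s ^ 2)), integral_gaussian,
      abs_of_pos hε, smul_eq_mul]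
  have e2 : ∫ t in Ioi (0 : ℝ), Real.exp (-(ε ^ 4)⁻¹ * t) = ε ^ 4 := by
    rw [integral_exp_mul_Ioi hε4]; simp
  have e3 : (fun x : ℝ × ℝ => Real.exp (-(x.2 / ε ^ 4) - c * ((x.1 - s₀) / ε) ^ 2))
      = fun x : ℝ × ℝ => Real.exp (-c * ((x.1 - s₀) / ε) ^ 2) * Real.exp (-(ε ^ 4)⁻¹ * x.2) := by
    funext x
    rw [← Real.exp_add]; congr 1; ring
  constructor
  · have := h1.mul_prod h2.integrable
    rw [prod_restrict_Ioi] at this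
    rw [e3]; exact this
  · rw [e3, ← prod_restrict_Ioi, integral_prod_mul (fun s : ℝ => Real.exp (-c * ((s - s₀) / ε) ^ 2))
      (fun t : ℝ => Real.exp (-(ε ^ 4)⁻¹ * t)), e1, e2]
    ring

namespace BoundaryParam

variable {Ω : Set Plane} {ι : Type} {Γ : BoundaryParam Ω ι} {i : ι} {s₀ δ : ℝ}

/-- The `L²` norm of a function given near a boundary point. -/
theorem IsPatch.integral_norm_pushR_sq (h : Γ.IsPatch i s₀ δ) (hΩ : IsOpen Ω) {W : ℝ × ℝ → ℝ}
    (hWs : tsupport W ⊆ box s₀ δ) :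
    ∫ x in Ω, ‖Γ.pushR i s₀ δ W x‖ ^ 2
      = ∫ p in {p : ℝ × ℝ | 0 < p.2}, Γ.tubeJac i p * W p ^ 2 := by
  have hW0 : ∀ p ∉ box s₀ δ, W p = 0 := fun p hp =>
    image_eq_zero_of_notMem_tsupport fun hp' => hp (hWs hp')
  refine h.setIntegral_eq hΩ (fun x hx => ?_) (fun p hp => ?_) fun p hp => ?_
  · rw [pushR, Γ.push_of_notMem i hx]; simp
  · rw [hW0 p hp]; simp
  · rw [pushR, h.push_tube _ hp, smul_eq_mul, Complex.norm_real, Real.norm_eq_abs, sq_abs]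

theorem integrable_tubeJac_mul_sq {W : ℝ × ℝ → ℝ} (hW : ContDiff ℝ ∞ W)
    (hWc : HasCompactSupport W) : Integrable fun p => Γ.tubeJac i p * W p ^ 2 := by
  have h1 : Continuous fun p => Γ.tubeJac i p * W p ^ 2 :=
    (Γ.contDiff_tubeJac i).continuous.mul (hW.continuous.pow 2)
  exact h1.integrable_of_hasCompactSupport
    (hWc.comp_left (g := fun y : ℝ => y ^ 2) (by simp)).mul_left

/-- The `L²` norm of a function that is bounded by the Gaussian weight in the rescaled coordinates.
-/
theorem IsPatch.integral_norm_pushR_sq_le (h : Γ.IsPatch i s₀ δ) (hΩ : IsOpen Ω) {W : ℝ × ℝ → ℝ}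
    (hW : ContDiff ℝ ∞ W) (hWc : HasCompactSupport W) (hWs : tsupport W ⊆ box s₀ δ)
    {α ε B : ℝ} (hα : 0 < α) (hε : 0 < ε)
    (hB : ∀ x : ℝ × ℝ, 0 ≤ x.2 →
      |W x| ≤ B * Real.exp (-(x.2 / ε ^ 4) / 2 - α / 4 * ((x.1 - s₀) / ε) ^ 2)) :
    ∫ x in Ω, ‖Γ.pushR i s₀ δ W x‖ ^ 2 ≤ 2 * B ^ 2 * (ε ^ 5 * √(Real.pi / (α / 2))) := by
  have hW0 : ∀ p ∉ box s₀ δ, W p = 0 := fun p hp =>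
    image_eq_zero_of_notMem_tsupport fun hp' => hp (hWs hp')
  obtain ⟨i1, e1⟩ := integral_rescaled_weight (c := α / 2) (by positivity) hε s₀
  rw [h.integral_norm_pushR_sq hΩ hWs, ← e1, ← integral_const_mul]
  refine setIntegral_mono_on (integrable_tubeJac_mul_sq hW hWc).integrableOn (i1.const_mul _)
    (measurableSet_lt measurable_const measurable_snd) fun p hp => ?_
  have hp : 0 < p.2 := hp
  by_cases hpb : p ∈ box s₀ δ
  · have h1 := pow_le_pow_left₀ (abs_nonneg _) (hB p hp.le) 2
    rw [sq_abs, mul_pow, ← Real.exp_nat_mul] at h1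
    calc Γ.tubeJac i p * W p ^ 2 ≤ 2 * _ :=
          mul_le_mul (h.jac_mem p hpb).2 h1 (sq_nonneg _) (by norm_num)
      _ = _ := by
          rw [mul_assoc]; congr 3; push_cast; ring
  · rw [hW0 p hpb]
    simp only [ne_eq, OfNat.ofNat_ne_zero, not_false_eq_true, zero_pow, mul_zero]
    positivity

end BoundaryParam

namespace QuasimodeData

variable {κ : ℝ → ℝ} {s₀ : ℝ} {N : ℕ} (D : QuasimodeData κ s₀ N)

/-- All coefficients of the ansatz have vanishing normal derivative at the boundary, apart from the
weight. -/
theorem eval_pderiv_ansatzPoly (M : ℕ) (ε σ : ℝ) :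
    MvPolynomial.eval ![σ, 0] (MvPolynomial.pderiv 1 (D.ansatzPoly M ε)) = 0 := by
  rw [ansatzPoly, map_sum, map_sum]
  refine Finset.sum_eq_zero fun b _ => ?_
  rw [Derivation.map_smul, MvPolynomial.smul_eval, ansatzCoef, map_add, pderiv_one_embS, zero_add]
  split_ifs
  · rw [D.robin, mul_zero]
  · simp

/-- The ansatz satisfies the Robin condition exactly, so that no boundary term is left in the weak
form. -/
theorem ev_polyT_ansatzPoly (M : ℕ) (ε σ : ℝ) :
    ev D.α (polyT (D.ansatzPoly M ε)) σ 0 = -ev D.α (D.ansatzPoly M ε) σ 0 := by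
  rw [polyT_apply, ev_sub, ev, eval_pderiv_ansatzPoly]; ring

theorem V_zero_ne_zero : D.V 0 ≠ 0 := fun h => by
  have := D.normalized
  rw [h] at this
  simp at this

theorem ansatzPoly_zero (M : ℕ) : D.ansatzPoly M 0 = embS (D.V 0) := by
  rw [ansatzPoly, Finset.sum_eq_single 0]
  · simp [ansatzCoef]
  · intro b _ hb; simp [hb]
  · intro h; simp at h

theorem continuous_ev_ansatzPoly (M : ℕ) :
    Continuous fun x : ℝ × ℝ × ℝ => ev D.α (D.ansatzPoly M x.1) x.2.1 x.2.2 := by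
  simp only [ansatzPoly, ev_sum, ev_smul]
  refine continuous_finsetSum _ fun b _ => (continuous_fst.pow b).mul ?_
  exact (contDiff_ev D.α (D.ansatzCoef M b)).continuous.comp continuous_snd

/-- Near a point where the leading term does not vanish, the ansatz stays away from zero. -/
theorem exists_lt_abs_ev_ansatzPoly (M : ℕ) : ∃ (σ₁ c r : ℝ), 0 < c ∧ 0 < r ∧ r ≤ 1 / 2 ∧
    ∀ ε σ τ : ℝ, 0 < ε → ε < r → |σ - σ₁| < r → |τ - 1| < r →
      c < |ev D.α (D.ansatzPoly M ε) σ τ| := by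
  obtain ⟨σ₁, hσ₁⟩ : ∃ σ₁, (D.V 0).eval σ₁ ≠ 0 := by
    by_contra! hne
    exact D.V_zero_ne_zero (Polynomial.funext fun σ => by simpa using hne σ)
  have h0 : ev D.α (D.ansatzPoly M 0) σ₁ 1 ≠ 0 := by
    rw [ansatzPoly_zero, ev, eval_embS]
    exact mul_ne_zero hσ₁ (Real.exp_ne_zero _)
  set c := |ev D.α (D.ansatzPoly M 0) σ₁ 1| / 2 with hc
  have hcpos : 0 < c := half_pos (abs_pos.2 h0)
  have hcont := (D.continuous_ev_ansatzPoly M).abs.continuousAt (x := ((0 : ℝ), σ₁, (1 : ℝ)))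
  have hev := hcont.eventually (lt_mem_nhds (half_lt_self (abs_pos.2 h0)))
  obtain ⟨r, hr, hball⟩ := Metric.eventually_nhds_iff.1 hev
  refine ⟨σ₁, c, min r (1 / 2), hcpos, lt_min hr (by norm_num), min_le_right _ _,
    fun ε σ τ hε hεr hσ hτ => hball (y := (ε, σ, τ)) ?_⟩
  rw [Prod.dist_eq, Prod.dist_eq, max_lt_iff, max_lt_iff, Real.dist_eq, Real.dist_eq, Real.dist_eq,
    sub_zero, abs_of_pos hε]
  exact ⟨hεr.trans_le (min_le_left _ _), hσ.trans_le (min_le_left _ _),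
    hτ.trans_le (min_le_left _ _)⟩

end QuasimodeData

end Norms

/-! ### The approximate eigenfunction in the plane -/

namespace BoundaryParam

section Existence

variable {Ω : Set Plane} {ι : Type} {Γ : BoundaryParam Ω ι} {i : ι} {s₀ δ : ℝ}

/-- The norm of the quasimode is at least of the order of the rescaled area, `ε · ε⁴`, since the
ansatz is bounded away from zero on a fixed square in the rescaled coordinates. -/
theorem IsPatch.exists_le_integral_norm_pushR_sq (h : Γ.IsPatch i s₀ δ) (hΩ : IsOpen Ω) {C : ℝ}
    {χ : ℝ → ℝ} (hχ : IsCutoff δ C χ) {κ : ℝ → ℝ} {N : ℕ} (D : QuasimodeData κ s₀ N) (M : ℕ) :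
    ∃ c > 0, ∃ ε₀ > 0, ∀ ε : ℝ, 0 < ε → ε < ε₀ →
      c * ε ^ 5
        ≤ ∫ x in Ω, ‖Γ.pushR i s₀ δ (cutEv D.α s₀ ε χ χ (D.ansatzPoly M ε)) x‖ ^ 2 := by
  obtain ⟨σ₁, c, r, hc, hr, hr1, hlow⟩ := D.exists_lt_abs_ev_ansatzPoly M
  have hδ := h.pos
  refine ⟨1 / 2 * c ^ 2 * (4 * r ^ 2), by positivity,
    min (min r 1) (δ / (3 * (|σ₁| + 2))), by positivity, fun ε hε hε₀ => ?_⟩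
  obtain ⟨hε1, hε2⟩ := lt_min_iff.1 hε₀
  obtain ⟨hεr, hε1⟩ := lt_min_iff.1 hε1
  have hεδ : ε * (|σ₁| + 2) ≤ δ / 3 := by
    rw [lt_div_iff₀ (by positivity)] at hε2
    linarith
  set P := D.ansatzPoly M ε
  set W := cutEv D.α s₀ ε χ χ P with hWdef
  have hW : ContDiff ℝ ∞ W := contDiff_cutEv hχ.smooth hχ.smooth P
  have hWc : HasCompactSupport W := hχ.hasCompactSupport_cutEv P
  have hWs : tsupport W ⊆ box s₀ δ := hχ.tsupport_cutEv_subset_box hδ P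
  rw [h.integral_norm_pushR_sq hΩ hWs]
  -- the rescaled square of side `2r` about the point `(σ₁, 1)`
  set K : Set (ℝ × ℝ) := Ioo (s₀ + ε * (σ₁ - r)) (s₀ + ε * (σ₁ + r))
    ×ˢ Ioo (ε ^ 4 * (1 - r)) (ε ^ 4 * (1 + r)) with hK
  have hKm : MeasurableSet K := measurableSet_Ioo.prod measurableSet_Ioo
  have hvol : volume.real K = 4 * r ^ 2 * ε ^ 5 := by
    rw [hK, Measure.volume_eq_prod, measureReal_prod_prod, Real.volume_real_Ioo_of_le,
      Real.volume_real_Ioo_of_le]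
    · ring
    · gcongr; linarith
    · gcongr; linarith
  have hfin : volume K ≠ ⊤ := by
    rw [hK, Measure.volume_eq_prod, Measure.prod_prod, Real.volume_Ioo, Real.volume_Ioo]
    exact ENNReal.mul_ne_top ENNReal.ofReal_ne_top ENNReal.ofReal_ne_top
  have hKS : K ⊆ {p : ℝ × ℝ | 0 < p.2} := fun p hp => by
    have h1 : 0 ≤ ε ^ 4 * (1 - r) := mul_nonneg (by positivity) (by linarith)
    exact h1.trans_lt hp.2.1
  have hint := integrable_tubeJac_mul_sq (Γ := Γ) (i := i) hW hWc
  have hW0 : ∀ p ∉ box s₀ δ, W p = 0 := fun p hp =>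
    image_eq_zero_of_notMem_tsupport fun hp' => hp (hWs hp')
  have hnn : ∀ p, 0 ≤ Γ.tubeJac i p * W p ^ 2 := fun p => by
    by_cases hp : p ∈ box s₀ δ
    · exact mul_nonneg (h.tubeJac_pos hp).le (sq_nonneg _)
    · rw [hW0 p hp]; simp
  have hpt : ∀ p ∈ K, 1 / 2 * c ^ 2 ≤ Γ.tubeJac i p * W p ^ 2 := by
    rintro ⟨s, t⟩ ⟨⟨hs1, hs2⟩, ht1, ht2⟩
    simp only at hs1 hs2 ht1 ht2
    have hσ : |(s - s₀) / ε - σ₁| < r := by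
      rw [show (s - s₀) / ε - σ₁ = (s - s₀ - ε * σ₁) / ε by field_simp, abs_div, abs_of_pos hε,
        div_lt_iff₀ hε, abs_lt]
      constructor <;> linarith
    have hτ : |t / ε ^ 4 - 1| < r := by
      rw [show t / ε ^ 4 - 1 = (t - ε ^ 4) / ε ^ 4 by field_simp, abs_div,
        abs_of_pos (by positivity : 0 < ε ^ 4), div_lt_iff₀ (by positivity), abs_lt]
      constructor <;> linarith
    have h1 := hlow ε _ _ hε hεr hσ hτ
    have hsδ : |s - s₀| ≤ δ / 3 := by
      refine le_trans ?_ hεδ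
      have h2 : ε * |σ₁| ≥ ε * σ₁ := by gcongr; exact le_abs_self _
      have h3 : ε * |σ₁| ≥ -(ε * σ₁) := by
        rw [← mul_neg]; gcongr; exact neg_le_abs _
      have h4 : ε * r ≤ ε * 1 := by gcongr; linarith
      rw [abs_le]; constructor <;> linarith
    have htδ : |t| ≤ δ / 3 := by
      have h4 : ε ^ 4 ≤ ε := pow_le_of_le_one hε.le hε1.le (by norm_num)
      have h5 : 0 ≤ ε * |σ₁| := by positivity
      have h6 : ε ^ 4 * r ≤ ε ^ 4 * 1 := by gcongr; linarith
      have h7 : 0 < ε ^ 4 := by positivity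
      rw [abs_le]; constructor <;> linarith
    have hp : (s, t) ∈ box s₀ δ := by
      rw [abs_le] at hsδ htδ
      exact ⟨⟨by linarith, by linarith⟩, by linarith, by linarith⟩
    have hWv : W (s, t) = ev D.α P ((s - s₀) / ε) (t / ε ^ 4) := by
      simp only [hWdef, cutEv]
      rw [hχ.eq_one _ hsδ, hχ.eq_one _ htδ]; ring
    rw [hWv]
    have h8 := pow_le_pow_left₀ hc.le h1.le 2
    rw [sq_abs] at h8
    exact mul_le_mul (h.jac_mem _ hp).1 h8 (sq_nonneg _) (h.tubeJac_pos hp).le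
  calc 1 / 2 * c ^ 2 * (4 * r ^ 2) * ε ^ 5 = 1 / 2 * c ^ 2 * volume.real K := by rw [hvol]; ring
    _ ≤ ∫ p in K, Γ.tubeJac i p * W p ^ 2 :=
      setIntegral_ge_of_const_le_real hKm hfin hpt hint.integrableOn
    _ ≤ _ := setIntegral_mono_set hint.integrableOn (Eventually.of_forall hnn)
        (Eventually.of_forall hKS)

/-- The ansatz, cut off and transported to the plane, is an approximate eigenfunction of the
Robin Laplacian. -/
theorem exists_quasimode [Fintype ι] (hΩ : IsOpen Ω) {N : ℕ}
    (D : QuasimodeData (Γ.curvature i) s₀ N) (M : ℕ) :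
    ∃ K > 0, ∃ ε₀ > 0, ∀ ε : ℝ, 0 < ε → ε < ε₀ → ∃ ψ f : Plane → ℂ, IsTest ψ ∧
      MemLp f 2 (volume.restrict Ω) ∧
      (∀ η, IsTest η →
        (((ε ^ 8) ^ 2 : ℝ) : ℂ) * (∫ x in Ω, ∑ i, pderiv i ψ x * conj (pderiv i η x))
          - ((ε ^ 12 : ℝ) : ℂ) * (∫ x, ψ x * conj (η x) ∂Γ.arcMeasure)
          - ((ε ^ 8 * D.quasi M ε : ℝ) : ℂ) * (∫ x in Ω, ψ x * conj (η x))
          = ∫ x in Ω, f x * conj (η x)) ∧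
      ∫ x in Ω, ‖f x‖ ^ 2 < (K * ε ^ (16 + M)) ^ 2 * ∫ x in Ω, ‖ψ x‖ ^ 2 := by
  obtain ⟨δ, C, χ, h, hχ, K, hK, hres⟩ := exists_isPatch_residual_le hΩ D M
  obtain ⟨c, hc, ε₀, hε₀, hlow⟩ := h.exists_le_integral_norm_pushR_sq hΩ hχ D M
  set A := 2 * K ^ 2 * √(Real.pi / (D.α / 2)) with hA
  have hα := D.α_pos
  have hApos : 0 < A := by positivity
  refine ⟨√(2 * (A / c)), by positivity, min ε₀ 1, by positivity, fun ε hε hεlt => ?_⟩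
  obtain ⟨hε0, hε1⟩ := lt_min_iff.1 hεlt
  set P := D.ansatzPoly M ε with hP
  set W := cutEv D.α s₀ ε χ χ P with hWdef
  have hW : ContDiff ℝ ∞ W := contDiff_cutEv hχ.smooth hχ.smooth P
  have hWc : HasCompactSupport W := hχ.hasCompactSupport_cutEv P
  have hWs : tsupport W ⊆ box s₀ δ := hχ.tsupport_cutEv_subset_box h.pos P
  set R := Γ.residual i (ε ^ 8) (ε ^ 8 * D.quasi M ε) W with hR
  have hRs : tsupport R ⊆ tsupport W := Γ.tsupport_residual i _ _ _
  have hRd : ContDiff ℝ ∞ R := h.contDiff_residual hW hWs _ _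
  have hRc : HasCompactSupport R := hWc.of_isClosed_subset (isClosed_tsupport _) hRs
  refine ⟨Γ.pushR i s₀ δ W, Γ.pushR i s₀ δ R, h.isTest_pushR hW hWc hWs,
    (h.isTest_pushR hRd hRc (hRs.trans hWs)).memLp _ _, fun η hη => ?_, ?_⟩
  · refine h.weak_form hΩ hW hWc hWs (fun s => ?_) hη
    -- The cutoff function is constant near the boundary, so it preserves the Robin condition.
    have hχ0 : deriv χ 0 = 0 := (hχ.deriv_eq_zero (by simpa using h.pos)).1
    rw [hWdef, dSnd_cutEv hχ.smooth hχ.smooth]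
    simp only [cutEv, hχ0, zero_div, D.ev_polyT_ansatzPoly, hP]
    field_simp
    ring
  · have h1 := h.integral_norm_pushR_sq_le hΩ hRd hRc (hRs.trans hWs) hα hε
      (hres ε · hε hε1.le)
    have h2 := hlow ε hε hε0
    have h3 : 0 < (ε ^ (16 + M)) ^ 2 := by positivity
    calc _ ≤ _ := h1
      _ = A / c * (ε ^ (16 + M)) ^ 2 * (c * ε ^ 5) := by rw [hA]; field_simp
      -- The factor `2` makes the inequality strict.
      _ < 2 * (A / c) * (ε ^ (16 + M)) ^ 2 * (c * ε ^ 5) := by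
        have : 0 < A / c * (ε ^ (16 + M)) ^ 2 * (c * ε ^ 5) := by positivity
        linarith
      _ ≤ 2 * (A / c) * (ε ^ (16 + M)) ^ 2 * ∫ x in Ω, ‖Γ.pushR i s₀ δ W x‖ ^ 2 := by gcongr
      _ = _ := by rw [mul_pow, Real.sq_sqrt (by positivity)]

end Existence

end BoundaryParam

/-! ### Eigenvalues near the quasi-eigenvalues -/

section Conclusion

/-- The quasi-eigenvalue tends to `-1`, so the interval about it stays on the negative half-line,
away from the essential spectrum that an exterior domain has. -/
theorem QuasimodeData.eventually_quasi_lt {κ : ℝ → ℝ} {s₀ : ℝ} {N : ℕ} (D : QuasimodeData κ s₀ N)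
    (M : ℕ) (K : ℝ) : ∀ᶠ ε in 𝓝 (0 : ℝ), D.quasi M ε + K * ε ^ (8 + M) < 0 := by
  have hc : Continuous fun ε => D.quasi M ε + K * ε ^ (8 + M) := by
    unfold quasi
    fun_prop
  have h0 : D.quasi M 0 = -1 := by
    rw [quasi, Finset.sum_eq_single 0]
    · simp [quasiCoef]
    · intro b _ hb; simp [hb]
    · intro h; simp at h
  refine hc.continuousAt.eventually (gt_mem_nhds ?_)
  simp only [h0]; norm_num

/-- Within less than a period of `s₀` the boundary point `M(s₀)` has only the parameter `s₀`, so
this is a local maximum of the curvature as a function of the parameter. -/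
theorem BoundaryParam.deriv_curvature_eq_zero {Ω : Set Plane} {ι : Type} (Γ : BoundaryParam Ω ι)
    (i₀ : ι) (s₀ : ℝ)
    (h_max : ∀ i s, Γ.M i s ≠ Γ.M i₀ s₀ → Γ.curvature i s < Γ.curvature i₀ s₀) :
    deriv (Γ.curvature i₀) s₀ = 0 := by
  have hl := Γ.len_pos i₀
  have hloc : IsLocalMax (Γ.curvature i₀) s₀ := by
    filter_upwards [Ioo_mem_nhds (by linarith : s₀ - Γ.len i₀ < s₀)
      (by linarith : s₀ < s₀ + Γ.len i₀)] with s hs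
    by_cases hM : Γ.M i₀ s = Γ.M i₀ s₀
    · obtain ⟨-, k, hk⟩ := Γ.simple _ _ _ _ hM
      have h1 : (k : ℝ) < 1 := by
        by_contra! hk1
        nlinarith [hs.1]
      have h2 : (-1 : ℝ) < k := by
        by_contra! hk1
        nlinarith [hs.2]
      have h3 : k = 0 := by
        have h1' : k < 1 := by exact_mod_cast h1
        have h2' : -1 < k := by exact_mod_cast h2
        omega
      rw [hk, h3]; simp
    · exact (h_max i₀ s hM).le
  exact hloc.deriv_eq_zero

/-- For small `h` there is an eigenvalue within the error of the quasimode. -/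
theorem BoundaryParam.exists_isEigenvalue_quasi {Ω : Set Plane} (hΩ : IsOpen Ω) {ι : Type}
    [Fintype ι] (Γ : BoundaryParam Ω ι) (i : ι) {s₀ : ℝ} {N : ℕ}
    (D : QuasimodeData (Γ.curvature i) s₀ N) (M : ℕ) :
    ∃ K > 0, ∀ᶠ h in 𝓝[>] (0 : ℝ), ∃ μ,
      |μ - h * quasiEigenvalue (Γ.curvature i) s₀ (N + 1) D.ζ M h|
          < K * h ^ (((M : ℝ) + 16) / 8) ∧ IsEigenvalue Γ h μ := by
  obtain ⟨K, hK, ε₀, hε₀, hq⟩ := exists_quasimode hΩ D M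
  refine ⟨K, hK, ?_⟩
  have ht : Tendsto (fun h : ℝ => h ^ (1 / 8 : ℝ)) (𝓝[>] 0) (𝓝 0) := by
    have h1 := (Real.continuous_rpow_const (by norm_num : (0 : ℝ) ≤ 1 / 8)).tendsto 0
    rw [Real.zero_rpow (by norm_num)] at h1
    exact h1.mono_left nhdsWithin_le_nhds
  filter_upwards [self_mem_nhdsWithin, ht.eventually (gt_mem_nhds hε₀),
    ht.eventually (D.eventually_quasi_lt M K)] with h hh hlt hneg
  have hh : 0 < h := hh
  rw [D.quasiEigenvalue_eq hh]
  have hε : 0 < h ^ (1 / 8 : ℝ) := Real.rpow_pos_of_pos hh _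
  have e8 : h = (h ^ (1 / 8 : ℝ)) ^ 8 := by
    rw [← QuasimodeData.rpow_eighth hh]; norm_num
  have e12 : h ^ (3 / 2 : ℝ) = (h ^ (1 / 8 : ℝ)) ^ 12 := by
    rw [← QuasimodeData.rpow_eighth hh]; norm_num
  have eM : h ^ (((M : ℝ) + 16) / 8) = (h ^ (1 / 8 : ℝ)) ^ (16 + M) := by
    rw [← QuasimodeData.rpow_eighth hh]; congr 1; push_cast; ring
  obtain ⟨ψ, f, hψ, hf, hweak, hsmall⟩ := hq _ hε hlt
  rw [eM]
  set ε := h ^ (1 / 8 : ℝ) with hεdef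
  rw [← e8, ← e12] at hweak
  refine exists_isEigenvalue_near hΩ (traceEstimate hΩ Γ) hh (by positivity) ?_ hψ hf hweak hsmall
  have : h * D.quasi M ε + K * ε ^ (16 + M) = h * (D.quasi M ε + K * ε ^ (8 + M)) := by
    rw [show 16 + M = 8 + (8 + M) by omega, pow_add ε 8 (8 + M), ← e8]; ring
  rw [this]
  exact (mul_neg_of_pos_of_neg hh hneg).le

/-- The expansion of the quasi-eigenvalue of `𝓛_h`. -/
theorem mul_quasiEigenvalue {h : ℝ} (hh : 0 < h) (κ : ℝ → ℝ) (s₀ : ℝ) (n : ℕ) (ζ : ℕ → ℝ) (M : ℕ) :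
    h * quasiEigenvalue κ s₀ n ζ M h = -h - κ s₀ * h ^ (3 / 2 : ℝ)
      + (2 * (n : ℝ) - 1) * √(-iteratedDeriv 2 κ s₀ / 2) * h ^ (7 / 4 : ℝ)
      + h ^ (15 / 8 : ℝ) * ∑ j ∈ Finset.range (M + 1), ζ j * h ^ ((j : ℝ) / 8) := by
  have e : ∀ a b : ℝ, b = a + 1 → h ^ b = h * h ^ a := fun a b hab => by
    rw [hab, Real.rpow_add_one hh.ne']; ring
  rw [quasiEigenvalue, e (1 / 2) (3 / 2) (by norm_num), e (3 / 4) (7 / 4) (by norm_num),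
    e (7 / 8) (15 / 8) (by norm_num)]
  ring

end Conclusion

end Robin

end

theorem theorem7p1 {Ω : Set Robin.Plane} (hΩ_open : IsOpen Ω) (hΩ_conn : IsConnected Ω)
    {ι : Type} [Fintype ι] (Γ : Robin.BoundaryParam Ω ι)
    -- the curvature has a unique maximum point `M i₀ s₀`, and the maximum is non-degenerate
    (i₀ : ι) (s₀ : ℝ)
    (h_max : ∀ i s, Γ.M i s ≠ Γ.M i₀ s₀ → Γ.curvature i s < Γ.curvature i₀ s₀)
    (k₂ : ℝ) (hk₂ : k₂ = - iteratedDeriv 2 (Γ.curvature i₀) s₀) (hk₂_pos : 0 < k₂)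
    (n : ℕ) (hn : 1 ≤ n) :
    ∃ ζ : ℕ → ℝ,
      Robin.IsQuasimodeExpansion (Γ.curvature i₀) s₀ n ζ ∧
      ∀ M : ℕ, ∃ μ : ℝ → ℝ,
        (∀ᶠ h in 𝓝[>] (0 : ℝ), Robin.IsEigenvalue Γ h (μ h)) ∧
        (fun h : ℝ => μ h -
            (- h - Γ.curvature i₀ s₀ * h ^ (3 / 2 : ℝ)
              + (2 * (n : ℝ) - 1) * √(k₂ / 2) * h ^ (7 / 4 : ℝ)
              + h ^ (15 / 8 : ℝ) * ∑ j ∈ Finset.range (M + 1), ζ j * h ^ ((j : ℝ) / 8)))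
          =O[𝓝[>] (0 : ℝ)] (fun h : ℝ => h ^ (((M : ℝ) + 16) / 8)) := by
  -- `N` is the degree of the Hermite polynomial.
  obtain ⟨N, rfl⟩ : ∃ N, n = N + 1 := ⟨n - 1, by omega⟩
  obtain ⟨D⟩ := Robin.nonempty_quasimodeData (Γ.contDiff_curvature i₀)
    (Γ.deriv_curvature_eq_zero i₀ s₀ h_max) (by linarith) N
  refine ⟨D.ζ, D.isQuasimodeExpansion, fun M => ?_⟩
  obtain ⟨K, hK, hev⟩ := Γ.exists_isEigenvalue_quasi hΩ_open i₀ D M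
  obtain ⟨μ, hμ⟩ := hev.choice
  refine ⟨μ, hμ.mono fun h hh => hh.2, IsBigO.of_bound K ?_⟩
  filter_upwards [hμ, self_mem_nhdsWithin] with h hh hpos
  have hpos : 0 < h := hpos
  rw [hk₂, ← Robin.mul_quasiEigenvalue hpos, Real.norm_eq_abs, Real.norm_eq_abs,
    abs_of_pos (Real.rpow_pos_of_pos hpos _)]
  exact hh.1.le
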